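/- **Proposition 5.1 (toric singularities).** Let $k$ be an algebraically closed field (of any characteristic), let $n\ge 0$, and let $X=\operatorname{Spec} R$ be a normal $n$-dimensional singularity over $k$, that is, $R$ is a Noetherian complete local normal domain of Krull dimension $n$ that is a $k$-algebra. Set $S:=k[[x_1,\dots,x_n]]$ and let $\mathbb{T}^n=(\mathbb{G}_{m,k})^n$ be the $n$-dimensional torus with its usual $k$-linear action $x_i\mapsto t_i x_i$ on $S$. Then the following are equivalent: 1. $X$ is toric and $\mathbb{Q}$-factorial. 2. $R\cong S^G$ as $k$-algebras, where $G$ is a finite subgroup scheme of $\mathbb{T}^n$ that acts on $S$ through the $\mathbb{T}^n$-action, with an action that is free in codimension one. Here $X$ is *toric* if $R$ is isomorphic, as a $k$-algebra, to the completion of the local ring of a normal toric variety $X(\Delta)$ over $k$ (the variety of a fan $\Delta$ in some $\mathbb{R}^r$ with lattice $\mathbb{Z}^r$, glued from the charts $\operatorname{Spec} k[\sigma^\vee\cap M]$, $\sigma\in\Delta$) at a closed point; $X$ is *$\mathbb{Q}$-factorial* if every Weil divisor on $X$ has a positive multiple that is Cartier; and the action of $G$ is *free in codimension one* if there is a $G$-stable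 open subset $V\subseteq\operatorname{Spec} S$ whose complement has codimension at least two, such that $V\times_k G\to V\times_{\operatorname{Spec} S^G}V$, $(v,g)\mapsto(v,gv)$, is an isomorphism. -/

import Mathlib

open AlgebraicGeometry CategoryTheory TensorProduct

universe u v

noncomputable section

namespace ToricSing

/-! ### Fans and normal toric varieties -/

/-- A fan in `N_ℝ = ℝ^r` with respect to the lattice `N = ℤ^r`: a finite set of strongly convex
rational polyhedral cones that contains every face of each of its cones, and in which any two cones
meet in a common face. -/
structure Fan (r : ℕ) where
  cones : Set (PointedCone ℝ (Fin r → ℝ))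
  finite : cones.Finite
  rational : ∀ σ ∈ cones, ∃ s : Finset (Fin r → ℤ),
    σ = PointedCone.hull ℝ ((fun v : Fin r → ℤ => fun i => (v i : ℝ)) '' (s : Set (Fin r → ℤ)))
  stronglyConvex : ∀ σ ∈ cones, ∀ v ∈ σ, -v ∈ σ → v = 0
  face_mem : ∀ σ ∈ cones, ∀ τ : PointedCone ℝ (Fin r → ℝ), τ.IsFaceOf σ → τ ∈ cones
  inter_isFaceOf : ∀ σ ∈ cones, ∀ τ ∈ cones, (σ ⊓ τ).IsFaceOf σ

/-- The monoid `S_σ = σ^∨ ∩ M` of lattice points of the dual cone, where `M = ℤ^r` is the dual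
lattice, paired with `N_ℝ = ℝ^r` in the usual way. -/
def dualMonoid {r : ℕ} (σ : PointedCone ℝ (Fin r → ℝ)) : AddSubmonoid (Fin r → ℤ) where
  carrier := {m | ∀ v ∈ σ, 0 ≤ ∑ i, (m i : ℝ) * v i}
  zero_mem' := by intro v _; simp
  add_mem' := by
    intro a b ha hb v hv
    have := add_nonneg (ha v hv) (hb v hv)
    simpa [add_mul, Finset.sum_add_distrib] using this

theorem dualMonoid_anti {r : ℕ} {τ σ : PointedCone ℝ (Fin r → ℝ)} (h : τ ≤ σ) :
    dualMonoid σ ≤ dualMonoid τ :=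
  fun _ hm v hv => hm v (h hv)

/-- The coordinate ring `k[S_σ]` of the affine toric variety `U_σ`. -/
abbrev ChartRing (k : Type u) [Field k] {r : ℕ} (σ : PointedCone ℝ (Fin r → ℝ)) : Type u :=
  AddMonoidAlgebra k (dualMonoid σ)

/-- The affine toric variety `U_σ = Spec k[S_σ]`. -/
abbrev chart (k : Type u) [Field k] {r : ℕ} (σ : PointedCone ℝ (Fin r → ℝ)) : Scheme.{u} :=
  Spec (CommRingCat.of (ChartRing k σ))

/-- The structure morphism `U_σ ⟶ Spec k`. -/
def chartStructure (k : Type u) [Field k] {r : ℕ} (σ : PointedCone ℝ (Fin r → ℝ)) :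
    chart k σ ⟶ Spec (CommRingCat.of k) :=
  Spec.map (CommRingCat.ofHom (algebraMap k (ChartRing k σ)))

/-- The morphism `U_τ ⟶ U_σ` induced by `τ ⊆ σ`. -/
def chartMap (k : Type u) [Field k] {r : ℕ} {τ σ : PointedCone ℝ (Fin r → ℝ)} (h : τ ≤ σ) :
    chart k τ ⟶ chart k σ :=
  Spec.map (CommRingCat.ofHom
    (AddMonoidAlgebra.mapDomainRingHom k
      (AddSubmonoid.inclusion (dualMonoid_anti h))))

/-- An identification of the `k`-scheme `p : X ⟶ Spec k` with the toric variety `X(Δ)` of the fan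
`Δ`: the scheme `X` is glued from the charts `U_σ`, `σ ∈ Δ`, where `U_σ` and `U_τ` are glued along
their common open subscheme `U_{σ ∩ τ}`. -/
structure ToricVariety {k : Type u} [Field k] {r : ℕ} (Δ : Fan r)
    (X : Scheme.{u}) (p : X ⟶ Spec (CommRingCat.of k)) where
  ι : ∀ σ ∈ Δ.cones, chart k σ ⟶ X
  isOpenImmersion : ∀ σ hσ, IsOpenImmersion (ι σ hσ)
  ι_comp : ∀ σ hσ, ι σ hσ ≫ p = chartStructure k σ
  chartMap_comp : ∀ τ hτ σ hσ, ∀ h : τ ≤ σ, chartMap k h ≫ ι σ hσ = ι τ hτ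
  covers : ∀ x : X, ∃ σ hσ, x ∈ Set.range (ι σ hσ)
  inter : ∀ σ hσ τ hτ, ∀ hi : σ ⊓ τ ∈ Δ.cones,
    Set.range (ι σ hσ) ∩ Set.range (ι τ hτ) = Set.range (ι (σ ⊓ τ) hi)

/-- The `k`-algebra structure map `k → 𝒪_{X,x}` of a local ring of a `k`-scheme. -/
def stalkStructure {k : Type u} [Field k] {X : Scheme.{u}} (p : X ⟶ Spec (CommRingCat.of k))
    (x : X) : k →+* X.presheaf.stalk x :=
  (Spec.preimage (X.fromSpecStalk x ≫ p)).hom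

/-- The completed local ring of the scheme `X` at `x`. -/
abbrev CompletedStalk (X : Scheme.{u}) (x : X) : Type u :=
  AdicCompletion (IsLocalRing.maximalIdeal (X.presheaf.stalk x)) (X.presheaf.stalk x)

/-- The `k`-algebra `R` (to be thought of as the singularity `Spec R`) is toric: it is, as a
`k`-algebra, the completion of the local ring of a normal toric variety at a closed point. -/
def IsToric (k : Type u) [Field k] (R : Type v) [CommRing R] [Algebra k R] : Prop :=
  ∃ (r : ℕ) (Δ : Fan r) (X : Scheme.{u}) (p : X ⟶ Spec (CommRingCat.of k))
    (_ : ToricVariety Δ X p) (x : X), IsClosed ({x} : Set X) ∧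
    ∃ e : R ≃+* CompletedStalk X x, ∀ c : k,
      e (algebraMap k R c) =
        algebraMap (X.presheaf.stalk x) (CompletedStalk X x) (stalkStructure p x c)

/-! ### Weil divisors and `ℚ`-factoriality -/

/-- The prime divisors of `Spec R`: the prime ideals of height one. -/
abbrev PrimeDivisor (R : Type v) [CommRing R] : Type v :=
  {P : PrimeSpectrum R // P.asIdeal.height = 1}

/-- Weil divisors on `Spec R`, for a Noetherian ring `R`. -/
abbrev WeilDivisor (R : Type v) [CommRing R] : Type v := PrimeDivisor R →₀ ℤ

/-- The order of vanishing `length (R_P / a R_P)` of `a` along the prime divisor `P`. It is finite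
for all `a ≠ 0` when `R` is a Noetherian domain. -/
def ordAlong {R : Type v} [CommRing R] (P : PrimeDivisor R) (a : R) : ℤ :=
  ((Ring.ord (Localization.AtPrime P.1.asIdeal)
    (algebraMap R (Localization.AtPrime P.1.asIdeal) a)).toNat : ℤ)

/-- A Weil divisor on `Spec R`, with `R` a Noetherian normal domain, is Cartier if locally it is
the divisor of a rational function `a / b`. The open neighbourhoods are the sets `D(g)`. -/
def WeilDivisor.IsCartier {R : Type v} [CommRing R] (D : WeilDivisor R) : Prop :=
  ∀ Q : PrimeSpectrum R, ∃ g : R, g ∉ Q.asIdeal ∧ ∃ a b : R, a ≠ 0 ∧ b ≠ 0 ∧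
    ∀ P : PrimeDivisor R, g ∉ P.1.asIdeal → D P = ordAlong P a - ordAlong P b

/-- The normal scheme `Spec R` is `ℚ`-factorial: every Weil divisor has a positive multiple that is
Cartier. -/
def IsQFactorial (R : Type v) [CommRing R] : Prop :=
  ∀ D : WeilDivisor R, ∃ m : ℕ, 0 < m ∧ WeilDivisor.IsCartier (m • D)

/-! ### Finite subgroup schemes of the torus and their action on `k[[x₁, …, xₙ]]` -/

/-- The coordinate ring `k[t₁^{±1}, …, tₙ^{±1}] = k[ℤ^n]` of the torus `𝕋^n = (𝔾_m)^n`, with its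
Hopf algebra structure, for which the monomials are group-like. -/
abbrev TorusRing (k : Type u) [Field k] (n : ℕ) : Type u := AddMonoidAlgebra k (Fin n → ℤ)

/-- A finite subgroup scheme `G` of the torus `𝕋^n` over `k`: a closed subgroup scheme, that is, a
Hopf ideal of the coordinate ring of `𝕋^n`, which is finite over `k`. -/
structure FiniteTorusSubgroup (k : Type u) [Field k] (n : ℕ) where
  ideal : Ideal (TorusRing k n)
  isHopfIdeal : ideal.IsHopfIdeal k
  finite : Module.Finite k (TorusRing k n ⧸ ideal)

/-- The power series ring `S = k[[x₁, …, xₙ]]`. -/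
abbrev PowerSeriesRing (k : Type u) [Field k] (n : ℕ) : Type u := MvPowerSeries (Fin n) k

namespace FiniteTorusSubgroup

variable {k : Type u} [Field k] {n : ℕ} (G : FiniteTorusSubgroup k n)

/-- The coordinate ring `H⁰(G, 𝒪_G)`. -/
abbrev CoordRing : Type u := TorusRing k n ⧸ G.ideal

/-- The restriction to `G` of the `i`-th coordinate function `tᵢ` of the torus. -/
def coord (i : Fin n) : G.CoordRing :=
  Ideal.Quotient.mk G.ideal (AddMonoidAlgebra.single (Pi.single i 1) 1)

/-- The coordinate ring of `G × Spec S`, that is `S ⊗ₖ H⁰(G, 𝒪_G)`, which is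
`H⁰(G, 𝒪_G)[[x₁, …, xₙ]]` since `G` is finite over `k`. -/
abbrev ProductRing : Type u := MvPowerSeries (Fin n) G.CoordRing

/-- The ring map of the projection `G × Spec S → Spec S`. -/
def proj : PowerSeriesRing k n →ₐ[k] G.ProductRing :=
  MvPowerSeries.mapAlgHom (Algebra.ofId k G.CoordRing)

/-- The coaction, that is, the ring map of the action `G × Spec S → Spec S` of `G ⊆ 𝕋^n` through the
usual `k`-linear action of the torus: `f(x₁, …, xₙ) ↦ f(t₁ x₁, …, tₙ xₙ)`. -/
def coaction : PowerSeriesRing k n →ₐ[k] G.ProductRing where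
  toRingHom := (MvPowerSeries.rescale G.coord).comp G.proj.toRingHom
  commutes' c := by
    ext e
    have h : G.proj.toRingHom (algebraMap k (PowerSeriesRing k n) c) =
        MvPowerSeries.C (algebraMap k G.CoordRing c) :=
      (G.proj.commutes c).trans (by simp [MvPowerSeries.algebraMap_apply])
    change MvPowerSeries.coeff e (MvPowerSeries.rescale G.coord (G.proj.toRingHom _)) = _
    classical
    rw [h, MvPowerSeries.coeff_rescale, MvPowerSeries.algebraMap_apply, MvPowerSeries.coeff_C]
    split_ifs with he
    · subst he
      simp
    · simp

/-- The invariant ring `S^G`. -/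
def invariants : Subalgebra k (PowerSeriesRing k n) := AlgHom.equalizer G.coaction G.proj

/-- `proj` is linear over the invariants. -/
def projInv : PowerSeriesRing k n →ₐ[G.invariants] G.ProductRing where
  toRingHom := G.proj.toRingHom
  commutes' _ := rfl

/-- `coaction` is linear over the invariants. -/
def coactionInv : PowerSeriesRing k n →ₐ[G.invariants] G.ProductRing where
  toRingHom := G.coaction.toRingHom
  commutes' a := a.2

/-- The ring map `S ⊗_{S^G} S → S ⊗ₖ H⁰(G, 𝒪_G)`, `a ⊗ b ↦ proj a * coaction b`, of the morphism
`Spec S × G → Spec S ×_{Spec S^G} Spec S`, `(v, g) ↦ (v, g v)`. -/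
def canonicalMap :
    PowerSeriesRing k n ⊗[G.invariants] PowerSeriesRing k n →ₐ[G.invariants] G.ProductRing :=
  Algebra.TensorProduct.productMap G.projInv G.coactionInv

/-- The fibre product `Spec S ×_{Spec S^G} Spec S`. -/
abbrev fibreSquare : Scheme.{u} :=
  Spec (CommRingCat.of (PowerSeriesRing k n ⊗[G.invariants] PowerSeriesRing k n))

/-- For `V` open in `Spec S`, the open subset `V ×_{Spec S^G} V` of the fibre product. -/
def openSquare (V : (Spec (CommRingCat.of (PowerSeriesRing k n))).Opens) : G.fibreSquare.Opens :=
  (Spec.map (CommRingCat.ofHom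
    (Algebra.TensorProduct.includeLeft : PowerSeriesRing k n →ₐ[G.invariants]
      PowerSeriesRing k n ⊗[G.invariants] PowerSeriesRing k n).toRingHom) ⁻¹ᵁ V) ⊓
  (Spec.map (CommRingCat.ofHom
    (Algebra.TensorProduct.includeRight : PowerSeriesRing k n →ₐ[G.invariants]
      PowerSeriesRing k n ⊗[G.invariants] PowerSeriesRing k n).toRingHom) ⁻¹ᵁ V)

/-- The action of `G` on `Spec S` is free in codimension one: there is a `G`-stable open subset `V`
of `Spec S` whose complement has codimension at least two, and on which the action is free in the
scheme sense, that is, `V × G → V ×_{Spec S^G} V`, `(v, g) ↦ (v, g v)`, is an isomorphism.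
(As `V` is stable, the restriction of `Spec S × G → Spec S ×_{Spec S^G} Spec S` over the open subset
`V ×_{Spec S^G} V` has source `V × G`.) -/
def IsFreeInCodimOne : Prop :=
  ∃ V : (Spec (CommRingCat.of (PowerSeriesRing k n))).Opens,
    (∀ P : PrimeSpectrum (PowerSeriesRing k n), P ∉ V → 2 ≤ P.asIdeal.height) ∧
    Spec.map (CommRingCat.ofHom G.coaction.toRingHom) ⁻¹ᵁ V =
      Spec.map (CommRingCat.ofHom G.proj.toRingHom) ⁻¹ᵁ V ∧
    IsIso (Spec.map (CommRingCat.ofHom G.canonicalMap.toRingHom) ∣_ (G.openSquare V))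

end FiniteTorusSubgroup

end ToricSing

end

noncomputable section

namespace ToricSing

/-! ### Completions -/

/-! Both conditions are compared with one family of rings: for a subgroup `Λ` of `ℤ^ι`, the ring
`k[[ℕ^ι ∩ Λ]]` of power series whose exponents lie in `Λ` (`supportedSeries k (latticeMonoid Λ)`).
It is the completion at the origin of the monoid algebra of `ℕ^ι ∩ Λ`
(`exists_supportedSeries_equiv_adicCompletion`).

From quotients to toric: the characters of the torus trivial on `G` form a lattice `Λ` of finite
index, and `S^G = k[[ℕ^n ∩ Λ]]` (`invariants_eq`). In a basis of `Λ` the coordinate functions span a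
simplicial cone whose dual monoid is `ℕ^n ∩ Λ`, so the ring is toric
(`isToric_of_equiv_supportedSeries`). It is `ℚ`-factorial because the factorial ring `S` is finite
over it (`isQFactorial_of_finite_ufd`): over each prime divisor lies a prime element of `S`, and its
norm vanishes along that divisor alone.

From toric to quotients: the smallest chart containing the closed point is presented by the
primitive equations of its facets together with free unit coordinates. Translating the units to the
origin gives `R ≅ k[[ℕ^ι ∩ Λ]]` (`IsToric.exists_equiv_supportedSeries`). Here each coordinate takes
the value 1 on `Λ` (primitivity), and for each `i` some element of `Λ` vanishes at `i` and is
positive elsewhere (irredundancy). If a multiple of the divisor `x i = 0` is principal, its equation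
is a unit times a monomial, and irredundancy makes that monomial a power of `x i`. So `Λ` contains a
multiple of every unit vector (`exists_single_mem_of_isQFactorial`) and has finite index; comparing
dimensions gives `|ι| = n`.

The group is then the diagonalizable group with character group `ℤ^n / Λ`. Since the `i`-th
coordinate takes the value 1 on `Λ`, this group is generated by the unit vectors other than the
`i`-th. Hence wherever all `x j` with `j ≠ i` are invertible, every character of `G` is the weight
of an invertible monomial, and the action is free there. The complement of these loci lies where two
coordinates vanish (`isFreeInCodimOne_of_forall`). -/

theorem exists_equiv_adicCompletion {C T : Type*} [CommRing C] [CommRing T] (I : Ideal C)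
    (J : Ideal T) [IsAdicComplete J T] (g : C →+* T) (hg : ∀ j, (J ^ j).comap g = I ^ j)
    (hd : ∀ (j : ℕ) (t : T), ∃ c, t - g c ∈ J ^ j) :
    ∃ e : T ≃+* AdicCompletion I C, ∀ c, e (g c) = algebraMap C (AdicCompletion I C) c := by
  -- By `hg` and `hd`, `g` induces isomorphisms `C / I^j ≅ T / J^j`. Their inverses assemble into
  -- `F`, and completeness of `T` makes `F` bijective.
  have hinj (j : ℕ) : Function.Injective (Ideal.quotientMap (J ^ j) g (hg j).ge) :=
    Ideal.quotientMap_injective' (hg j).le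
  have hsurj (j : ℕ) : Function.Surjective (Ideal.quotientMap (J ^ j) g (hg j).ge) := by
    intro t
    obtain ⟨t, rfl⟩ := Ideal.Quotient.mk_surjective t
    obtain ⟨c, hc⟩ := hd j t
    exact ⟨Ideal.Quotient.mk _ c, by
      rw [Ideal.quotientMap_mk, eq_comm, Ideal.Quotient.eq]; exact hc⟩
  let q (j : ℕ) : C ⧸ I ^ j ≃+* T ⧸ J ^ j := RingEquiv.ofBijective _ ⟨hinj j, hsurj j⟩
  let ψ (j : ℕ) : T →+* C ⧸ I ^ j := (q j).symm.toRingHom.comp (Ideal.Quotient.mk _)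
  have hψ (j : ℕ) (t : T) (c : C) (h : t - g c ∈ J ^ j) : ψ j t = Ideal.Quotient.mk _ c := by
    apply (q j).injective
    change q j ((q j).symm _) = Ideal.Quotient.mk _ (g c)
    rw [RingEquiv.apply_symm_apply, Ideal.Quotient.eq]
    exact h
  have hcompat : ∀ {m n : ℕ} (hle : m ≤ n),
      (Ideal.Quotient.factorPow I hle).comp (ψ n) = ψ m := by
    intro m n hle
    ext t
    obtain ⟨c, hc⟩ := hd n t
    rw [RingHom.comp_apply, hψ n t c hc, hψ m t c (Ideal.pow_le_pow_right hle hc)]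
    rfl
  let F := AdicCompletion.liftRingHom I ψ hcompat
  have hF (j : ℕ) (t : T) : AdicCompletion.evalₐ I j (F t) = ψ j t :=
    AdicCompletion.evalₐ_liftRingHom ..
  have hbij : Function.Bijective F := by
    constructor
    · rw [injective_iff_map_eq_zero]
      intro t ht
      refine IsHausdorff.haus (I := J) inferInstance t fun j => ?_
      rw [SModEq.zero, smul_eq_mul, Ideal.mul_top]
      have h := hF j t
      rw [ht, map_zero] at h
      have : Ideal.Quotient.mk (J ^ j) t = 0 := by
        rw [← map_zero (q j), h]; exact ((q j).apply_symm_apply _).symm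
      exact Ideal.Quotient.eq_zero_iff_mem.1 this
    · intro x
      obtain ⟨r, rfl⟩ := AdicCompletion.mk_surjective I C x
      obtain ⟨t, ht⟩ := IsPrecomplete.prec (I := J) (M := T) inferInstance
        (f := fun j => g (r j)) (by
          intro m n hmn
          rw [SModEq.sub_mem, smul_eq_mul, Ideal.mul_top, ← map_sub, ← Ideal.mem_comap, hg,
            ← Ideal.Quotient.eq]
          exact (AdicCompletion.Ideal.mk_eq_mk I hmn r).symm)
      refine ⟨t, AdicCompletion.ext_evalₐ fun j => ?_⟩
      rw [hF, AdicCompletion.evalₐ_mk]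
      apply hψ
      have := ht j
      rw [SModEq.sub_mem, smul_eq_mul, Ideal.mul_top] at this
      rw [← neg_sub]; exact neg_mem this
  refine ⟨RingEquiv.ofBijective F hbij, fun c => AdicCompletion.ext_evalₐ fun j => ?_⟩
  rw [RingEquiv.ofBijective_apply, hF, hψ j (g c) c (by simp)]
  rfl

/-! ### Power series supported on a monoid of exponents -/

variable (k : Type u) [Field k] {ι : Type}

/-- The algebra of power series whose exponents lie in the monoid `P`. -/
def supportedSeries (P : AddSubmonoid (ι →₀ ℕ)) : Subalgebra k (MvPowerSeries ι k) where
  carrier := {f | ∀ m ∉ P, MvPowerSeries.coeff m f = 0}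
  add_mem' ha hb m hm := by rw [map_add, ha m hm, hb m hm, add_zero]
  mul_mem' {a b} ha hb m hm := by
    classical
    rw [MvPowerSeries.coeff_mul]
    refine Finset.sum_eq_zero fun p hp => ?_
    rw [Finset.HasAntidiagonal.mem_antidiagonal] at hp
    by_cases h1 : p.1 ∈ P
    · by_cases h2 : p.2 ∈ P
      · exact absurd (hp ▸ P.add_mem h1 h2) hm
      · rw [hb _ h2, mul_zero]
    · rw [ha _ h1, zero_mul]
  algebraMap_mem' r m hm := by
    classical
    rw [MvPowerSeries.algebraMap_apply, MvPowerSeries.coeff_C, if_neg]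
    rintro rfl
    exact hm P.zero_mem

variable {k}

theorem mem_supportedSeries {P : AddSubmonoid (ι →₀ ℕ)} {f : MvPowerSeries ι k} :
    f ∈ supportedSeries k P ↔ ∀ m ∉ P, MvPowerSeries.coeff m f = 0 := Iff.rfl

theorem monomial_mem_supportedSeries {P : AddSubmonoid (ι →₀ ℕ)} {m : ι →₀ ℕ} (hm : m ∈ P)
    (c : k) : MvPowerSeries.monomial m c ∈ supportedSeries k P := by
  classical
  intro m' hm'
  rw [MvPowerSeries.coeff_monomial, if_neg]
  rintro rfl
  exact hm' hm

/-- The exponents that are sums of `j` nonzero elements of `P` and an element of `P`. -/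
def decomposable (P : AddSubmonoid (ι →₀ ℕ)) : ℕ → Set (ι →₀ ℕ)
  | 0 => P
  | j + 1 => {m | ∃ a ∈ P, a ≠ 0 ∧ ∃ b ∈ decomposable P j, a + b = m}

section decomposable

variable {P : AddSubmonoid (ι →₀ ℕ)}

theorem add_mem_decomposable {j : ℕ} {a b : ι →₀ ℕ} (ha : a ∈ P) (hb : b ∈ decomposable P j) :
    a + b ∈ decomposable P j := by
  induction j generalizing b with
  | zero => exact P.add_mem ha hb
  | succ j ih =>
    obtain ⟨c, hc, hc0, d, hd, rfl⟩ := hb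
    exact ⟨c, hc, hc0, a + d, ih hd, by abel⟩

theorem decomposable_subset {j : ℕ} : decomposable P j ⊆ P := by
  induction j with
  | zero => exact subset_rfl
  | succ j ih =>
    rintro _ ⟨c, hc, -, d, hd, rfl⟩
    exact P.add_mem hc (ih hd)

theorem le_degree_of_mem_decomposable {j : ℕ} {m : ι →₀ ℕ} (h : m ∈ decomposable P j) :
    j ≤ m.degree := by
  induction j generalizing m with
  | zero => exact Nat.zero_le _
  | succ j ih =>
    obtain ⟨c, hc, hc0, d, hd, rfl⟩ := h
    rw [map_add]
    have := ih hd
    have : c.degree ≠ 0 := fun h => hc0 ((Finsupp.degree_eq_zero_iff c).1 h)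
    omega

theorem mem_decomposable_one {m : ι →₀ ℕ} : m ∈ decomposable P 1 ↔ m ∈ P ∧ m ≠ 0 := by
  constructor
  · rintro ⟨a, ha, ha0, b, hb, rfl⟩
    exact ⟨P.add_mem ha hb, by simp [ha0]⟩
  · rintro ⟨h, h0⟩
    exact ⟨m, h, h0, 0, P.zero_mem, add_zero m⟩

/-- Serves to divide a series by finitely many monomials: the nonzero generators of `P` suffice. -/
theorem exists_finset_split (hP : P.FG) : ∃ s : Finset (ι →₀ ℕ), (∀ g ∈ s, g ∈ P ∧ g ≠ 0) ∧
    ∀ a ∈ P, a ≠ 0 → ∃ g ∈ s, ∃ b ∈ P, a = g + b := by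
  classical
  obtain ⟨s, rfl⟩ := hP
  refine ⟨s.filter (· ≠ 0), fun g hg => ?_, fun a ha => ?_⟩
  · rw [Finset.mem_filter] at hg
    exact ⟨AddSubmonoid.subset_closure hg.1, hg.2⟩
  · induction ha using AddSubmonoid.closure_induction with
    | mem x hx => exact fun h => ⟨x, by simp_all, 0, zero_mem _, by simp⟩
    | zero => exact fun h => absurd rfl h
    | add x y hx hy ihx ihy =>
      intro h
      by_cases h0 : x = 0
      · subst h0
        rw [zero_add] at h ⊢
        exact ihy h
      · obtain ⟨g, hg, b, hb, rfl⟩ := ihx h0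
        exact ⟨g, hg, b + y, add_mem hb hy, by abel⟩

end decomposable

variable (k) in
/-- The ideal of series without constant term. -/
def originIdeal (P : AddSubmonoid (ι →₀ ℕ)) : Ideal (supportedSeries k P) :=
  RingHom.ker ((MvPowerSeries.constantCoeff (σ := ι) (R := k)).comp
    (supportedSeries k P).val.toRingHom)

/-! ### Powers of the ideal of the origin, and completeness -/

section powers

variable {P : AddSubmonoid (ι →₀ ℕ)}

theorem mem_originIdeal {f : supportedSeries k P} :
    f ∈ originIdeal k P ↔ MvPowerSeries.constantCoeff (f : MvPowerSeries ι k) = 0 := Iff.rfl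

theorem mem_originIdeal_iff_decomposable {f : supportedSeries k P} :
    f ∈ originIdeal k P ↔ ∀ m ∉ decomposable P 1, MvPowerSeries.coeff m f.1 = 0 := by
  rw [mem_originIdeal]
  constructor
  · intro h m hm
    rw [mem_decomposable_one, not_and_or, not_not] at hm
    rcases hm with hm | rfl
    · exact f.2 m hm
    · exact h
  · intro h
    exact h 0 (by simp [mem_decomposable_one])

/-- Turns ideal-theoretic congruences into conditions on coefficients. Finite generation matters for
the converse: a series with infinitely many terms has to be written as a finite sum of products, so
its terms are grouped by one chosen generator dividing each exponent. -/
theorem mem_originIdeal_pow (hP : P.FG) {j : ℕ} {f : supportedSeries k P} :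
    f ∈ originIdeal k P ^ j ↔ ∀ m ∉ decomposable P j, MvPowerSeries.coeff m f.1 = 0 := by
  classical
  constructor
  · induction j generalizing f with
    | zero => exact fun _ => f.2
    | succ j ih =>
      rw [pow_succ']
      intro h
      induction h using Submodule.mul_induction_on' with
      | mem_mul_mem a ha b hb =>
        intro m hm
        rw [MulMemClass.coe_mul, MvPowerSeries.coeff_mul]
        refine Finset.sum_eq_zero fun p hp => ?_
        rw [Finset.HasAntidiagonal.mem_antidiagonal] at hp
        by_cases h1 : p.1 ∈ decomposable P 1
        · by_cases h2 : p.2 ∈ decomposable P j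
          · rw [mem_decomposable_one] at h1
            exact absurd ⟨p.1, h1.1, h1.2, p.2, h2, hp⟩ hm
          · rw [ih hb _ h2, mul_zero]
        · rw [mem_originIdeal_iff_decomposable.1 ha _ h1, zero_mul]
      | add a _ b _ ha hb =>
        intro m hm
        rw [AddMemClass.coe_add, map_add, ha m hm, hb m hm, add_zero]
  · induction j generalizing f with
    | zero => simp
    | succ j ih =>
      intro h
      obtain ⟨s, hs, hsplit⟩ := exists_finset_split hP
      have hch : ∀ m ∈ decomposable P (j + 1), ∃ g ∈ s, ∃ b ∈ decomposable P j, g + b = m := by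
        rintro _ ⟨a, ha, ha0, b, hb, rfl⟩
        obtain ⟨g, hg, c, hc, rfl⟩ := hsplit a ha ha0
        exact ⟨g, hg, c + b, add_mem_decomposable hc hb, by abel⟩
      -- Each exponent `m` is charged to exactly one generator `γ m`. `F g` collects the terms
      -- charged to `g`, divided by the monomial of `g`, so that `f` is the sum of the products.
      choose! γ hγs β hβ hγβ using hch
      let F (g : ι →₀ ℕ) : MvPowerSeries ι k := fun b =>
        if g + b ∈ decomposable P (j + 1) ∧ γ (g + b) = g then MvPowerSeries.coeff (g + b) f.1 else 0
      have hcF (g b) : MvPowerSeries.coeff b (F g) =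
        if g + b ∈ decomposable P (j + 1) ∧ γ (g + b) = g then
          MvPowerSeries.coeff (g + b) f.1 else 0 := rfl
      have hF (g b) (hb : b ∉ decomposable P j) : MvPowerSeries.coeff b (F g) = 0 := by
        rw [hcF, if_neg]
        rintro ⟨h1, h2⟩
        have := hγβ _ h1
        rw [h2, add_right_inj] at this
        exact hb (this ▸ hβ _ h1)
      let F' (g : ι →₀ ℕ) : supportedSeries k P :=
        ⟨F g, fun m hm => hF g m fun h => hm (decomposable_subset h)⟩
      have key : f = ∑ g ∈ s.attach, (⟨MvPowerSeries.monomial g.1 1,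
          monomial_mem_supportedSeries (hs g.1 g.2).1 1⟩ : supportedSeries k P) * F' g.1 := by
        ext m
        rw [AddSubmonoidClass.coe_finsetSum, map_sum]
        simp only [MulMemClass.coe_mul]
        rw [Finset.sum_attach s (fun g => MvPowerSeries.coeff m (MvPowerSeries.monomial g 1 * F g))]
        simp only [MvPowerSeries.coeff_monomial_mul, one_mul, hcF]
        by_cases hm : m ∈ decomposable P (j + 1)
        · rw [Finset.sum_eq_single (γ m)]
          · have hle : γ m ≤ m := by
              conv_rhs => rw [← hγβ m hm]
              exact le_self_add
            rw [if_pos hle, add_tsub_cancel_of_le hle, if_pos ⟨hm, rfl⟩]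
          · intro g _ hg
            split_ifs with h1 h2
            · rw [add_tsub_cancel_of_le h1] at h2
              exact absurd h2.2.symm hg
            · rfl
            · rfl
          · exact fun hn => absurd (hγs m hm) hn
        · rw [h m hm, Finset.sum_eq_zero]
          intro g _
          split_ifs with h1 h2
          · rw [add_tsub_cancel_of_le h1] at h2
            exact absurd h2.1 hm
          · rfl
          · rfl
      rw [key, pow_succ']
      refine sum_mem fun g _ => Ideal.mul_mem_mul ?_ (ih fun m hm => hF g.1 m hm)
      rw [mem_originIdeal]
      change MvPowerSeries.coeff 0 (MvPowerSeries.monomial g.1 (1 : k)) = 0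
      rw [MvPowerSeries.coeff_monomial, if_neg (hs g.1 g.2).2.symm]

theorem isAdicComplete_originIdeal (hP : P.FG) :
    IsAdicComplete (originIdeal k P) (supportedSeries k P) where
  haus' f hf := by
    ext m
    have := hf (m.degree + 1)
    rw [SModEq.zero, smul_eq_mul, Ideal.mul_top, mem_originIdeal_pow hP] at this
    exact this m fun h => by have := le_degree_of_mem_decomposable h; omega
  prec' f hf := by
    simp only [SModEq.sub_mem, smul_eq_mul, Ideal.mul_top, mem_originIdeal_pow hP,
      AddSubgroupClass.coe_sub, map_sub, sub_eq_zero] at hf ⊢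
    -- Elements of `decomposable P (m.degree + 1)` have degree larger than that of `m`, so the
    -- coefficient at `m` is constant from stage `m.degree + 1` on.
    refine ⟨⟨fun m => MvPowerSeries.coeff m (f (m.degree + 1)).1,
      fun m hm => (f (m.degree + 1)).2 m hm⟩, fun n m hm => ?_⟩
    change _ = MvPowerSeries.coeff m (f (m.degree + 1)).1
    rcases le_total n (m.degree + 1) with h | h
    · exact hf h m hm
    · refine (hf h m fun h => ?_).symm
      have := le_degree_of_mem_decomposable h
      omega

end powers

/-- By completeness the origin ideal lies in the Jacobson radical, and `f` differs from a nonzero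
constant by an element of it. -/
theorem isUnit_supportedSeries_of_constantCoeff_ne_zero {P : AddSubmonoid (ι →₀ ℕ)} (hP : P.FG)
    {f : supportedSeries k P}
    (hf : MvPowerSeries.constantCoeff (f : MvPowerSeries ι k) ≠ 0) : IsUnit f := by
  have := isAdicComplete_originIdeal (k := k) hP
  have hJ := IsAdicComplete.le_jacobson_bot (originIdeal k P)
  set c := MvPowerSeries.constantCoeff (f : MvPowerSeries ι k)
  have h1 : f - algebraMap k _ c ∈ originIdeal k P := by
    rw [mem_originIdeal, AddSubgroupClass.coe_sub, map_sub]
    simp [c, MvPowerSeries.algebraMap_apply]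
  have h2 := Ideal.mem_jacobson_bot.1 (hJ h1) (algebraMap k _ c⁻¹)
  have h3 : f * algebraMap k _ c⁻¹ =
      (f - algebraMap k _ c) * algebraMap k (supportedSeries k P) c⁻¹ + 1 := by
    rw [sub_mul, ← map_mul, mul_inv_cancel₀ hf, map_one]; ring
  rw [← h3] at h2
  exact isUnit_of_mul_isUnit_left h2

/-- The polynomials among the series supported on `P`. -/
def toSeries (P : AddSubmonoid (ι →₀ ℕ)) : AddMonoidAlgebra k P →ₐ[k] supportedSeries k P :=
  AddMonoidAlgebra.lift k (supportedSeries k P) P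
    { toFun := fun p => ⟨MvPowerSeries.monomial p.toAdd.1 1,
        monomial_mem_supportedSeries p.toAdd.2 1⟩
      map_one' := rfl
      map_mul' := fun a b => Subtype.ext <| by
        simp [MvPowerSeries.monomial_mul_monomial] }

theorem toSeries_single (P : AddSubmonoid (ι →₀ ℕ)) (p : P) (c : k) :
    (toSeries P (AddMonoidAlgebra.single p c)).1 = MvPowerSeries.monomial p.1 c := by
  rw [toSeries, AddMonoidAlgebra.lift_single]
  change c • MvPowerSeries.monomial p.1 (1 : k) = _
  rw [← map_smul, smul_eq_mul, mul_one]

theorem coeff_toSeries (P : AddSubmonoid (ι →₀ ℕ)) (b : AddMonoidAlgebra k P) (p : P) :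
    MvPowerSeries.coeff p.1 (toSeries P b).1 = b.coeff p := by
  classical
  induction b using AddMonoidAlgebra.induction_linear with
  | zero => simp
  | add f g hf hg => rw [map_add, AddMemClass.coe_add, map_add, hf, hg]; simp
  | single q c =>
    rw [toSeries_single, MvPowerSeries.coeff_monomial, AddMonoidAlgebra.coeff_single,
      Finsupp.single_apply]
    simp only [Subtype.ext_iff, eq_comm]

variable (k) in
/-- The ideal of the origin in the monoid algebra of `P`. -/
def polyOriginIdeal (P : AddSubmonoid (ι →₀ ℕ)) : Ideal (AddMonoidAlgebra k P) :=
  (originIdeal k P).comap (toSeries P)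

theorem originIdeal_isMaximal (P : AddSubmonoid (ι →₀ ℕ)) : (originIdeal k P).IsMaximal :=
  RingHom.ker_isMaximal_of_surjective _ fun c =>
    ⟨algebraMap k _ c, by simp [MvPowerSeries.algebraMap_apply]⟩

theorem mem_polyOriginIdeal {P : AddSubmonoid (ι →₀ ℕ)} {b : AddMonoidAlgebra k P} :
    b ∈ polyOriginIdeal k P ↔ b.coeff 0 = 0 := by
  rw [← coeff_toSeries]
  exact Iff.rfl

theorem polyOriginIdeal_isMaximal (P : AddSubmonoid (ι →₀ ℕ)) :
    (polyOriginIdeal k P).IsMaximal :=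
  RingHom.ker_isMaximal_of_surjective ((MvPowerSeries.constantCoeff (σ := ι) (R := k)).comp
    ((supportedSeries k P).val.toRingHom.comp (toSeries P).toRingHom)) fun c =>
    ⟨algebraMap k _ c, by
      rw [RingHom.comp_apply, RingHom.comp_apply]
      erw [AlgHom.commutes]
      simp [MvPowerSeries.algebraMap_apply]⟩

theorem single_mem_polyOriginIdeal_pow {P : AddSubmonoid (ι →₀ ℕ)} {j : ℕ} {m : P}
    (hm : m.1 ∈ decomposable P j) (c : k) :
    AddMonoidAlgebra.single m c ∈ polyOriginIdeal k P ^ j := by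
  induction j generalizing m c with
  | zero => simp
  | succ j ih =>
    obtain ⟨m, hmP⟩ := m
    obtain ⟨a, ha, ha0, b, hb, rfl⟩ := hm
    have : AddMonoidAlgebra.single (⟨a + b, hmP⟩ : P) c = AddMonoidAlgebra.single (⟨a, ha⟩ : P) 1 *
        AddMonoidAlgebra.single (⟨b, decomposable_subset hb⟩ : P) c := by
      rw [AddMonoidAlgebra.single_mul_single, one_mul]; rfl
    rw [this, pow_succ']
    refine Ideal.mul_mem_mul ?_ (ih hb c)
    classical
    rw [mem_polyOriginIdeal, AddMonoidAlgebra.coeff_single, Finsupp.single_apply, if_neg]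
    rw [Subtype.ext_iff]
    exact ha0

/-- The coefficient criterion for the powers passes to polynomials term by term, as each admissible
monomial is itself a product of `j` nonconstant ones and a further monomial. -/
theorem comap_toSeries_originIdeal_pow {P : AddSubmonoid (ι →₀ ℕ)} (hP : P.FG) (j : ℕ) :
    (originIdeal k P ^ j).comap (toSeries P) = polyOriginIdeal k P ^ j := by
  refine le_antisymm (fun b hb => ?_) (Ideal.le_comap_pow _ _)
  rw [Ideal.mem_comap, mem_originIdeal_pow hP] at hb
  rw [← AddMonoidAlgebra.sum_coeff_single b]
  refine sum_mem fun p hp => single_mem_polyOriginIdeal_pow ?_ _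
  by_contra h
  rw [Finsupp.mem_support_iff, ← coeff_toSeries] at hp
  exact hp (hb p.1 h)

theorem finite_degree_lt [Finite ι] (j : ℕ) : {m : ι →₀ ℕ | m.degree < j}.Finite := by
  have := Fintype.ofFinite ι
  classical
  refine Set.Finite.subset (Set.finite_Iic (Finsupp.equivFunOnFinite.symm fun _ : ι => j)) ?_
  intro m hm i
  exact (Finsupp.le_degree i m).trans (by simpa using hm : m.degree < j).le

/-- If all generators have degree at most `N`, then `j` of them can be split off from any element of
degree more than `j * N`; only finitely many exponents have smaller degree. This makes the
truncations of a series polynomials. -/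
theorem finite_compl_decomposable [Finite ι] {P : AddSubmonoid (ι →₀ ℕ)} (hP : P.FG) (j : ℕ) :
    ((P : Set (ι →₀ ℕ)) \ decomposable P j).Finite := by
  obtain ⟨s, hs, hsplit⟩ := exists_finset_split hP
  set N := s.sup Finsupp.degree
  have key : ∀ j, ∀ m ∈ P, j * N < m.degree → m ∈ decomposable P j := by
    intro j
    induction j with
    | zero => exact fun m hm _ => hm
    | succ j ih =>
      intro m hm hd
      obtain ⟨g, hg, b, hb, rfl⟩ := hsplit m hm (by rintro rfl; simp at hd)
      refine ⟨g, (hs g hg).1, (hs g hg).2, b, ih b hb ?_, rfl⟩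
      have : g.degree ≤ N := Finset.le_sup hg
      rw [map_add, add_mul, one_mul] at hd
      omega
  refine (finite_degree_lt (j * N + 1)).subset fun m hm => ?_
  by_contra h
  exact hm.2 (key j m hm.1 (by simpa using h))

theorem exists_sub_toSeries_mem [Finite ι] {P : AddSubmonoid (ι →₀ ℕ)} (hP : P.FG) (j : ℕ)
    (f : supportedSeries k P) : ∃ b, f - toSeries P b ∈ originIdeal k P ^ j := by
  classical
  have hfin := finite_compl_decomposable hP j
  have hfin' : {p : P | p.1 ∉ decomposable P j}.Finite :=
    Set.Finite.of_finite_image (f := Subtype.val) (hfin.subset (by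
      rintro _ ⟨p, hp, rfl⟩; exact ⟨p.2, hp⟩)) Subtype.val_injective.injOn
  refine ⟨∑ p ∈ hfin'.toFinset, AddMonoidAlgebra.single p (MvPowerSeries.coeff p.1 f.1), ?_⟩
  rw [mem_originIdeal_pow hP]
  intro m hm
  by_cases hmP : m ∈ P
  · rw [AddSubgroupClass.coe_sub, map_sub, coeff_toSeries P _ ⟨m, hmP⟩,
      AddMonoidAlgebra.coeff_sum, Finsupp.finsetSum_apply, Finset.sum_eq_single ⟨m, hmP⟩]
    · simp
    · intro b _ hb
      simp [hb]
    · intro h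
      exact absurd (hfin'.mem_toFinset.2 hm) h
  · exact (f - toSeries P _).2 m hmP

instance polyOriginIdeal_isPrime (P : AddSubmonoid (ι →₀ ℕ)) : (polyOriginIdeal k P).IsPrime :=
  (polyOriginIdeal_isMaximal P).isPrime

/-- The completion of the monoid algebra of `P` at the origin is the algebra of power series
supported on `P`. -/
theorem exists_supportedSeries_equiv_adicCompletion [Finite ι] {P : AddSubmonoid (ι →₀ ℕ)}
    (hP : P.FG) (C : Type*) [CommRing C] [IsLocalRing C] [Algebra (AddMonoidAlgebra k P) C]
    [IsLocalization.AtPrime C (polyOriginIdeal k P)] :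
    ∃ e : supportedSeries k P ≃+* AdicCompletion (IsLocalRing.maximalIdeal C) C,
      ∀ b, e (toSeries P b) = algebraMap C _ (algebraMap _ C b) := by
  have := isAdicComplete_originIdeal (k := k) hP
  have hunit : ∀ y : (polyOriginIdeal k P).primeCompl, IsUnit (toSeries P (y : AddMonoidAlgebra k P)) :=
    fun y => isUnit_supportedSeries_of_constantCoeff_ne_zero hP y.2
  let g : C →+* supportedSeries k P := IsLocalization.lift (M := (polyOriginIdeal k P).primeCompl)
    (g := (toSeries P).toRingHom) hunit
  have hgb (b) : g (algebraMap _ C b) = toSeries P b := IsLocalization.lift_eq _ b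
  have hmax := IsLocalization.AtPrime.map_eq_maximalIdeal (polyOriginIdeal k P) C
  obtain ⟨e, he⟩ := exists_equiv_adicCompletion (IsLocalRing.maximalIdeal C) (originIdeal k P) g
    (fun j => by
      ext c
      -- Denominators are units on both sides, so the comparison of powers reduces to the polynomial
      -- `b`.
      obtain ⟨b, s, rfl⟩ := IsLocalization.exists_mk'_eq (polyOriginIdeal k P).primeCompl c
      have hs : IsUnit (algebraMap _ C s.1) := IsLocalization.map_units C s
      have h1 := IsLocalization.mk'_spec C b s
      rw [Ideal.mem_comap, ← Ideal.mul_unit_mem_iff_mem _ (hs.map g), ← map_mul, h1, hgb,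
        ← Ideal.mul_unit_mem_iff_mem (IsLocalRing.maximalIdeal C ^ j) hs, h1]
      constructor
      · intro h
        rw [← hmax, ← Ideal.map_pow]
        refine Ideal.mem_map_of_mem _ ?_
        rw [← comap_toSeries_originIdeal_pow hP]
        exact h
      · intro h
        have h2 : Ideal.map g (IsLocalRing.maximalIdeal C) ≤ originIdeal k P := by
          rw [← hmax, Ideal.map_map, Ideal.map_le_iff_le_comap]
          intro b hb
          rw [Ideal.mem_comap, RingHom.comp_apply, hgb]
          exact hb
        have h3 := Ideal.mem_map_of_mem g h
        rw [hgb, Ideal.map_pow] at h3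
        exact Ideal.pow_right_mono h2 j h3)
    (fun j t => by
      obtain ⟨b, hb⟩ := exists_sub_toSeries_mem hP j t
      exact ⟨algebraMap _ C b, by rwa [hgb]⟩)
  exact ⟨e, fun b => by rw [← hgb, he]⟩

/-! ### Unique factorization in power series rings -/

/-- Modulo `𝔪` a distinguished polynomial is a power of `X`, whose monic divisors over a field are
powers of `X` again. -/
theorem isDistinguishedAt_of_dvd {A : Type*} [CommRing A] {𝔪 : Ideal A} [𝔪.IsMaximal]
    {p g : Polynomial A} (hg : g.IsDistinguishedAt 𝔪) (hp : p.Monic) (h : p ∣ g) :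
    p.IsDistinguishedAt 𝔪 := by
  let := Ideal.Quotient.field 𝔪
  have h1 := Polynomial.map_dvd (Ideal.Quotient.mk 𝔪) h
  rw [hg.map_eq_X_pow, dvd_prime_pow Polynomial.prime_X] at h1
  obtain ⟨e, -, he⟩ := h1
  have h2 := Polynomial.eq_of_monic_of_associated (hp.map _) (Polynomial.monic_X_pow e) he
  have h3 : p.natDegree = e := by
    rw [← hp.natDegree_map (Ideal.Quotient.mk 𝔪), h2, Polynomial.natDegree_X_pow]
  refine ⟨⟨fun {n} hn => ?_⟩, hp⟩
  rw [← Ideal.Quotient.eq_zero_iff_mem, ← Polynomial.coeff_map, h2, Polynomial.coeff_X_pow, if_neg]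
  omega

/-- Weierstrass division identifies `A[X]/(p)` with `A[[X]]/(p)`, and one is a domain when the other
is. -/
theorem prime_coe_of_isDistinguishedAt {A : Type*} [CommRing A] [IsDomain A] {I : Ideal A}
    [IsAdicComplete I A] {p : Polynomial A} (hp : p.IsDistinguishedAt I) (hprime : Prime p) :
    Prime (p : PowerSeries A) := by
  have h0 : (p : PowerSeries A) ≠ 0 := by
    rw [Ne, Polynomial.coe_eq_zero_iff]
    exact hprime.ne_zero
  rw [← Ideal.span_singleton_prime h0, ← Ideal.Quotient.isDomain_iff_prime]
  have : IsDomain (Polynomial A ⧸ Ideal.span {p}) := by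
    rw [Ideal.Quotient.isDomain_iff_prime, Ideal.span_singleton_prime hprime.ne_zero]
    exact hprime
  exact hp.algEquivQuotient.symm.toMulEquiv.isDomain _

/-- Weierstrass preparation replaces `f` by a distinguished polynomial, which factors in the
factorial ring `A[X]`. One prime factor lies in `Q`; made monic, it is distinguished and stays prime
in `A[[X]]`. -/
theorem exists_prime_mem_of_map_residue_ne_zero {A : Type*} [CommRing A] [IsDomain A]
    [UniqueFactorizationMonoid A] [IsLocalRing A] [IsAdicComplete (IsLocalRing.maximalIdeal A) A]
    (Q : Ideal (PowerSeries A)) [hQ : Q.IsPrime] {f : PowerSeries A} (hf : f ∈ Q)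
    (hres : f.map (IsLocalRing.residue A) ≠ 0) : ∃ p ∈ Q, Prime p := by
  obtain ⟨g, h, hgh⟩ := f.exists_isWeierstrassFactorization hres
  have hg : (g : PowerSeries A) ∈ Q := by
    rw [hgh.eq_mul] at hf
    exact (Ideal.mul_unit_mem_iff_mem _ hgh.isUnit).1 hf
  have hd : g.IsDistinguishedAt (IsLocalRing.maximalIdeal A) := hgh.isDistinguishedAt
  let q : Ideal (Polynomial A) := Q.comap (Polynomial.coeToPowerSeries.ringHom)
  have hq : q.IsPrime := Ideal.comap_isPrime _ _
  obtain ⟨s, hs, hsg⟩ := UniqueFactorizationMonoid.exists_prime_factors g hd.monic.ne_zero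
  have hsq : s.prod ∈ q := by
    obtain ⟨w, hw⟩ := hsg
    have : g ∈ q := hg
    rw [← hw] at this
    exact (Ideal.mul_unit_mem_iff_mem _ w.isUnit).1 this
  obtain ⟨p, hps, hpq⟩ := (hq.multiset_prod_mem_iff_exists_mem _).1 hsq
  have hpg : p ∣ g := (Multiset.dvd_prod hps).trans hsg.dvd
  have hlc : IsUnit p.leadingCoeff :=
    isUnit_of_dvd_one (by
      obtain ⟨c, rfl⟩ := hpg
      have := hd.monic
      rw [Polynomial.Monic, Polynomial.leadingCoeff_mul] at this
      exact ⟨_, this.symm⟩)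
  obtain ⟨w, hw⟩ := hlc
  set p' := p * Polynomial.C (↑w⁻¹ : A)
  have hunit : IsUnit (Polynomial.C (↑w⁻¹ : A)) := Polynomial.isUnit_C.2 w⁻¹.isUnit
  have hmonic : p'.Monic := by
    rw [Polynomial.Monic, Polynomial.leadingCoeff_mul, Polynomial.leadingCoeff_C, ← hw,
      Units.mul_inv]
  have hp' : Prime p' := by
    refine (Associated.prime_iff ?_).1 (hs p hps)
    exact associated_mul_unit_right _ _ hunit
  have hp'g : p' ∣ g := (hunit.mul_right_dvd).2 hpg
  exact ⟨p', Q.mul_mem_right _ hpq |> fun h => by simpa [p'] using h,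
    prime_coe_of_isDistinguishedAt (isDistinguishedAt_of_dvd hd hmonic hp'g) hp'⟩

variable {k : Type u} [Field k]

theorem fg_top_finsupp {ι : Type*} [Finite ι] : (⊤ : AddSubmonoid (ι →₀ ℕ)).FG :=
  AddSubmonoid.fg_of_subtractive fun _ _ _ _ => trivial

instance isAdicComplete_mvPowerSeries {ι : Type} [Finite ι] :
    IsAdicComplete (IsLocalRing.maximalIdeal (MvPowerSeries ι k)) (MvPowerSeries ι k) := by
  have h := isAdicComplete_originIdeal (k := k) (fg_top_finsupp (ι := ι))
  have htop : supportedSeries k (⊤ : AddSubmonoid (ι →₀ ℕ)) = ⊤ :=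
    eq_top_iff.2 fun f _ m hm => absurd trivial hm
  let e : supportedSeries k (⊤ : AddSubmonoid (ι →₀ ℕ)) ≃+* MvPowerSeries ι k :=
    ((Subalgebra.equivOfEq _ _ htop).trans Subalgebra.topEquiv).toRingEquiv
  have hmap : (originIdeal k (⊤ : AddSubmonoid (ι →₀ ℕ))).map e =
      IsLocalRing.maximalIdeal (MvPowerSeries ι k) := by
    refine IsLocalRing.eq_maximalIdeal ?_
    have := originIdeal_isMaximal (k := k) (⊤ : AddSubmonoid (ι →₀ ℕ))
    exact Ideal.map_isMaximal_of_equiv e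
  rw [← hmap, IsAdicComplete.congr_ringEquiv]
  exact h

/-- The images of the variables under a linear change of coordinates that makes most power series
regular in the variable `X 0`. -/
def shearVar {n : ℕ} (a : k) (c : Fin (n + 1) → k) (i : Fin (n + 1)) :
    MvPowerSeries (Fin (n + 1)) k :=
  if i = 0 then a • MvPowerSeries.X 0 else MvPowerSeries.X i + c i • MvPowerSeries.X 0

theorem hasSubst_shearVar {n : ℕ} (a : k) (c : Fin (n + 1) → k) :
    MvPowerSeries.HasSubst (shearVar a c) := by
  refine MvPowerSeries.hasSubst_of_constantCoeff_zero fun i => ?_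
  unfold shearVar
  split_ifs <;> simp [MvPowerSeries.smul_eq_C_mul]

theorem subst_shearVar_shearVar {n : ℕ} {a : k} (ha : a ≠ 0) (c : Fin (n + 1) → k)
    (f : MvPowerSeries (Fin (n + 1)) k) :
    MvPowerSeries.subst (shearVar a⁻¹ (fun i => - c i * a⁻¹))
      (MvPowerSeries.subst (shearVar a c) f) = f := by
  rw [MvPowerSeries.subst_comp_subst_apply (hasSubst_shearVar _ _) (hasSubst_shearVar _ _)]
  conv_rhs => rw [← id_eq f, ← MvPowerSeries.subst_self]
  congr 1
  ext1 i
  have h (j) := MvPowerSeries.subst_X (R := k) (hasSubst_shearVar a⁻¹ (fun i => - c i * a⁻¹)) j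
  rw [shearVar]
  split_ifs with hi
  · rw [MvPowerSeries.subst_smul (hasSubst_shearVar _ _), h, shearVar, if_pos rfl, smul_smul,
      mul_inv_cancel₀ ha, one_smul, hi]
  · rw [MvPowerSeries.subst_add (hasSubst_shearVar _ _),
      MvPowerSeries.subst_smul (hasSubst_shearVar _ _), h, h, shearVar, shearVar, if_neg hi,
      if_pos rfl, smul_smul, neg_mul, neg_smul]
    abel

theorem bijective_subst_shearVar {n : ℕ} {a : k} (ha : a ≠ 0) (c : Fin (n + 1) → k) :
    Function.Bijective (MvPowerSeries.substAlgHom (R := k) (hasSubst_shearVar a c)) := by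
  simp only [MvPowerSeries.coe_substAlgHom]
  refine ⟨Function.LeftInverse.injective (subst_shearVar_shearVar ha c), fun f =>
    ⟨MvPowerSeries.subst (shearVar a⁻¹ (fun i => - c i * a⁻¹)) f, ?_⟩⟩
  have h := subst_shearVar_shearVar (inv_ne_zero ha) (fun i => - c i * a⁻¹) f
  simpa [mul_assoc, ha] using h

/-- Pure powers of `X 0` are seen after setting the other variables to zero (the map `K`). Each
sheared variable then becomes a scalar times `X`, so a monomial of exponent `d` becomes its value at
the scalars times `X ^ d.degree`. -/
theorem coeff_subst_shearVar {n : ℕ} (a : k) (c : Fin (n + 1) → k) (d : Fin (n + 1) →₀ ℕ) (j : ℕ) :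
    MvPowerSeries.coeff (Finsupp.cons j 0) (d.prod fun i e => shearVar a c i ^ e) =
      if d.degree = j then d.prod fun i e => (if i = 0 then a else c i) ^ e else 0 := by
  let K : MvPowerSeries (Fin (n + 1)) k →+* PowerSeries k :=
    (PowerSeries.map MvPowerSeries.constantCoeff).comp
      (MvPowerSeries.finSuccEquiv k n).toRingEquiv.toRingHom
  have hK (f) : MvPowerSeries.coeff (Finsupp.cons j 0) f = PowerSeries.coeff j (K f) := by
    rw [← MvPowerSeries.coeff_coeff_finSuccEquiv]
    rfl
  have hKf (f) : K f = PowerSeries.map MvPowerSeries.constantCoeff (MvPowerSeries.finSuccEquiv k n f) :=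
    rfl
  have hX0 : K (MvPowerSeries.X 0) = PowerSeries.X := by
    rw [hKf, MvPowerSeries.finSuccEquiv_X_zero, PowerSeries.map_X]
  have hX (i : Fin (n + 1)) (hi : i ≠ 0) : K (MvPowerSeries.X i) = 0 := by
    obtain ⟨i, rfl⟩ := Fin.exists_succ_eq.2 hi
    rw [hKf, MvPowerSeries.finSuccEquiv_X_succ, PowerSeries.map_C]
    simp
  have hsmul (r : k) (f) : K (r • f) = PowerSeries.C r * K f := by
    rw [MvPowerSeries.smul_eq_C_mul, map_mul]
    congr 1
    rw [hKf, MvPowerSeries.finSuccEquiv_C, PowerSeries.map_C]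
    simp
  have hshear (i) : K (shearVar a c i) = PowerSeries.C (if i = 0 then a else c i) * PowerSeries.X := by
    unfold shearVar
    split_ifs with hi
    · rw [hsmul, hX0]
    · rw [map_add, hX i hi, hsmul, hX0, zero_add]
  rw [hK, map_finsuppProd]
  simp only [map_pow, hshear, mul_pow]
  rw [Finsupp.prod_mul, Finsupp.prod, Finsupp.prod, Finset.prod_pow_eq_pow_sum]
  simp only [← map_pow]
  rw [← map_prod, PowerSeries.coeff_C_mul, PowerSeries.coeff_X_pow, mul_ite, mul_one, mul_zero]
  exact if_congr eq_comm rfl rfl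

/-- After the shear, the coefficient of `X 0 ^ d` is the value of the degree-`d` homogeneous part of
`f` at the shearing vector. Over an infinite field a nonzero form does not vanish everywhere. -/
theorem exists_shear_regular [Infinite k] {n : ℕ} {f : MvPowerSeries (Fin (n + 1)) k}
    (hf : f ≠ 0) : ∃ (a : k) (_ : a ≠ 0) (c : Fin (n + 1) → k) (j : ℕ),
      MvPowerSeries.coeff (Finsupp.cons j 0) (MvPowerSeries.subst (shearVar a c) f) ≠ 0 := by
  classical
  obtain ⟨d, hd⟩ : ∃ d, MvPowerSeries.coeff d f ≠ 0 := by
    by_contra! h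
    exact hf (MvPowerSeries.ext h)
  let s := (finite_degree_lt (ι := Fin (n + 1)) (d.degree + 1)).toFinset
  let F : MvPolynomial (Fin (n + 1)) k :=
    ∑ e ∈ s with e.degree = d.degree, MvPolynomial.monomial e (MvPowerSeries.coeff e f)
  have hF : F ≠ 0 := by
    refine MvPolynomial.ne_zero_iff.2 ⟨d, ?_⟩
    rw [MvPolynomial.coeff_sum, Finset.sum_eq_single d]
    · rwa [MvPolynomial.coeff_monomial, if_pos rfl]
    · intro e _ he
      rw [MvPolynomial.coeff_monomial, if_neg he]
    · intro h
      exact absurd (by simp [s]) h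
  -- The extra factor `X 0` ensures `x 0 ≠ 0`, so that the shear is invertible.
  obtain ⟨x, hx⟩ : ∃ x, MvPolynomial.eval x (F * MvPolynomial.X 0) ≠ 0 := by
    by_contra! h
    exact mul_ne_zero hF (MvPolynomial.X_ne_zero 0) (MvPolynomial.funext fun x => by simpa using h x)
  rw [map_mul, MvPolynomial.eval_X] at hx
  refine ⟨x 0, right_ne_zero_of_mul hx, x, d.degree, ?_⟩
  rw [MvPowerSeries.coeff_subst (hasSubst_shearVar _ _)]
  convert left_ne_zero_of_mul hx
  rw [map_sum, finsum_eq_sum_of_support_subset (s := s.filter fun e => e.degree = d.degree)]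
  · refine Finset.sum_congr rfl fun e he => ?_
    rw [coeff_subst_shearVar, if_pos (Finset.mem_filter.1 he).2, MvPolynomial.eval_monomial,
      smul_eq_mul]
    congr 1
    refine Finsupp.prod_congr fun i _ => ?_
    split_ifs with hi
    · rw [hi]
    · rfl
  · intro e he
    rw [Function.mem_support, coeff_subst_shearVar] at he
    have h1 : e.degree = d.degree := by
      by_contra h
      rw [if_neg h, smul_zero] at he
      exact he rfl
    simp [s, h1]

instance isDomain_mvPowerSeries {ι : Type*} : IsDomain (MvPowerSeries ι k) :=
  NoZeroDivisors.to_isDomain _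

/-- Kaplansky's criterion: every nonzero prime ideal must contain a prime element. A shear makes a
given nonzero element regular in one variable, and the Weierstrass argument runs over the ring in
one variable less. -/
instance uniqueFactorizationMonoid_mvPowerSeries [Infinite k] (n : ℕ) :
    UniqueFactorizationMonoid (MvPowerSeries (Fin n) k) := by
  induction n with
  | zero =>
    exact (MvPowerSeries.isEmptyEquiv (σ := Fin 0) (R := k)).symm.toMulEquiv.uniqueFactorizationMonoid
      inferInstance
  | succ n ih =>
    rw [UniqueFactorizationMonoid.iff_exists_prime_mem_of_isPrime]
    intro Q hQ hQp
    obtain ⟨f, hfQ, hf⟩ := Submodule.exists_mem_ne_zero_of_ne_bot hQ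
    obtain ⟨a, ha, c, j, hj⟩ := exists_shear_regular hf
    let τ : MvPowerSeries (Fin (n + 1)) k ≃+* PowerSeries (MvPowerSeries (Fin n) k) :=
      (RingEquiv.ofBijective _ (bijective_subst_shearVar ha c)).trans
        (MvPowerSeries.finSuccEquiv k n).toRingEquiv
    have hτ : (τ f).map (IsLocalRing.residue _) ≠ 0 := by
      intro h
      have h1 := congrArg (PowerSeries.coeff j) h
      rw [PowerSeries.coeff_map, map_zero, IsLocalRing.residue_eq_zero_iff,
        IsLocalRing.mem_maximalIdeal, mem_nonunits_iff, MvPowerSeries.isUnit_iff_constantCoeff,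
        isUnit_iff_ne_zero, not_not] at h1
      apply hj
      rw [← MvPowerSeries.coeff_coeff_finSuccEquiv]
      rw [← h1, ← MvPowerSeries.coe_substAlgHom (hasSubst_shearVar a c)]
      rfl
    have hQ' : (Q.comap τ.symm).IsPrime := Ideal.comap_isPrime _ _
    obtain ⟨p, hp, hpp⟩ := exists_prime_mem_of_map_residue_ne_zero (Q.comap τ.symm) (f := τ f)
      (by simpa using hfQ) hτ
    exact ⟨τ.symm p, hp, (MulEquiv.prime_iff τ.symm.toMulEquiv).2 hpp⟩

/-! ### Orders of vanishing -/

section ord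

set_option linter.unusedSectionVars false

variable {R : Type*} [CommRing R] [IsDomain R] [IsNoetherianRing R]

theorem krullDimLE_one_localization (P : PrimeDivisor R) :
    Ring.KrullDimLE 1 (Localization.AtPrime P.1.asIdeal) := by
  rw [Ring.KrullDimLE, Order.krullDimLE_iff]
  change ringKrullDim _ ≤ _
  rw [IsLocalization.AtPrime.ringKrullDim_eq_height P.1.asIdeal, P.2]
  rfl

theorem algebraMap_localization_mem_nonZeroDivisors (P : PrimeDivisor R) {a : R} (ha : a ≠ 0) :
    algebraMap R (Localization.AtPrime P.1.asIdeal) a ∈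
      nonZeroDivisors (Localization.AtPrime P.1.asIdeal) :=
  mem_nonZeroDivisors_of_ne_zero <| by
    rwa [Ne, FaithfulSMul.algebraMap_eq_zero_iff]

theorem coe_toNat_ord (P : PrimeDivisor R) {a : R} (ha : a ≠ 0) :
    ((Ring.ord (Localization.AtPrime P.1.asIdeal)
      (algebraMap R (Localization.AtPrime P.1.asIdeal) a)).toNat : ℕ∞) =
    Ring.ord (Localization.AtPrime P.1.asIdeal)
      (algebraMap R (Localization.AtPrime P.1.asIdeal) a) :=
  have := krullDimLE_one_localization P
  ENat.natCast_toNat (Ring.ord_ne_top (algebraMap_localization_mem_nonZeroDivisors P ha))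

theorem ordAlong_mul (P : PrimeDivisor R) {a b : R} (ha : a ≠ 0) (hb : b ≠ 0) :
    ordAlong P (a * b) = ordAlong P a + ordAlong P b := by
  have := krullDimLE_one_localization P
  rw [ordAlong, ordAlong, ordAlong, map_mul,
    Ring.ord_mul _ (algebraMap_localization_mem_nonZeroDivisors P hb), ENat.toNat_add,
    Nat.cast_add]
  · exact Ring.ord_ne_top (algebraMap_localization_mem_nonZeroDivisors P ha)
  · exact Ring.ord_ne_top (algebraMap_localization_mem_nonZeroDivisors P hb)

theorem ordAlong_nonneg (P : PrimeDivisor R) (a : R) : 0 ≤ ordAlong P a := Int.natCast_nonneg _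

theorem ordAlong_eq_zero (P : PrimeDivisor R) {a : R} (ha : a ∉ P.1.asIdeal) :
    ordAlong P a = 0 := by
  have : IsUnit (algebraMap R (Localization.AtPrime P.1.asIdeal) a) :=
    IsLocalization.map_units (M := P.1.asIdeal.primeCompl) _ ⟨a, ha⟩
  rw [ordAlong, Ring.ord_of_isUnit this]
  rfl

theorem ordAlong_one (P : PrimeDivisor R) : ordAlong P 1 = 0 :=
  ordAlong_eq_zero P fun h => P.1.2.ne_top ((Ideal.eq_top_iff_one _).2 h)

theorem ordAlong_pow (P : PrimeDivisor R) {a : R} (ha : a ≠ 0) (n : ℕ) :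
    ordAlong P (a ^ n) = n * ordAlong P a := by
  induction n with
  | zero => simp [ordAlong_one]
  | succ n ih => rw [pow_succ, ordAlong_mul P (pow_ne_zero n ha) ha, ih]; push_cast; ring

theorem ordAlong_prod (P : PrimeDivisor R) {α : Type*} (s : Finset α) (a : α → R)
    (ha : ∀ i ∈ s, a i ≠ 0) : ordAlong P (∏ i ∈ s, a i) = ∑ i ∈ s, ordAlong P (a i) := by
  classical
  induction s using Finset.induction_on with
  | empty => simp [ordAlong_one]
  | insert i s hi ih =>
    rw [Finset.prod_insert hi, Finset.sum_insert hi, ordAlong_mul P (ha i (by simp)),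
      ih fun j hj => ha j (by simp [hj])]
    exact Finset.prod_ne_zero_iff.2 fun j hj => ha j (by simp [hj])

theorem ordAlong_pos (P : PrimeDivisor R) {a : R} (ha : a ≠ 0) (haP : a ∈ P.1.asIdeal) :
    0 < ordAlong P a := by
  rw [ordAlong, Int.natCast_pos, ← Nat.cast_pos (α := ℕ∞), coe_toNat_ord P ha, Ring.ord,
    Module.length_pos_iff]
  refine Ideal.Quotient.nontrivial_iff.2 fun h => ?_
  rw [Ideal.span_singleton_eq_top, IsLocalization.AtPrime.isUnit_to_map_iff _ P.1.asIdeal] at h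
  exact h haP

theorem mem_of_ordAlong_pos (P : PrimeDivisor R) {a : R} (h : 0 < ordAlong P a) :
    a ∈ P.1.asIdeal := by
  by_contra h'
  rw [ordAlong_eq_zero P h'] at h
  exact lt_irrefl _ h

theorem PrimeDivisor.eq_of_le {P Q : PrimeDivisor R} (h : P.1.asIdeal ≤ Q.1.asIdeal) : P = Q :=
  Subtype.ext <| PrimeSpectrum.ext <|
    Ideal.eq_of_le_of_height_le P.1.asIdeal h (by rw [P.2, Q.2])

/-- On a Noetherian normal domain, a rational function without poles is regular. -/
theorem dvd_of_ordAlong_le [IsIntegrallyClosed R] {a b : R} (ha : a ≠ 0) (hb : b ≠ 0)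
    (h : ∀ P : PrimeDivisor R, ordAlong P b ≤ ordAlong P a) : b ∣ a := by
  by_contra hab
  have hx : (Ideal.Quotient.mk (Ideal.span {b}) a) ≠ 0 := by
    rwa [Ne, Ideal.Quotient.eq_zero_iff_mem, Ideal.mem_span_singleton]
  -- An associated prime `P = (b : a')` of `R/b` containing `(b : a)`. It is shown to be a prime
  -- divisor with discrete valuation ring `R_P`; the order condition at `P` then gives a denominator
  -- of `a / b` outside `P`, a contradiction.
  obtain ⟨P, hP, hle⟩ := exists_le_isAssociatedPrime_of_isNoetherianRing R _ hx
  rw [isAssociatedPrime_iff] at hP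
  obtain ⟨hPp, y, hPy⟩ := hP
  obtain ⟨a', rfl⟩ := Ideal.Quotient.mk_surjective y
  have hmem (c t : R) : t ∈ (⊥ : Submodule R (R ⧸ Ideal.span {b})).colon
      {Ideal.Quotient.mk (Ideal.span {b}) c} ↔ b ∣ t * c := by
    rw [Submodule.mem_colon_singleton, Submodule.mem_bot, ← Ideal.mem_span_singleton,
      ← Ideal.Quotient.eq_zero_iff_mem]
    rfl
  have hPmem (t : R) : t ∈ P ↔ b ∣ t * a' := by rw [hPy, hmem]
  have hle' (t : R) (ht : b ∣ t * a) : t ∈ P := hle ((hmem a t).2 ht)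
  have hbP : b ∈ P := (hPmem b).2 (dvd_mul_right _ _)
  have ha' : ¬ b ∣ a' := fun hd => hPp.ne_top ((Ideal.eq_top_iff_one _).2 ((hPmem 1).2 (by simpa)))
  -- Otherwise `(a'/b) P ⊆ P`, so `a'/b` is integral over `R` by the determinant trick, hence in
  -- `R`, and `b` divides `a'`.
  obtain ⟨p, hpP, u, hpu, huP⟩ : ∃ p ∈ P, ∃ u, p * a' = b * u ∧ u ∉ P := by
    by_contra! hcon
    let K := FractionRing R
    have hbK : algebraMap R K b ≠ 0 := by rwa [Ne, FaithfulSMul.algebraMap_eq_zero_iff]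
    have hint : IsIntegral R (algebraMap R K a' / algebraMap R K b) := by
      refine isIntegral_of_smul_mem_submodule (Submodule.map (Algebra.linearMap R K) P) ?_
        ((IsNoetherian.noetherian P).map _) _ ?_
      · intro hbot
        have : algebraMap R K b ∈ Submodule.map (Algebra.linearMap R K) P := ⟨b, hbP, rfl⟩
        rw [hbot] at this
        exact hbK this
      · rintro _ ⟨p, hp, rfl⟩
        obtain ⟨u, hu⟩ := (hPmem p).1 hp
        refine ⟨u, hcon p hp u hu, ?_⟩
        rw [Algebra.linearMap_apply, Algebra.linearMap_apply, smul_eq_mul, div_mul_eq_mul_div,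
          eq_div_iff hbK, ← map_mul, ← map_mul, mul_comm a', hu, mul_comm]
    obtain ⟨c, hc⟩ := IsIntegrallyClosed.isIntegral_iff.1 hint
    rw [eq_div_iff hbK, ← map_mul] at hc
    exact ha' ⟨c, by rw [← IsFractionRing.injective R K hc, mul_comm]⟩
  -- As `u` is a unit in `R_P`, this says that `p` generates `P R_P`; it also makes `P` minimal over
  -- `(p)`, so of height one by Krull's principal ideal theorem.
  have key : ∀ q ∈ P, ∃ c, q * u = p * c := by
    intro q hq
    obtain ⟨c, hc⟩ := (hPmem q).1 hq
    refine ⟨c, mul_left_cancel₀ hb ?_⟩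
    linear_combination p * hc - q * hpu
  have hmin : P ∈ (Ideal.span {p}).minimalPrimes := by
    refine ⟨⟨hPp, (Ideal.span_singleton_le_iff_mem _).2 hpP⟩, ?_⟩
    rintro Q ⟨hQ, hpQ⟩ hQP q hq
    obtain ⟨c, hc⟩ := key q hq
    refine (hQ.mem_or_mem (x := q) (y := u) ?_).resolve_right fun h => huP (hQP h)
    rw [hc]
    exact Q.mul_mem_right _ ((Ideal.span_singleton_le_iff_mem _).1 hpQ)
  have hheight : P.height = 1 := by
    refine le_antisymm (Ideal.height_le_one_of_isPrincipal_of_mem_minimalPrimes _ P hmin) ?_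
    rw [Order.one_le_iff_ne_zero, Ne, Ideal.height_eq_zero_iff_eq_bot]
    rintro rfl
    exact hb hbP
  let D : PrimeDivisor R := ⟨⟨P, hPp⟩, hheight⟩
  have hprin : (IsLocalRing.maximalIdeal (Localization.AtPrime P)).IsPrincipal := by
    refine ⟨algebraMap _ _ p, ?_⟩
    change _ = Ideal.span _
    rw [← Localization.AtPrime.map_eq_maximalIdeal]
    refine le_antisymm (Ideal.map_le_iff_le_comap.2 fun q hq => ?_)
      ((Ideal.span_singleton_le_iff_mem _).2 (Ideal.mem_map_of_mem _ hpP))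
    obtain ⟨c, hc⟩ := key q hq
    have hu : IsUnit (algebraMap R (Localization.AtPrime P) u) :=
      IsLocalization.map_units (M := P.primeCompl) _ ⟨u, huP⟩
    rw [Ideal.mem_comap, ← Ideal.mul_unit_mem_iff_mem _ hu, ← map_mul, hc, map_mul]
    exact Ideal.mul_mem_right _ _ (Ideal.mem_span_singleton_self _)
  have hfield : ¬ IsField (Localization.AtPrime P) := by
    rw [IsLocalRing.isField_iff_maximalIdeal_eq]
    intro hbot
    have : algebraMap R (Localization.AtPrime P) b ∈ (⊥ : Ideal (Localization.AtPrime P)) := by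
      rw [← hbot, ← Localization.AtPrime.map_eq_maximalIdeal]
      exact Ideal.mem_map_of_mem _ hbP
    rw [Ideal.mem_bot, FaithfulSMul.algebraMap_eq_zero_iff] at this
    exact hb this
  have hdvr : IsDiscreteValuationRing (Localization.AtPrime P) :=
    ((IsDiscreteValuationRing.TFAE _ hfield).out 0 4).2 hprin
  have h1 := h D
  rw [ordAlong, ordAlong, Nat.cast_le, ← Nat.cast_le (α := ℕ∞), coe_toNat_ord D ha,
    coe_toNat_ord D hb] at h1
  change Ring.ord (Localization.AtPrime P) _ ≤ Ring.ord (Localization.AtPrime P) _ at h1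
  rw [Ring.ord_eq_addVal, Ring.ord_eq_addVal, IsDiscreteValuationRing.addVal_le_iff_dvd] at h1
  obtain ⟨z, hz⟩ := h1
  obtain ⟨c, s, rfl⟩ := IsLocalization.exists_mk'_eq P.primeCompl z
  have h2 : algebraMap R (Localization.AtPrime P) (s * a) = algebraMap R _ (b * c) := by
    rw [map_mul, map_mul]
    rw [show algebraMap R (Localization.AtPrime P) a = _ from hz, mul_left_comm,
      mul_comm (algebraMap R (Localization.AtPrime P) s.1), IsLocalization.mk'_spec]
  have h3 := FaithfulSMul.algebraMap_injective R (Localization.AtPrime P) h2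
  exact s.2 (hle' s.1 ⟨c, h3⟩)

end ord

/-! ### Torsion of the class group -/

/-- The divisor of `c P` is `e P` times `P` with `e P > 0`. With `m` the product of the `e P` over
the support of `D`, the divisor `m D` is globally principal; positive coefficients go to the
numerator and negative ones to the denominator. -/
theorem isQFactorial_of_forall_exists {R : Type*} [CommRing R] [IsDomain R] [IsNoetherianRing R]
    (h : ∀ P : PrimeDivisor R, ∃ c ∈ P.1.asIdeal, c ≠ 0 ∧
      ∀ Q : PrimeDivisor R, c ∈ Q.1.asIdeal → Q = P) : IsQFactorial R := by
  classical
  choose c hcP hc0 hcQ using h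
  have hc (P Q : PrimeDivisor R) (hPQ : Q ≠ P) : ordAlong Q (c P) = 0 :=
    ordAlong_eq_zero Q fun h => hPQ (hcQ P Q h)
  have hpos (P) := ordAlong_pos P (hc0 P) (hcP P)
  intro D
  let e (P : PrimeDivisor R) : ℕ := (ordAlong P (c P)).toNat
  have he (P) : (e P : ℤ) = ordAlong P (c P) := Int.toNat_of_nonneg (hpos P).le
  let s := D.support
  let m := ∏ P ∈ s, e P
  have hm : 0 < m := Finset.prod_pos fun P _ => by
    have := hpos P
    rw [← he] at this
    exact_mod_cast this
  refine ⟨m, hm, fun _ => ⟨1, fun h1 => (Ideal.ne_top_iff_one _).1 (PrimeSpectrum.isPrime _).ne_top h1,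
    ∏ P ∈ s, c P ^ ((D P).toNat * (m / e P)), ∏ P ∈ s, c P ^ ((-D P).toNat * (m / e P)),
    Finset.prod_ne_zero_iff.2 fun P _ => pow_ne_zero _ (hc0 P),
    Finset.prod_ne_zero_iff.2 fun P _ => pow_ne_zero _ (hc0 P), fun Q _ => ?_⟩⟩
  rw [ordAlong_prod _ _ _ fun P _ => pow_ne_zero _ (hc0 P),
    ordAlong_prod _ _ _ fun P _ => pow_ne_zero _ (hc0 P), ← Finset.sum_sub_distrib]
  simp only [ordAlong_pow Q (hc0 _), ← sub_mul]
  by_cases hQ : Q ∈ s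
  · rw [Finset.sum_eq_single Q]
    · rw [← he, Finsupp.smul_apply, nsmul_eq_mul]
      have h1 : e Q * (m / e Q) = m := Nat.mul_div_cancel' (Finset.dvd_prod_of_mem e hQ)
      have h2 : ((D Q).toNat : ℤ) - ((-D Q).toNat : ℤ) = D Q := Int.toNat_sub_toNat_neg _
      push_cast
      rw [← sub_mul, h2]
      conv_lhs => rw [← h1]
      push_cast
      ring
    · intro P _ hPQ
      rw [hc P Q hPQ.symm, mul_zero]
    · exact fun h => absurd hQ h
  · rw [Finset.sum_eq_zero]
    · rw [Finsupp.smul_apply, Finsupp.notMem_support_iff.1 hQ, smul_zero]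
    · intro P hP
      rw [hc P Q (by rintro rfl; exact hQ hP), mul_zero]

/-- A Noetherian normal domain over which some factorial ring is finite is `ℚ`-factorial. -/
theorem isQFactorial_of_finite_ufd (R S : Type*) [CommRing R] [IsDomain R] [IsNoetherianRing R]
    [IsIntegrallyClosed R] [CommRing S] [IsDomain S] [UniqueFactorizationMonoid S] [Algebra R S]
    [FaithfulSMul R S] [Module.Finite R S] : IsQFactorial R := by
  let := FractionRing.liftAlgebra R (FractionRing S)
  have : FiniteDimensional (FractionRing R) (FractionRing S) :=
    .of_isLocalization R S (nonZeroDivisors R)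
  set N := Algebra.intNorm R S
  have hNalg (h : R) : N (algebraMap R S h) =
      h ^ Module.finrank (FractionRing R) (FractionRing S) := by
    apply FaithfulSMul.algebraMap_injective R (FractionRing R)
    rw [Algebra.algebraMap_intNorm_fractionRing, ← IsScalarTower.algebraMap_apply,
      IsScalarTower.algebraMap_apply R (FractionRing R) (FractionRing S), Algebra.norm_algebraMap,
      map_pow]
  refine isQFactorial_of_forall_exists fun P => ?_
  obtain ⟨Q, hQ, hQP⟩ := Ideal.exists_ideal_over_prime_of_isIntegral_of_isDomain (S := S)
    P.1.asIdeal (by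
      rw [(RingHom.injective_iff_ker_eq_bot _).1 (FaithfulSMul.algebraMap_injective R S)]
      exact bot_le)
  have hQ0 : Q ≠ ⊥ := by
    rintro rfl
    rw [Ideal.comap_bot_of_injective _ (FaithfulSMul.algebraMap_injective R S)] at hQP
    exact Ideal.ne_bot_of_height_eq_one P.2 hQP.symm
  -- The contraction `q` of `(f)` is a nonzero prime inside `P`, so equals `P` by height. The norm
  -- of `f` is a multiple of `f`, hence lies in `P`.
  obtain ⟨f, hfQ, hf⟩ := hQ.exists_mem_prime_of_ne_bot hQ0
  let q : Ideal R := (Ideal.span {f}).comap (algebraMap R S)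
  have hq : q.IsPrime := by
    have := (Ideal.span_singleton_prime hf.ne_zero).2 hf
    exact Ideal.comap_isPrime _ _
  have hqP : q = P.1.asIdeal := by
    have hle : q ≤ P.1.asIdeal := by
      rw [← hQP]
      exact Ideal.comap_mono ((Ideal.span_singleton_le_iff_mem _).2 hfQ)
    have hq0 : q ≠ ⊥ := Ideal.comap_ne_bot_of_integral_mem hf.ne_zero
      (Ideal.mem_span_singleton_self f) (Algebra.IsIntegral.isIntegral f)
    have : q.FiniteHeight := inferInstance
    refine Ideal.eq_of_le_of_height_le q hle ?_
    rw [P.2, Order.one_le_iff_ne_zero, Ne, Ideal.height_eq_zero_iff_eq_bot]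
    exact hq0
  have hNf : N f ∈ q := by
    rw [Ideal.mem_comap, Ideal.mem_span_singleton]
    exact Algebra.dvd_algebraMap_intNorm_self R S f
  refine ⟨N f, hqP ▸ hNf, Algebra.intNorm_ne_zero.2 hf.ne_zero, fun P' hP' => ?_⟩
  by_cases hle : q ≤ P'.1.asIdeal
  · exact (PrimeDivisor.eq_of_le (hqP ▸ hle)).symm
  -- From `h = f g` a power of `h` is `N h = N f * N g`, which lies in `P'`, although `h` does not.
  · obtain ⟨h, hhq, hhP⟩ := SetLike.not_le_iff_exists.1 hle
    obtain ⟨g, hg⟩ := Ideal.mem_span_singleton.1 (Ideal.mem_comap.1 hhq)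
    refine absurd (P'.1.2.mem_of_pow_mem
      (Module.finrank (FractionRing R) (FractionRing S)) ?_) hhP
    rw [← hNalg, hg, map_mul]
    exact Ideal.mul_mem_right _ _ hP'

/-! ### Finite subgroups of the torus and lattices of finite index -/

section lattice

variable {ι : Type}

/-- Exponent vectors as integer vectors. -/
def expHom (ι : Type) : (ι →₀ ℕ) →+ (ι → ℤ) where
  toFun m i := m i
  map_zero' := by ext; simp
  map_add' a b := by ext; simp

@[simp]
theorem expHom_apply (m : ι →₀ ℕ) (i : ι) : expHom ι m i = m i := rfl

theorem expHom_injective : Function.Injective (expHom ι) := fun a b h => by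
  ext i
  have := congrFun h i
  rw [expHom_apply, expHom_apply] at this
  exact_mod_cast this

theorem exists_expHom_eq [Finite ι] {v : ι → ℤ} (hv : ∀ i, 0 ≤ v i) : ∃ m, expHom ι m = v :=
  ⟨Finsupp.equivFunOnFinite.symm fun i => (v i).toNat, by
    ext i
    simp [hv i]⟩

/-- The monoid of exponent vectors in a lattice. -/
def latticeMonoid (Λ : AddSubgroup (ι → ℤ)) : AddSubmonoid (ι →₀ ℕ) :=
  Λ.toAddSubmonoid.comap (expHom ι)

theorem mem_latticeMonoid {Λ : AddSubgroup (ι → ℤ)} {m : ι →₀ ℕ} :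
    m ∈ latticeMonoid Λ ↔ expHom ι m ∈ Λ := Iff.rfl

/-- Because `Λ` is a group, differences that remain in `ℕ^ι` remain in the monoid; this is what a
Dickson-type argument needs. -/
theorem latticeMonoid_fg [Finite ι] (Λ : AddSubgroup (ι → ℤ)) : (latticeMonoid Λ).FG :=
  AddSubmonoid.fg_of_subtractive fun x hx y hxy => by
    rw [mem_latticeMonoid, map_add] at hxy
    exact (Λ.add_mem_cancel_left hx).1 hxy

end lattice

namespace FiniteTorusSubgroup

variable {k : Type u} [Field k] {n : ℕ}

section lattice

variable (G : FiniteTorusSubgroup k n)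

instance : G.ideal.IsHopfIdeal k := G.isHopfIdeal

instance : Module.Finite k G.CoordRing := G.finite

/-- The restriction to `G` of the character `m` of the torus. -/
def character : Multiplicative (Fin n → ℤ) →* G.CoordRing :=
  (Ideal.Quotient.mk G.ideal).toMonoidHom.comp (AddMonoidAlgebra.of k (Fin n → ℤ))

theorem character_apply (m : Fin n → ℤ) : G.character (.ofAdd m) =
    Ideal.Quotient.mk G.ideal (AddMonoidAlgebra.single m 1) := rfl

theorem isGroupLikeElem_character (m : Fin n → ℤ) :
    IsGroupLikeElem k (G.character (.ofAdd m)) := by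
  have := (AddMonoidAlgebra.isGroupLikeElem_single_one (R := k) (A := k) m).map
    (Bialgebra.Quotient.mkBialgHom (R := k) G.ideal)
  exact this

/-- The lattice of the characters of the torus which are trivial on `G`. -/
def lattice : AddSubgroup (Fin n → ℤ) where
  carrier := {m | G.character (.ofAdd m) = 1}
  zero_mem' := map_one G.character
  add_mem' {a b} ha hb := by
    change G.character (.ofAdd a * .ofAdd b) = 1
    rw [map_mul, ha, hb, one_mul]
  neg_mem' {a} ha := by
    have h : G.character (.ofAdd (-a) * .ofAdd a) = 1 := by
      rw [← ofAdd_add, neg_add_cancel]; exact map_one _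
    rwa [map_mul, ha, mul_one] at h

theorem mem_lattice {m : Fin n → ℤ} : m ∈ G.lattice ↔ G.character (.ofAdd m) = 1 := Iff.rfl

theorem character_eq_iff {a b : Fin n → ℤ} :
    G.character (.ofAdd a) = G.character (.ofAdd b) ↔ a - b ∈ G.lattice := by
  have h : G.character (.ofAdd a) = G.character (.ofAdd (a - b)) * G.character (.ofAdd b) := by
    rw [← map_mul, ← ofAdd_add, sub_add_cancel]
  have hu : IsUnit (G.character (.ofAdd b)) :=
    (Group.isUnit (Multiplicative.ofAdd b)).map G.character
  rw [h, mem_lattice]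
  exact ⟨fun h => hu.mul_eq_right.1 h, fun h => by rw [h, one_mul]⟩

/-- Distinct classes modulo the lattice restrict to distinct group-like elements of the coordinate
ring. These are linearly independent, and the ring is finite-dimensional. -/
instance : G.lattice.FiniteIndex := by
  have h1 : LinearIndepOn k id {a : G.CoordRing | IsGroupLikeElem k a} :=
    linearIndepOn_isGroupLikeElem
  have hfin : {a : G.CoordRing | IsGroupLikeElem k a}.Finite := h1.finite
  have : Finite ((Fin n → ℤ) ⧸ G.lattice) := by
    have := hfin.to_subtype
    refine Finite.of_injective (β := {a : G.CoordRing | IsGroupLikeElem k a})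
      (fun q => Quotient.liftOn' q (fun m => ⟨G.character (.ofAdd m),
        G.isGroupLikeElem_character m⟩) ?_) ?_
    · intro a b h
      rw [QuotientAddGroup.leftRel_apply] at h
      refine Subtype.ext (G.character_eq_iff.2 ?_)
      rw [← neg_mem_iff]
      convert h using 1
      abel
    · intro a b
      induction a using QuotientAddGroup.induction_on
      induction b using QuotientAddGroup.induction_on
      intro h
      have := G.character_eq_iff.1 (congrArg Subtype.val h)
      rw [QuotientAddGroup.eq, ← neg_mem_iff]
      convert this using 1
      abel
  exact AddSubgroup.finiteIndex_of_finite_quotient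

theorem prod_coord_pow (e : Fin n →₀ ℕ) :
    e.prod (fun i a => G.coord i ^ a) = G.character (.ofAdd (expHom _ e)) := by
  have h (i : Fin n) : G.coord i = G.character (.ofAdd (Pi.single i 1)) := rfl
  rw [Finsupp.prod_fintype _ _ (by simp)]
  simp_rw [h, ← map_pow, ← map_prod, ← ofAdd_nsmul, ← ofAdd_sum]
  congr 2
  ext i
  simp [Finset.sum_apply, Pi.single_apply]

theorem coeff_proj (e : Fin n →₀ ℕ) (f : PowerSeriesRing k n) :
    MvPowerSeries.coeff e (G.proj f) = algebraMap k _ (MvPowerSeries.coeff e f) := rfl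

theorem coeff_coaction (e : Fin n →₀ ℕ) (f : PowerSeriesRing k n) :
    MvPowerSeries.coeff e (G.coaction f) =
      G.character (.ofAdd (expHom _ e)) * algebraMap k _ (MvPowerSeries.coeff e f) := by
  rw [← prod_coord_pow, ← coeff_proj, ← MvPowerSeries.coeff_rescale]
  rfl

/-- The coaction multiplies the coefficient at `e` by the character `e` of `G`, so invariance is a
condition on each exponent separately. -/
theorem invariants_eq : G.invariants = supportedSeries k (latticeMonoid G.lattice) := by
  ext f
  rw [mem_supportedSeries, invariants, AlgHom.mem_equalizer]
  constructor
  · intro h e he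
    by_contra h0
    apply he
    have := congrArg (MvPowerSeries.coeff e) h
    rw [coeff_coaction, coeff_proj] at this
    have hu : IsUnit (algebraMap k G.CoordRing (MvPowerSeries.coeff e f)) :=
      (IsUnit.mk0 _ h0).map _
    exact hu.mul_eq_right.1 this
  · intro h
    ext e
    rw [coeff_coaction, coeff_proj]
    by_cases he : e ∈ latticeMonoid G.lattice
    · rw [G.mem_lattice.1 he, one_mul]
    · rw [h e he, map_zero, mul_zero]

end lattice

theorem isHopfIdeal_ker {A B : Type*} [CommRing A] [CommRing B] [HopfAlgebra k A]
    [HopfAlgebra k B] (f : A →ₐc[k] B) (hf : Function.Surjective f)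
    (hS : ∀ a, f (HopfAlgebra.antipode k a) = HopfAlgebra.antipode k (f a)) :
    (RingHom.ker f).IsHopfIdeal k where
  counit_eq_zero a ha := by
    have h : f a = 0 := ha
    rw [← CoalgHomClass.counit_comp_apply f a, h, map_zero]
  map_mkQ_comul_eq_zero a ha := by
    have h : f a = 0 := ha
    let g : B ≃ₗ[k] A ⧸ (RingHom.ker f).restrictScalars k :=
      (LinearMap.quotKerEquivOfSurjective (f : A →ₗ[k] B) hf).symm
    have hg : (Submodule.mkQ ((RingHom.ker f).restrictScalars k)) =
        g.toLinearMap ∘ₗ (f : A →ₗ[k] B) := by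
      ext x
      exact (LinearEquiv.symm_apply_apply
        (LinearMap.quotKerEquivOfSurjective (f : A →ₗ[k] B) hf) _).symm
    rw [hg, TensorProduct.map_comp, LinearMap.comp_apply]
    have := CoalgHomClass.map_comp_comul_apply f a
    rw [this, h, map_zero, map_zero]
  antipode_mem a ha := by
    have h : f a = 0 := ha
    change f _ = 0
    rw [hS, h, map_zero]

/-- The finite subgroup of the torus on which the characters in `Λ` are trivial. -/
def ofLattice (k : Type u) [Field k] (Λ : AddSubgroup (Fin n → ℤ)) [Λ.FiniteIndex] :
    FiniteTorusSubgroup k n where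
  ideal := RingHom.ker (AddMonoidAlgebra.mapDomainBialgHom k (QuotientAddGroup.mk' Λ))
  isHopfIdeal := by
    refine isHopfIdeal_ker _ ?_ ?_
    · intro b
      induction b using AddMonoidAlgebra.induction_linear with
      | zero => exact ⟨0, map_zero _⟩
      | add a b ha hb =>
        obtain ⟨a, rfl⟩ := ha
        obtain ⟨b, rfl⟩ := hb
        exact ⟨a + b, map_add _ _ _⟩
      | single q c =>
        obtain ⟨m, rfl⟩ := QuotientAddGroup.mk'_surjective Λ q
        exact ⟨AddMonoidAlgebra.single m c, AddMonoidAlgebra.mapDomainBialgHom_single _ _ _⟩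
    · intro a
      induction a using AddMonoidAlgebra.induction_linear with
      | zero => simp
      | add a b ha hb => simp only [map_add, ha, hb]
      | single q c => simp [AddMonoidAlgebra.antipode_single]
  finite := by
    let f := (AddMonoidAlgebra.mapDomainBialgHom k (QuotientAddGroup.mk' Λ) :
      TorusRing k n →ₗ[k] AddMonoidAlgebra k ((Fin n → ℤ) ⧸ Λ))
    have : Module.Finite k (AddMonoidAlgebra k ((Fin n → ℤ) ⧸ Λ)) := inferInstance
    exact Module.Finite.equiv (f.quotKerEquivRange).symm

theorem lattice_ofLattice (Λ : AddSubgroup (Fin n → ℤ)) [Λ.FiniteIndex] :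
    (ofLattice k Λ).lattice = Λ := by
  ext m
  rw [mem_lattice, character_apply, ← map_one (Ideal.Quotient.mk _), Ideal.Quotient.eq]
  change (AddMonoidAlgebra.mapDomainBialgHom k (QuotientAddGroup.mk' Λ)) _ = 0 ↔ _
  rw [map_sub, sub_eq_zero, map_one, AddMonoidAlgebra.mapDomainBialgHom_single,
    AddMonoidAlgebra.one_def, AddMonoidAlgebra.single_left_inj one_ne_zero]
  simp

end FiniteTorusSubgroup

/-! ### Power series are finite over the series with exponents in a lattice of finite index -/

section finite

variable {k : Type u} [Field k] {ι : Type}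

/-- The monomials with all exponents below `N` generate: every exponent is its residue modulo `N`
plus a vector of multiples of `N`, which lies in `P`. -/
theorem module_finite_mvPowerSeries [Finite ι] {P : AddSubmonoid (ι →₀ ℕ)} {N : ℕ} (hN : 0 < N)
    (hP : ∀ m : ι →₀ ℕ, N • m ∈ P) : Module.Finite (supportedSeries k P) (MvPowerSeries ι k) := by
  classical
  have := Fintype.ofFinite ι
  let r : (ι → Fin N) → (ι →₀ ℕ) := fun a => Finsupp.equivFunOnFinite.symm fun i => (a i : ℕ)
  refine ⟨⟨Finset.univ.image fun a => MvPowerSeries.monomial (r a) 1, ?_⟩⟩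
  rw [eq_top_iff]
  intro f _
  let g : (ι → Fin N) → supportedSeries k P := fun a =>
    ⟨fun m => if (∀ i, N ∣ m i) then MvPowerSeries.coeff (r a + m) f else 0, by
      intro m hm
      change (if _ then _ else _) = _
      rw [if_neg]
      intro h
      choose q hq using h
      apply hm
      convert hP (Finsupp.equivFunOnFinite.symm q) using 1
      ext i
      simp [hq]⟩
  have hg (a) (m) : MvPowerSeries.coeff m (g a).1 =
    if (∀ i, N ∣ m i) then MvPowerSeries.coeff (r a + m) f else 0 := rfl
  have hf : f = ∑ a, g a • MvPowerSeries.monomial (r a) (1 : k) := by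
    ext m
    rw [map_sum]
    let a0 : ι → Fin N := fun i => ⟨m i % N, Nat.mod_lt _ hN⟩
    rw [Finset.sum_eq_single a0]
    · rw [Algebra.smul_def, MvPowerSeries.coeff_mul_monomial, mul_one, if_pos]
      · change _ = MvPowerSeries.coeff _ (g a0).1
        rw [hg, if_pos]
        · rw [add_tsub_cancel_of_le]
          intro i
          simpa [r, a0] using Nat.mod_le (m i) N
        · intro i
          simp only [r, a0, Finsupp.tsub_apply, Finsupp.equivFunOnFinite_symm_apply_apply]
          exact Nat.dvd_sub_mod _
      · intro i
        simpa [r, a0] using Nat.mod_le (m i) N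
    · intro a _ ha
      rw [Algebra.smul_def, MvPowerSeries.coeff_mul_monomial, mul_one]
      split_ifs with h
      · change MvPowerSeries.coeff _ (g a).1 = _
        rw [hg, if_neg]
        contrapose! ha
        ext i
        obtain ⟨q, hq⟩ := ha i
        have h1 := h i
        simp only [r, Finsupp.tsub_apply, Finsupp.equivFunOnFinite_symm_apply_apply] at hq h1
        have : m i = N * q + a i := by omega
        simp [a0, this, Nat.mod_eq_of_lt (a i).2]
      · rfl
    · simp
  rw [hf]
  exact Submodule.sum_mem _ fun a _ => Submodule.smul_mem _ _
    (Submodule.subset_span (by simp))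

theorem nsmul_mem_latticeMonoid {Λ : AddSubgroup (ι → ℤ)} (m : ι →₀ ℕ) :
    Λ.index • m ∈ latticeMonoid Λ := by
  rw [mem_latticeMonoid, map_nsmul]
  exact Λ.nsmul_index_mem _

theorem module_finite_supportedSeries [Finite ι] (Λ : AddSubgroup (ι → ℤ)) [Λ.FiniteIndex] :
    Module.Finite (supportedSeries k (latticeMonoid Λ)) (MvPowerSeries ι k) :=
  module_finite_mvPowerSeries (Nat.pos_of_ne_zero AddSubgroup.FiniteIndex.index_ne_zero)
    nsmul_mem_latticeMonoid

theorem isQFactorial_of_finite_ringHom {R : Type v} {S : Type*} [CommRing R]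
    [IsDomain R] [IsIntegrallyClosed R] [IsNoetherianRing R] [CommRing S] [IsDomain S]
    [UniqueFactorizationMonoid S] (φ : R →+* S) (hφ : Function.Injective φ) (hfin : φ.Finite) :
    IsQFactorial R := by
  let := φ.toAlgebra
  have : FaithfulSMul R S := (faithfulSMul_iff_algebraMap_injective _ _).2 hφ
  have : Module.Finite R S := hfin
  exact isQFactorial_of_finite_ufd R S

theorem isQFactorial_of_equiv_supportedSeries [Infinite k] {n : ℕ} (R : Type v) [CommRing R]
    [IsDomain R] [IsIntegrallyClosed R] [IsNoetherianRing R] [Algebra k R]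
    (Λ : AddSubgroup (Fin n → ℤ)) [Λ.FiniteIndex]
    (e : R ≃ₐ[k] supportedSeries k (latticeMonoid Λ)) : IsQFactorial R := by
  have h1 := RingHom.finite_algebraMap.2 (module_finite_supportedSeries (k := k) Λ)
  exact isQFactorial_of_finite_ringHom
    ((algebraMap (supportedSeries k (latticeMonoid Λ)) (MvPowerSeries (Fin n) k)).comp
      e.toRingEquiv.toRingHom) (Subtype.val_injective.comp e.injective)
    (h1.comp (RingHom.Finite.of_surjective _ e.surjective))

end finite

/-! ### Local rings of toric varieties in a chart -/

section stalk

/-- An open immersion induces isomorphisms on stalks, so the local ring of `X` can be computed in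
the chart, with its `k`-structure. -/
theorem exists_isLocalization_stalk {k : Type u} [Field k] {A : Type u} [CommRing A] [Algebra k A]
    {X : Scheme.{u}} (p : X ⟶ Spec (CommRingCat.of k)) (f : Spec (CommRingCat.of A) ⟶ X)
    [IsOpenImmersion f] (hf : f ≫ p = Spec.map (CommRingCat.ofHom (algebraMap k A)))
    (y : PrimeSpectrum A) :
    ∃ g : A →+* X.presheaf.stalk (f y),
      @IsLocalization.AtPrime A _ (X.presheaf.stalk (f y)) _ g.toAlgebra y.asIdeal _ ∧
      ∀ c, g (algebraMap k A c) = stalkStructure p (f y) c := by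
  let Y : Scheme.{u} := Spec (CommRingCat.of A)
  let y' : Y := y
  let h : X.presheaf.stalk (f y') ≅ Y.presheaf.stalk y' := asIso (f.stalkMap y')
  let γ : CommRingCat.of A ⟶ Y.presheaf.stalk y' :=
    (Scheme.ΓSpecIso (CommRingCat.of A)).inv ≫ Y.presheaf.germ ⊤ y' trivial
  have hγ : Y.fromSpecStalk y' = Spec.map γ := Spec.fromSpecStalk_eq (CommRingCat.of A) y'
  have h0 : @IsLocalization.AtPrime A _ (Y.presheaf.stalk y') _ γ.hom.toAlgebra y.asIdeal _ :=
    StructureSheaf.IsLocalization.to_stalk A y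
  clear_value γ
  refine ⟨(γ ≫ h.inv).hom, ?_, ?_⟩
  · let := (γ ≫ h.inv).hom.toAlgebra
    let alg : Algebra A (Y.presheaf.stalk y') := γ.hom.toAlgebra
    exact IsLocalization.isLocalization_of_algEquiv y.asIdeal.primeCompl
      (AlgEquiv.ofRingEquiv (f := h.symm.commRingCatIsoToRingEquiv) fun _ => rfl)
  · have key : CommRingCat.ofHom (algebraMap k A) ≫ γ =
        CommRingCat.ofHom (stalkStructure p (f y')) ≫ h.hom := by
      apply Spec.map_injective
      have h1 : Spec.map (CommRingCat.ofHom (stalkStructure p (f y'))) =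
          X.fromSpecStalk (f y') ≫ p := Spec.map_preimage _
      have h2 : Spec.map h.hom ≫ X.fromSpecStalk (f y') = Y.fromSpecStalk y' ≫ f :=
        Scheme.SpecMap_stalkMap_fromSpecStalk f
      rw [Spec.map_comp, Spec.map_comp, h1, ← Category.assoc, h2, hγ, Category.assoc, hf]
    intro c
    have h2 : CommRingCat.ofHom (algebraMap k A) ≫ γ ≫ h.inv =
        CommRingCat.ofHom (stalkStructure p (f y')) := by
      rw [← Category.assoc, key, Category.assoc, h.hom_inv_id]
      exact Category.comp_id _
    exact congrArg (fun φ => φ.hom c) h2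

end stalk

section completedStalk

theorem exists_equiv_completedStalk {k : Type u} [Field k] {ι : Type} [Finite ι]
    {P : AddSubmonoid (ι →₀ ℕ)} (hP : P.FG) {X : Scheme.{u}} (p : X ⟶ Spec (CommRingCat.of k))
    (x : X) (g : AddMonoidAlgebra k P →+* X.presheaf.stalk x)
    (hg : @IsLocalization.AtPrime _ _ (X.presheaf.stalk x) _ g.toAlgebra (polyOriginIdeal k P) _)
    (hgk : ∀ c, g (algebraMap k _ c) = stalkStructure p x c) :
    ∃ e : supportedSeries k P ≃+* CompletedStalk X x, ∀ c : k,
      e (algebraMap k (supportedSeries k P) c) =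
        algebraMap (X.presheaf.stalk x) (CompletedStalk X x) (stalkStructure p x c) := by
  let := g.toAlgebra
  obtain ⟨e, he⟩ := exists_supportedSeries_equiv_adicCompletion (k := k) hP (X.presheaf.stalk x)
  refine ⟨e, fun c => ?_⟩
  rw [← hgk, ← (toSeries P).commutes c, he]
  rfl

end completedStalk

/-! ### Faces of rational cones and localization -/

section faces

/-- The monomial of `m` becomes invertible in `k[Q']`, and any element of `k[Q']` is brought into
`k[Q]` by one of its powers; injectivity is inherited from `Q ≤ Q'`. -/
theorem isLocalization_away_inclusion (k : Type u) [Field k] {M : Type*} [AddCommGroup M]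
    {Q Q' : AddSubmonoid M} (h : Q ≤ Q') (m : Q) (hm : -m.1 ∈ Q')
    (hQ' : ∀ q ∈ Q', ∃ N : ℕ, q + N • m.1 ∈ Q) :
    @IsLocalization.Away _ _ (AddMonoidAlgebra.single m 1 : AddMonoidAlgebra k Q)
      (AddMonoidAlgebra k Q') _
      (AddMonoidAlgebra.mapDomainRingHom k (AddSubmonoid.inclusion h)).toAlgebra := by
  let φ : AddMonoidAlgebra k Q →+* AddMonoidAlgebra k Q' :=
    AddMonoidAlgebra.mapDomainRingHom k (AddSubmonoid.inclusion h)
  let := φ.toAlgebra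
  have hφ (q : Q) (c : k) : φ (AddMonoidAlgebra.single q c) =
      AddMonoidAlgebra.single ⟨q.1, h q.2⟩ c := by
    exact AddMonoidAlgebra.mapDomain_single
  have hφinj : Function.Injective φ :=
    AddMonoidAlgebra.mapDomain_injective (AddSubmonoid.inclusion_injective h)
  have hpow (N : ℕ) : φ (AddMonoidAlgebra.single m 1 ^ N) =
      AddMonoidAlgebra.single ⟨N • m.1, h (Q.nsmul_mem m.2 N)⟩ 1 := by
    rw [AddMonoidAlgebra.single_pow, one_pow, hφ]
    rfl
  have hsurj (z : AddMonoidAlgebra k Q') :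
      ∃ N x, z * φ (AddMonoidAlgebra.single m 1 ^ N) = φ x := by
    induction z using AddMonoidAlgebra.induction_linear with
    | zero => exact ⟨0, 0, by simp⟩
    | add a b ha hb =>
      obtain ⟨N, x, hx⟩ := ha
      obtain ⟨N', x', hx'⟩ := hb
      refine ⟨N + N', x * AddMonoidAlgebra.single m 1 ^ N' +
        x' * AddMonoidAlgebra.single m 1 ^ N, ?_⟩
      rw [map_add, map_mul, map_mul, ← hx, ← hx', pow_add, map_mul]
      ring
    | single q c =>
      obtain ⟨N, hN⟩ := hQ' q.1 q.2
      refine ⟨N, AddMonoidAlgebra.single ⟨_, hN⟩ c, ?_⟩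
      rw [hpow, hφ, AddMonoidAlgebra.single_mul_single, mul_one]
      rfl
  refine (isLocalization_iff _ _).2 ⟨?_, ?_, ?_⟩
  · rintro ⟨_, N, rfl⟩
    change IsUnit (φ (AddMonoidAlgebra.single m 1 ^ N))
    rw [map_pow]
    refine IsUnit.pow _ (IsUnit.of_mul_eq_one (AddMonoidAlgebra.single ⟨-m.1, hm⟩ 1) ?_)
    rw [hφ, AddMonoidAlgebra.single_mul_single, AddMonoidAlgebra.one_def]
    congr 1
    · ext; simp
    · simp
  · intro z
    obtain ⟨N, x, hx⟩ := hsurj z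
    exact ⟨⟨x, ⟨_, N, rfl⟩⟩, hx⟩
  · intro x y hxy
    exact ⟨1, by rw [hφinj hxy]⟩

variable {r : ℕ}

/-- The real vector with the given integral coordinates. -/
def realVec (v : Fin r → ℤ) : Fin r → ℝ := fun i => v i

/-- The pairing of integral vectors and real vectors. -/
def pairing (m : Fin r → ℤ) : (Fin r → ℝ) →ₗ[ℝ] ℝ :=
  ∑ i, (m i : ℝ) • LinearMap.proj i

theorem pairing_apply (m : Fin r → ℤ) (v : Fin r → ℝ) : pairing m v = ∑ i, (m i : ℝ) * v i := by
  simp [pairing]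

theorem pairing_realVec (m v : Fin r → ℤ) : pairing m (realVec v) = ((m ⬝ᵥ v : ℤ) : ℝ) := by
  simp [pairing_apply, realVec, dotProduct]

theorem pairing_add (m m' : Fin r → ℤ) (v : Fin r → ℝ) :
    pairing (m + m') v = pairing m v + pairing m' v := by
  simp [pairing_apply, add_mul, Finset.sum_add_distrib]

theorem pairing_neg (m : Fin r → ℤ) (v : Fin r → ℝ) : pairing (-m) v = -pairing m v := by
  simp [pairing_apply]

theorem mem_dualMonoid {σ : PointedCone ℝ (Fin r → ℝ)} {m : Fin r → ℤ} :
    m ∈ dualMonoid σ ↔ ∀ v ∈ σ, 0 ≤ pairing m v := by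
  simp_rw [pairing_apply]
  exact Iff.rfl

theorem mem_dualMonoid_hull {s : Set (Fin r → ℤ)} {m : Fin r → ℤ} :
    m ∈ dualMonoid (PointedCone.hull ℝ (realVec '' s)) ↔ ∀ v ∈ s, 0 ≤ m ⬝ᵥ v := by
  rw [mem_dualMonoid]
  constructor
  · intro h v hv
    have := h (realVec v) (PointedCone.subset_hull ⟨v, hv, rfl⟩)
    rw [pairing_realVec] at this
    exact_mod_cast this
  · intro h v hv
    induction hv using Submodule.span_induction with
    | mem x hx =>
      obtain ⟨v, hv, rfl⟩ := hx
      rw [pairing_realVec]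
      exact_mod_cast h v hv
    | zero => simp
    | add x y _ _ hx hy => rw [map_add]; exact add_nonneg hx hy
    | smul a x _ hx =>
      have : pairing m (a • x) = (a : ℝ) * pairing m x := (pairing m).map_smul (a : ℝ) x
      rw [this]
      exact mul_nonneg a.2 hx

/-- On `σ` the form `m` is nonnegative, so a sum lies on its zero hyperplane only if both summands
do. -/
theorem isFaceOf_of_forall_mem_iff {σ τ : PointedCone ℝ (Fin r → ℝ)} {m : Fin r → ℤ}
    (hm : m ∈ dualMonoid σ) (hτ : ∀ x, x ∈ τ ↔ x ∈ σ ∧ pairing m x = 0) : τ.IsFaceOf σ where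
  le x hx := ((hτ x).1 hx).1
  mem_of_smul_add_mem {x y a} hx hy ha h := by
    rw [hτ]
    refine ⟨hx, ?_⟩
    have h1 := ((hτ _).1 h).2
    rw [map_add, map_smul, smul_eq_mul] at h1
    have h2 := mem_dualMonoid.1 hm x hx
    have h3 := mem_dualMonoid.1 hm y hy
    have h4 := mul_nonneg ha.le h2
    have h5 : a * pairing m x = 0 := by linarith
    exact (mul_eq_zero.1 h5).resolve_left ha.ne'

variable (k : Type u) [Field k]

theorem isLocalization_away_face {s : Set (Fin r → ℤ)} (hs : s.Finite)
    {τ : PointedCone ℝ (Fin r → ℝ)} (hle : τ ≤ PointedCone.hull ℝ (realVec '' s))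
    (m : dualMonoid (PointedCone.hull ℝ (realVec '' s)))
    (hτ : ∀ x, x ∈ τ ↔ x ∈ PointedCone.hull ℝ (realVec '' s) ∧ pairing m.1 x = 0) :
    @IsLocalization.Away _ _ (AddMonoidAlgebra.single m 1 : ChartRing k _) (ChartRing k τ) _
      (AddMonoidAlgebra.mapDomainRingHom k
        (AddSubmonoid.inclusion (dualMonoid_anti hle))).toAlgebra := by
  refine isLocalization_away_inclusion k (dualMonoid_anti hle) m ?_ ?_
  · rw [mem_dualMonoid]
    intro v hv
    rw [pairing_neg, ((hτ v).1 hv).2, neg_zero]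
  · intro q hq
    -- A generator `v` with `m ⬝ᵥ v = 0` lies in `τ`, where `q` is already nonnegative. On the
    -- others `m` is at least 1, so this many copies of `m` outweigh `q`.
    refine ⟨∑ v ∈ hs.toFinset, (q ⬝ᵥ v).natAbs, ?_⟩
    have hm := mem_dualMonoid_hull.1 m.2
    rw [mem_dualMonoid_hull]
    intro v hv
    rw [add_dotProduct, smul_dotProduct, nsmul_eq_mul]
    by_cases h0 : m.1 ⬝ᵥ v = 0
    · rw [h0, mul_zero, add_zero]
      have h1 : realVec v ∈ τ := (hτ _).2 ⟨PointedCone.subset_hull ⟨v, hv, rfl⟩, by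
        rw [pairing_realVec, h0, Int.cast_zero]⟩
      have := mem_dualMonoid.1 hq _ h1
      rw [pairing_realVec] at this
      exact_mod_cast this
    · have h1 : 1 ≤ m.1 ⬝ᵥ v := by have := hm v hv; omega
      have h2 : (q ⬝ᵥ v).natAbs ≤ ∑ v ∈ hs.toFinset, (q ⬝ᵥ v).natAbs :=
        Finset.single_le_sum (f := fun v => (q ⬝ᵥ v).natAbs) (fun _ _ => Nat.zero_le _)
          (hs.mem_toFinset.2 hv)
      set N := ∑ v ∈ hs.toFinset, (q ⬝ᵥ v).natAbs
      have h3 : (N : ℤ) ≤ N * (m.1 ⬝ᵥ v) := le_mul_of_one_le_right (by positivity) h1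
      omega

theorem chartMap_isOpenImmersion {s : Set (Fin r → ℤ)} (hs : s.Finite)
    {τ : PointedCone ℝ (Fin r → ℝ)} (hle : τ ≤ PointedCone.hull ℝ (realVec '' s))
    (m : dualMonoid (PointedCone.hull ℝ (realVec '' s)))
    (hτ : ∀ x, x ∈ τ ↔ x ∈ PointedCone.hull ℝ (realVec '' s) ∧ pairing m.1 x = 0) :
    IsOpenImmersion (chartMap k hle) := by
  let := (AddMonoidAlgebra.mapDomainRingHom k
        (AddSubmonoid.inclusion (dualMonoid_anti hle))).toAlgebra
  have := isLocalization_away_face k hs hle m hτ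
  exact IsOpenImmersion.of_isLocalization (AddMonoidAlgebra.single m 1)

theorem range_chartMap {s : Set (Fin r → ℤ)} (hs : s.Finite)
    {τ : PointedCone ℝ (Fin r → ℝ)} (hle : τ ≤ PointedCone.hull ℝ (realVec '' s))
    (m : dualMonoid (PointedCone.hull ℝ (realVec '' s)))
    (hτ : ∀ x, x ∈ τ ↔ x ∈ PointedCone.hull ℝ (realVec '' s) ∧ pairing m.1 x = 0)
    (y : PrimeSpectrum (ChartRing k (PointedCone.hull ℝ (realVec '' s)))) :
    y ∈ Set.range (chartMap k hle) ↔ AddMonoidAlgebra.single m 1 ∉ y.asIdeal := by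
  let := (AddMonoidAlgebra.mapDomainRingHom k
        (AddSubmonoid.inclusion (dualMonoid_anti hle))).toAlgebra
  have := isLocalization_away_face k hs hle m hτ
  have h := PrimeSpectrum.localization_away_comap_range (ChartRing k τ)
    (AddMonoidAlgebra.single m 1 : ChartRing k (PointedCone.hull ℝ (realVec '' s)))
  exact (Set.ext_iff.1 h y)

end faces

/-! ### Affine simplicial toric varieties -/

section simplicial

variable {n : ℕ}

/-- The cone spanned by the vectors `v i`, `i ∈ I`. -/
abbrev spanCone (v : Fin n → Fin n → ℤ) (I : Finset (Fin n)) : PointedCone ℝ (Fin n → ℝ) :=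
  PointedCone.hull ℝ (realVec '' (v '' (I : Set (Fin n))))

/-- The integral vectors `v i` and `w i` are dual to each other up to the factor `N`. -/
structure IsDualSystem (v w : Fin n → Fin n → ℤ) (N : ℕ) : Prop where
  pos : 0 < N
  dot : ∀ i j, w i ⬝ᵥ v j = if i = j then (N : ℤ) else 0

variable {v w : Fin n → Fin n → ℤ} {N : ℕ}

namespace IsDualSystem

theorem pairing_eq (h : IsDualSystem v w N) (i j : Fin n) :
    pairing (w i) (realVec (v j)) = if i = j then (N : ℝ) else 0 := by
  rw [pairing_realVec, h.dot]
  split_ifs <;> simp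

/-- Duality says that two square matrices multiply to the identity in one order. They then do so in
the other, which is the expansion of `x` in the basis `v`. -/
theorem sum_smul (h : IsDualSystem v w N) (x : Fin n → ℝ) :
    ∑ i, ((N : ℝ)⁻¹ * pairing (w i) x) • realVec (v i) = x := by
  have hN : (N : ℝ) ≠ 0 := by exact_mod_cast h.pos.ne'
  let A : Matrix (Fin n) (Fin n) ℝ := (N : ℝ)⁻¹ • Matrix.of fun i j => (w i j : ℝ)
  let B : Matrix (Fin n) (Fin n) ℝ := Matrix.of fun j i => (v i j : ℝ)
  have hAB : A * B = 1 := by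
    ext i j
    have := h.pairing_eq i j
    rw [pairing_apply] at this
    simp only [A, Matrix.smul_apply, Matrix.mul_apply, Matrix.of_apply, B,
      smul_eq_mul, Matrix.one_apply, mul_assoc, ← Finset.mul_sum]
    simp only [realVec] at this
    rw [this]
    split_ifs
    · exact inv_mul_cancel₀ hN
    · exact mul_zero _
  have hBA : B * A = 1 := mul_eq_one_comm.1 hAB
  have h1 : B.mulVec (A.mulVec x) = x := by
    rw [Matrix.mulVec_mulVec, hBA, Matrix.one_mulVec]
  conv_rhs => rw [← h1]
  ext j
  simp only [Finset.sum_apply, Pi.smul_apply, smul_eq_mul, Matrix.mulVec, dotProduct, A, B,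
    pairing_apply, realVec, Matrix.smul_apply, Matrix.of_apply, Finset.mul_sum, Finset.sum_mul]
  refine Finset.sum_congr rfl fun i _ => Finset.sum_congr rfl fun l _ => ?_
  ring

theorem mem_spanCone (h : IsDualSystem v w N) {I : Finset (Fin n)} {x : Fin n → ℝ} :
    x ∈ spanCone v I ↔ ∀ i, 0 ≤ pairing (w i) x ∧ (i ∉ I → pairing (w i) x = 0) := by
  constructor
  · intro hx i
    induction hx using Submodule.span_induction with
    | mem x hx =>
      obtain ⟨_, ⟨j, hj, rfl⟩, rfl⟩ := hx
      rw [h.pairing_eq]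
      split_ifs with hij
      · exact ⟨Nat.cast_nonneg _, fun hi => absurd (hij ▸ hj) hi⟩
      · exact ⟨le_rfl, fun _ => rfl⟩
    | zero => simp
    | add x y _ _ hx hy =>
      rw [map_add]
      exact ⟨add_nonneg hx.1 hy.1, fun hi => by rw [hx.2 hi, hy.2 hi, add_zero]⟩
    | smul a x _ hx =>
      have : pairing (w i) (a • x) = (a : ℝ) * pairing (w i) x :=
        (pairing (w i)).map_smul (a : ℝ) x
      rw [this]
      exact ⟨mul_nonneg a.2 hx.1, fun hi => by rw [hx.2 hi, mul_zero]⟩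
  · intro hx
    rw [← h.sum_smul x]
    refine Submodule.sum_mem _ fun i _ => ?_
    by_cases hi : i ∈ I
    · have h0 : 0 ≤ (N : ℝ)⁻¹ * pairing (w i) x :=
        mul_nonneg (inv_nonneg.2 (Nat.cast_nonneg _)) (hx i).1
      exact Submodule.smul_mem _ (⟨_, h0⟩ : {c : ℝ // 0 ≤ c})
        (PointedCone.subset_hull ⟨_, ⟨i, hi, rfl⟩, rfl⟩)
    · rw [(hx i).2 hi, mul_zero, zero_smul]
      exact zero_mem _

theorem pairing_nonneg (h : IsDualSystem v w N) {I : Finset (Fin n)} {x : Fin n → ℝ}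
    (hx : x ∈ spanCone v I) (i : Fin n) : 0 ≤ pairing (w i) x := (h.mem_spanCone.1 hx i).1

theorem spanCone_inf (h : IsDualSystem v w N) (I J : Finset (Fin n)) :
    spanCone v I ⊓ spanCone v J = spanCone v (I ∩ J) := by
  ext x
  rw [Submodule.mem_inf, h.mem_spanCone, h.mem_spanCone, h.mem_spanCone]
  simp only [Finset.mem_inter, not_and_or]
  exact ⟨fun hx i => ⟨(hx.1 i).1, fun hi => hi.elim (hx.1 i).2 (hx.2 i).2⟩,
    fun hx => ⟨fun i => ⟨(hx i).1, fun hi => (hx i).2 (.inl hi)⟩,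
      fun i => ⟨(hx i).1, fun hi => (hx i).2 (.inr hi)⟩⟩⟩

theorem spanCone_le_univ (v : Fin n → Fin n → ℤ) (I : Finset (Fin n)) :
    spanCone v I ≤ spanCone v Finset.univ :=
  Submodule.span_mono (Set.image_mono (Set.image_mono (by simp)))

theorem pairing_sum (s : Finset (Fin n)) (x : Fin n → ℝ) :
    pairing (∑ i ∈ s, w i) x = ∑ i ∈ s, pairing (w i) x := by
  classical
  induction s using Finset.induction_on with
  | empty => simp [pairing_apply]
  | insert i s hi ih => rw [Finset.sum_insert hi, Finset.sum_insert hi, pairing_add, ih]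

theorem sum_mem_dualMonoid (h : IsDualSystem v w N) (I s : Finset (Fin n)) :
    ∑ i ∈ s, w i ∈ dualMonoid (spanCone v I) := by
  rw [mem_dualMonoid]
  intro x hx
  rw [pairing_sum]
  exact Finset.sum_nonneg fun i _ => h.pairing_nonneg hx i

theorem mem_spanCone_iff_pairing (h : IsDualSystem v w N) (I J : Finset (Fin n))
    (x : Fin n → ℝ) :
    x ∈ spanCone v (J ∩ I) ↔ x ∈ spanCone v J ∧ pairing (∑ i ∈ Iᶜ, w i) x = 0 := by
  rw [pairing_sum, h.mem_spanCone, h.mem_spanCone]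
  constructor
  · intro hx
    refine ⟨fun i => ⟨(hx i).1, fun hi => (hx i).2 fun hi' => hi (Finset.mem_inter.1 hi').1⟩,
      Finset.sum_eq_zero fun i hi => (hx i).2 fun hi' => ?_⟩
    exact Finset.mem_compl.1 hi (Finset.mem_inter.1 hi').2
  · rintro ⟨hx, h0⟩ i
    refine ⟨(hx i).1, fun hi => ?_⟩
    rw [Finset.mem_inter, not_and_or] at hi
    rcases hi with hi | hi
    · exact (hx i).2 hi
    · exact (Finset.sum_eq_zero_iff_of_nonneg fun j _ => (hx j).1).1 h0 i
        (Finset.mem_compl.2 hi)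

theorem mem_spanCone_iff_pairing_univ (h : IsDualSystem v w N) (I : Finset (Fin n))
    (x : Fin n → ℝ) : x ∈ spanCone v I ↔
      x ∈ spanCone v Finset.univ ∧ pairing (∑ i ∈ Iᶜ, w i) x = 0 := by
  rw [← h.mem_spanCone_iff_pairing, Finset.univ_inter]

/-- The fan of all faces of a simplicial cone of full dimension. -/
def fan (h : IsDualSystem v w N) : Fan n where
  cones := Set.range (spanCone v)
  finite := Set.finite_range _
  rational := by
    classical
    rintro _ ⟨I, rfl⟩
    exact ⟨I.image v, by simp only [Finset.coe_image]; rfl⟩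
  stronglyConvex := by
    rintro _ ⟨I, rfl⟩ x hx hx'
    rw [← h.sum_smul x]
    refine Finset.sum_eq_zero fun i _ => ?_
    have h1 := h.pairing_nonneg hx i
    have h2 := h.pairing_nonneg hx' i
    rw [map_neg] at h2
    rw [le_antisymm (by linarith) h1, mul_zero, zero_smul]
  face_mem := by
    classical
    rintro _ ⟨I, rfl⟩ τ hτ
    refine ⟨I.filter fun i => realVec (v i) ∈ τ, le_antisymm ?_ fun x hx => ?_⟩
    · refine Submodule.span_le.2 ?_
      rintro _ ⟨_, ⟨i, hi, rfl⟩, rfl⟩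
      exact (Finset.mem_filter.1 hi).2
    · have hx' := hτ.le hx
      refine h.mem_spanCone.2 fun i => ⟨h.pairing_nonneg hx' i, fun hi => ?_⟩
      by_cases hiI : i ∈ I
      · by_contra h0
        refine hi (Finset.mem_filter.2 ⟨hiI, ?_⟩)
        have hpos : 0 < (N : ℝ)⁻¹ * pairing (w i) x := mul_pos
          (inv_pos.2 (by exact_mod_cast h.pos))
          (lt_of_le_of_ne (h.pairing_nonneg hx' i) (Ne.symm h0))
        -- A point of the face with positive `i`-th coordinate is a positive multiple of `v i` plus
        -- a point `y` of the cone, so the face contains `v i`.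
        refine hτ.mem_of_smul_add_mem (y := ∑ j ∈ Finset.univ.erase i,
          ((N : ℝ)⁻¹ * pairing (w j) x) • realVec (v j))
          (PointedCone.subset_hull ⟨_, ⟨i, hiI, rfl⟩, rfl⟩) ?_ hpos ?_
        · refine Submodule.sum_mem _ fun j _ => ?_
          by_cases hj : j ∈ I
          · have h0 : 0 ≤ (N : ℝ)⁻¹ * pairing (w j) x :=
              mul_nonneg (inv_nonneg.2 (Nat.cast_nonneg _)) (h.pairing_nonneg hx' j)
            exact Submodule.smul_mem _ (⟨_, h0⟩ : {c : ℝ // 0 ≤ c})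
              (PointedCone.subset_hull ⟨_, ⟨j, hj, rfl⟩, rfl⟩)
          · rw [(h.mem_spanCone.1 hx' j).2 hj, mul_zero, zero_smul]
            exact zero_mem _
        · rw [Finset.add_sum_erase _ (fun j => ((N : ℝ)⁻¹ * pairing (w j) x) • realVec (v j))
            (Finset.mem_univ i), h.sum_smul]
          exact hx
      · exact (h.mem_spanCone.1 hx' i).2 hiI
  inter_isFaceOf := by
    rintro _ ⟨I, rfl⟩ _ ⟨J, rfl⟩
    rw [h.spanCone_inf]
    exact isFaceOf_of_forall_mem_iff (h.sum_mem_dualMonoid I Jᶜ)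
      (h.mem_spanCone_iff_pairing J I)

theorem le_univ_of_mem_fan (h : IsDualSystem v w N) {σ : PointedCone ℝ (Fin n → ℝ)}
    (hσ : σ ∈ h.fan.cones) : σ ≤ spanCone v Finset.univ := by
  obtain ⟨I, rfl⟩ := hσ
  exact spanCone_le_univ v I

variable (k : Type u) [Field k]

theorem _root_.ToricSing.chartMap_comp_chartMap {r : ℕ} {ρ τ σ : PointedCone ℝ (Fin r → ℝ)}
    (h : ρ ≤ τ) (h' : τ ≤ σ) : chartMap k h ≫ chartMap k h' = chartMap k (h.trans h') := by
  rw [chartMap, chartMap, chartMap, ← Spec.map_comp, ← CommRingCat.ofHom_comp]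
  congr 2
  ext
  · simp
  · simp
    rfl

theorem _root_.ToricSing.chartMap_comp_chartStructure {r : ℕ}
    {τ σ : PointedCone ℝ (Fin r → ℝ)} (h : τ ≤ σ) :
    chartMap k h ≫ chartStructure k σ = chartStructure k τ := by
  rw [chartMap, chartStructure, chartStructure, ← Spec.map_comp, ← CommRingCat.ofHom_comp]
  congr 2
  ext
  simp

theorem _root_.ToricSing.chartMap_refl {r : ℕ} (σ : PointedCone ℝ (Fin r → ℝ)) :
    chartMap k (le_refl σ) = 𝟙 _ := by
  rw [chartMap, ← Spec.map_id]
  congr 1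
  ext
  · simp
  · simp
    rfl

/-- The affine simplicial toric variety. -/
def toricVariety (h : IsDualSystem v w N) :
    ToricVariety h.fan (chart k (spanCone v Finset.univ))
      (chartStructure k (spanCone v Finset.univ)) where
  ι σ hσ := chartMap k (h.le_univ_of_mem_fan hσ)
  isOpenImmersion := by
    rintro _ ⟨I, rfl⟩
    exact chartMap_isOpenImmersion k ((Set.toFinite _).image v) _
      ⟨_, h.sum_mem_dualMonoid _ Iᶜ⟩ (h.mem_spanCone_iff_pairing_univ I)
  ι_comp σ hσ := chartMap_comp_chartStructure k _
  chartMap_comp τ hτ σ hσ hle := chartMap_comp_chartMap k _ _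
  covers x := ⟨spanCone v Finset.univ, ⟨_, rfl⟩, x, by rw [chartMap_refl]; rfl⟩
  inter := by
    classical
    rintro _ ⟨I, rfl⟩ _ ⟨J, rfl⟩ hi
    have hfin := (Set.toFinite ((Finset.univ : Finset (Fin n)) : Set (Fin n))).image v
    ext y
    rw [Set.mem_inter_iff]
    have h1 := range_chartMap k hfin (spanCone_le_univ v I) ⟨_, h.sum_mem_dualMonoid _ Iᶜ⟩
      (h.mem_spanCone_iff_pairing_univ I) y
    have h2 := range_chartMap k hfin (spanCone_le_univ v J) ⟨_, h.sum_mem_dualMonoid _ Jᶜ⟩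
      (h.mem_spanCone_iff_pairing_univ J) y
    -- The sum of the two defining characters cuts out the common face, and its monomial is the
    -- product of the two monomials. It is nonzero at a point exactly when both factors are.
    have h3 := range_chartMap k hfin (h.le_univ_of_mem_fan hi)
      (⟨_, h.sum_mem_dualMonoid _ Iᶜ⟩ + ⟨_, h.sum_mem_dualMonoid _ Jᶜ⟩) (by
        intro x
        change _ ↔ _ ∧ pairing (∑ i ∈ Iᶜ, w i + ∑ i ∈ Jᶜ, w i) x = 0
        rw [Submodule.mem_inf, h.mem_spanCone_iff_pairing_univ I,
          h.mem_spanCone_iff_pairing_univ J, pairing_add]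
        constructor
        · rintro ⟨⟨h1, h2⟩, h3, h4⟩
          exact ⟨h1, by rw [h2, h4, add_zero]⟩
        · rintro ⟨h1, h2⟩
          have h3 := mem_dualMonoid.1 (h.sum_mem_dualMonoid _ Iᶜ) x h1
          have h4 := mem_dualMonoid.1 (h.sum_mem_dualMonoid _ Jᶜ) x h1
          exact ⟨⟨h1, by linarith⟩, h1, by linarith⟩) y
    refine (and_congr h1 h2).trans (Iff.trans ?_ h3.symm)
    have hprime := PrimeSpectrum.isPrime (y : PrimeSpectrum (ChartRing k (spanCone v Finset.univ)))
    rw [← not_or, ← hprime.mul_mem_iff_mem_or_mem, AddMonoidAlgebra.single_mul_single, mul_one]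

end IsDualSystem

end simplicial

/-! ### Lattices of finite index give toric singularities -/

section toric

theorem isLocalization_atPrime_comp_equiv {A B T : Type*} [CommRing A] [CommRing B] [CommRing T]
    (E : B ≃+* A) (g : A →+* T) (P : Ideal A) [P.IsPrime] (Q : Ideal B) [Q.IsPrime]
    (hQ : ∀ b, b ∈ Q ↔ E b ∈ P) (h : @IsLocalization.AtPrime A _ T _ g.toAlgebra P _) :
    @IsLocalization.AtPrime B _ T _ (g.comp E.toRingHom).toAlgebra Q _ := by
  obtain ⟨h1, h2, h3⟩ := (@isLocalization_iff _ _ _ _ _ g.toAlgebra).1 h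
  refine (@isLocalization_iff _ _ _ _ _ (g.comp E.toRingHom).toAlgebra).2 ⟨?_, ?_, ?_⟩
  · rintro ⟨y, hy⟩
    exact h1 ⟨E y, fun h => hy ((hQ _).2 h)⟩
  · intro z
    obtain ⟨⟨a, s⟩, hs⟩ := h2 z
    refine ⟨⟨E.symm a, ⟨E.symm s, fun h => s.2 (by simpa using (hQ _).1 h)⟩⟩, ?_⟩
    change z * g (E (E.symm s)) = g (E (E.symm a))
    rw [E.apply_symm_apply, E.apply_symm_apply]
    exact hs
  · intro x y hxy
    obtain ⟨c, hc⟩ := h3 (x := E x) (y := E y) hxy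
    refine ⟨⟨E.symm c, fun h => c.2 (by simpa using (hQ _).1 h)⟩, ?_⟩
    apply E.injective
    simpa using hc

variable {n : ℕ}

/-- `Λ` is free of rank `n`, and `φ` is given by a basis. The vector `v i` is the `i`-th coordinate
function in that basis, and `w i` represents `N` times the `i`-th unit vector, which lies in `Λ` for
`N` the index. -/
theorem exists_isDualSystem (Λ : AddSubgroup (Fin n → ℤ)) [Λ.FiniteIndex] :
    ∃ v w N, IsDualSystem v w N ∧
      ∃ φ : (Fin n → ℤ) ≃+ Λ, ∀ m i, (φ m).1 i = m ⬝ᵥ v i := by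
  classical
  set N := Λ.index
  have hN : 0 < N := Nat.pos_of_ne_zero AddSubgroup.FiniteIndex.index_ne_zero
  have hmem (x : Fin n → ℤ) : N • x ∈ Λ := Λ.nsmul_index_mem x
  let L : Submodule ℤ (Fin n → ℤ) := AddSubgroup.toIntSubmodule Λ
  have hrank : Module.finrank ℤ L = n := by
    refine le_antisymm ?_ ?_
    · simpa using L.finrank_le
    · let f : (Fin n → ℤ) →ₗ[ℤ] L :=
        LinearMap.codRestrict L ((N : ℤ) • LinearMap.id) fun x => by
          have : (N : ℤ) • x ∈ Λ := by rw [natCast_zsmul]; exact hmem x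
          exact this
      have hf : Function.Injective f := by
        intro x y hxy
        have h1 : (N : ℤ) • x = (N : ℤ) • y := congrArg Subtype.val hxy
        exact smul_right_injective _ (by exact_mod_cast hN.ne') h1
      simpa using LinearMap.finrank_le_finrank_of_injective hf
  let b : Module.Basis (Fin n) ℤ L := Module.finBasisOfFinrankEq ℤ L hrank
  let φ : (Fin n → ℤ) ≃+ Λ := b.equivFun.symm.toAddEquiv
  have hφ (m : Fin n → ℤ) (i : Fin n) : (φ m).1 i = m ⬝ᵥ fun j => (b j).1 i := by
    have : (φ m).1 = ∑ j, m j • (b j).1 := by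
      have h1 : φ m = ∑ j, m j • b j := b.equivFun_symm_apply m
      rw [h1]
      exact (map_sum L.subtype _ _).trans (by simp)
    rw [this, Finset.sum_apply]
    simp [dotProduct]
  refine ⟨fun i j => (b j).1 i, fun i => φ.symm ⟨N • Pi.single i 1, hmem _⟩, N,
    ⟨hN, fun i j => ?_⟩, φ, hφ⟩
  rw [← hφ, φ.apply_symm_apply]
  simp [Pi.single_apply, eq_comm]

/-- Through `φ`, the dual monoid of the cone spanned by the `v i` is the set of elements of `Λ` with
nonnegative coordinates. The required closed point is the origin of this affine toric variety. -/
theorem isToric_of_equiv_supportedSeries {k : Type u} [Field k] (R : Type v) [CommRing R]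
    [Algebra k R] (Λ : AddSubgroup (Fin n → ℤ)) [Λ.FiniteIndex]
    (e : R ≃ₐ[k] supportedSeries k (latticeMonoid Λ)) : IsToric k R := by
  obtain ⟨v, w, N, h, φ, hφ⟩ := exists_isDualSystem Λ
  set σ := spanCone v Finset.univ
  have hσ (m : Fin n → ℤ) : m ∈ dualMonoid σ ↔ ∀ i, 0 ≤ (φ m).1 i := by
    rw [mem_dualMonoid_hull]
    simp [hφ]
  let θ : latticeMonoid Λ →+ dualMonoid σ :=
    { toFun := fun p => ⟨φ.symm ⟨expHom _ p.1, p.2⟩, (hσ _).2 fun i => by simp⟩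
      map_zero' := by
        ext1
        change φ.symm 0 = 0
        exact map_zero _
      map_add' := fun a b => by
        ext1
        change φ.symm ⟨expHom _ (a.1 + b.1), _⟩ = φ.symm _ + φ.symm _
        rw [← map_add]
        congr 1 }
  have hθ : Function.Bijective θ := by
    constructor
    · intro a b hab
      have h1 := φ.symm.injective (congrArg Subtype.val hab)
      exact Subtype.ext (expHom_injective (congrArg Subtype.val h1))
    · rintro ⟨m, hm⟩
      obtain ⟨p, hp⟩ := exists_expHom_eq ((hσ m).1 hm)
      have hpΛ : p ∈ latticeMonoid Λ := by
        rw [mem_latticeMonoid, hp]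
        exact (φ m).2
      refine ⟨⟨p, hpΛ⟩, Subtype.ext ?_⟩
      change φ.symm _ = m
      rw [AddEquiv.symm_apply_eq]
      exact Subtype.ext hp
  let E : AddMonoidAlgebra k (latticeMonoid Λ) ≃ₐ[k] ChartRing k σ :=
    AddMonoidAlgebra.domCongr k k (AddEquiv.ofBijective θ hθ)
  let y : PrimeSpectrum (ChartRing k σ) :=
    ⟨(polyOriginIdeal k (latticeMonoid Λ)).comap E.symm.toRingEquiv.toRingHom,
      Ideal.comap_isPrime _ _⟩
  have hymax : y.asIdeal.IsMaximal :=
    have := polyOriginIdeal_isMaximal (k := k) (latticeMonoid Λ)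
    Ideal.comap_isMaximal_of_surjective _ E.symm.surjective
  obtain ⟨g, hg, hgk⟩ := exists_isLocalization_stalk (chartStructure k σ) (𝟙 (chart k σ))
    (Category.id_comp _) y
  have hg' := isLocalization_atPrime_comp_equiv E.toRingEquiv g y.asIdeal
    (polyOriginIdeal k (latticeMonoid Λ)) (fun b => by
      refine Iff.trans ?_ (Ideal.mem_comap (f := E.symm.toRingEquiv.toRingHom)).symm
      exact iff_of_eq (congrArg (· ∈ polyOriginIdeal k _) (E.symm_apply_apply b).symm)) hg
  obtain ⟨e', he'⟩ := exists_equiv_completedStalk (latticeMonoid_fg Λ) (chartStructure k σ) _ _ hg'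
    fun c => by
      rw [← hgk]
      exact congrArg g (E.commutes c)
  refine ⟨n, h.fan, chart k σ, chartStructure k σ, h.toricVariety k, 𝟙 (chart k σ) y, ?_,
    e.toRingEquiv.trans e', fun c => ?_⟩
  · exact (PrimeSpectrum.isClosed_singleton_iff_isMaximal y).2 hymax
  · exact (congrArg e' (e.commutes c)).trans (he' c)

end toric

/-! ### Coordinate divisors of the ring of series with exponents in a lattice -/

section coordinates

variable {k : Type u} [Field k] {ι : Type}

/-- Exhibits `(X i)` as the kernel of a ring map to a domain, which is how `X i` is seen to be
prime. -/
theorem rescale_eq_zero_iff [DecidableEq ι] (i : ι) (f : MvPowerSeries ι k) :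
    MvPowerSeries.rescale (fun j => if j = i then (0 : k) else 1) f = 0 ↔
      MvPowerSeries.X i ∣ f := by
  have key (m : ι →₀ ℕ) : (m.prod fun j a => (if j = i then (0 : k) else 1) ^ a) =
      if m i = 0 then 1 else 0 := by
    split_ifs with h
    · refine Finset.prod_eq_one fun j hj => ?_
      by_cases hji : j = i
      · subst hji
        simp [h]
      · simp [hji]
    · exact Finset.prod_eq_zero (Finsupp.mem_support_iff.2 h) (by simp [h])
  rw [MvPowerSeries.X_dvd_iff, MvPowerSeries.ext_iff]
  refine forall_congr' fun m => ?_
  rw [MvPowerSeries.coeff_rescale, key, map_zero]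
  by_cases h : m i = 0 <;> simp [h]

theorem prime_X (i : ι) : Prime (MvPowerSeries.X i : MvPowerSeries ι k) := by
  classical
  refine ⟨?_, fun h => ?_, fun a b => ?_⟩
  · intro h
    have := congrArg (MvPowerSeries.coeff (Finsupp.single i 1)) h
    simp [MvPowerSeries.coeff_X] at this
  · have := h.map (MvPowerSeries.constantCoeff (σ := ι) (R := k))
    simp at this
  · rw [← rescale_eq_zero_iff, ← rescale_eq_zero_iff, ← rescale_eq_zero_iff, map_mul]
    exact mul_eq_zero.1

theorem monomial_eq_prod_X (i : ι) (m : ι →₀ ℕ) :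
    (MvPowerSeries.monomial (Finsupp.single i 1 + m) (1 : k)) =
      MvPowerSeries.X i * MvPowerSeries.monomial m 1 := by
  rw [MvPowerSeries.X, MvPowerSeries.monomial_mul_monomial, one_mul]

theorem exists_isUnit_mul_monomial {m : ι →₀ ℕ} {g : MvPowerSeries ι k}
    (h : g ∣ MvPowerSeries.monomial m 1) :
    ∃ u e, IsUnit u ∧ g = u * MvPowerSeries.monomial e 1 := by
  classical
  induction hd : m.degree generalizing m g with
  | zero =>
    rw [Finsupp.degree_eq_zero_iff] at hd
    subst hd
    exact ⟨g, 0, isUnit_of_dvd_one h, by simp⟩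
  | succ d ih =>
    obtain ⟨i, hi⟩ : ∃ i, m i ≠ 0 := by
      by_contra! hall
      rw [show m = 0 from Finsupp.ext hall] at hd
      simp at hd
    obtain ⟨m', rfl⟩ : ∃ m', m = Finsupp.single i 1 + m' :=
      exists_add_of_le (Finsupp.single_le_iff.2 (Nat.one_le_iff_ne_zero.2 hi))
    have hd' : m'.degree = d := by
      rw [map_add, Finsupp.degree_single] at hd
      omega
    obtain ⟨c, hc⟩ := h
    rw [monomial_eq_prod_X] at hc
    have hX := prime_X (k := k) i
    rcases hX.dvd_or_dvd ⟨_, hc.symm⟩ with ⟨g', rfl⟩ | ⟨c', rfl⟩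
    · rw [mul_assoc] at hc
      obtain ⟨u, e, hu, rfl⟩ := ih ⟨c, mul_left_cancel₀ hX.ne_zero hc⟩ hd'
      exact ⟨u, Finsupp.single i 1 + e, hu, by rw [monomial_eq_prod_X]; ring⟩
    · rw [mul_left_comm] at hc
      exact ih ⟨c', mul_left_cancel₀ hX.ne_zero hc⟩ hd'

theorem le_of_mul_monomial_dvd_monomial {a b : ι →₀ ℕ} {u : MvPowerSeries ι k}
    (h : u * MvPowerSeries.monomial a 1 ∣ MvPowerSeries.monomial b 1) : a ≤ b := by
  classical
  obtain ⟨c, hc⟩ := (dvd_mul_left _ _).trans h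
  have := congrArg (MvPowerSeries.coeff b) hc
  rw [MvPowerSeries.coeff_monomial_same, MvPowerSeries.coeff_monomial_mul] at this
  by_contra hab
  rw [if_neg hab] at this
  exact one_ne_zero this

end coordinates

/-! ### The prime divisors `x i = 0` and their torsion in the class group -/

section divisor

variable {k : Type u} [Field k] {ι : Type} {Λ : AddSubgroup (ι → ℤ)}
  {R : Type v} [CommRing R] (e : R ≃+* supportedSeries k (latticeMonoid Λ))

/-- The monomial with exponent vector `m` in the lattice. -/
def latticeMonomial {m : ι →₀ ℕ} (hm : m ∈ latticeMonoid Λ) : R :=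
  e.symm ⟨MvPowerSeries.monomial m 1, monomial_mem_supportedSeries hm 1⟩

theorem equiv_latticeMonomial {m : ι →₀ ℕ} (hm : m ∈ latticeMonoid Λ) :
    (e (latticeMonomial e hm)).1 = MvPowerSeries.monomial m 1 := by
  rw [latticeMonomial, e.apply_symm_apply]

theorem equiv_val_dvd {a b : R} (h : a ∣ b) : (e a).1 ∣ (e b).1 := by
  obtain ⟨c, rfl⟩ := h
  exact ⟨(e c).1, by rw [map_mul]; rfl⟩

/-- The prime ideal of the divisor `x i = 0`. -/
def coordIdeal (i : ι) : Ideal R :=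
  (Ideal.span {(MvPowerSeries.X i : MvPowerSeries ι k)}).comap
    ((supportedSeries k (latticeMonoid Λ)).val.toRingHom.comp e.toRingHom)

theorem mem_coordIdeal {i : ι} {a : R} : a ∈ coordIdeal e i ↔ MvPowerSeries.X i ∣ (e a).1 :=
  Ideal.mem_span_singleton

instance coordIdeal_isPrime (i : ι) : (coordIdeal e i).IsPrime := by
  have := (Ideal.span_singleton_prime (prime_X (k := k) i).ne_zero).2 (prime_X i)
  exact Ideal.comap_isPrime _ _

theorem latticeMonomial_mem_coordIdeal {i : ι} {m : ι →₀ ℕ} (hm : m ∈ latticeMonoid Λ) :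
    latticeMonomial e hm ∈ coordIdeal e i ↔ m i ≠ 0 := by
  classical
  rw [mem_coordIdeal, equiv_latticeMonomial, MvPowerSeries.X_dvd_iff]
  constructor
  · intro h h0
    have := h m h0
    rw [MvPowerSeries.coeff_monomial_same] at this
    exact one_ne_zero this
  · intro h m' hm'
    rw [MvPowerSeries.coeff_monomial, if_neg]
    rintro rfl
    exact h hm'

theorem latticeMonomial_ne_zero {m : ι →₀ ℕ} (hm : m ∈ latticeMonoid Λ) :
    latticeMonomial e hm ≠ 0 := by
  classical
  intro h
  have h1 := equiv_latticeMonomial e hm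
  rw [h, map_zero] at h1
  have := congrArg (MvPowerSeries.coeff m) h1
  rw [MvPowerSeries.coeff_monomial_same] at this
  exact zero_ne_one this

theorem latticeMonomial_dvd_of_forall {w : ι →₀ ℕ} (hw : w ∈ latticeMonoid Λ) {a : R}
    (h : ∀ m, MvPowerSeries.coeff m (e a).1 ≠ 0 → w ≤ m) : latticeMonomial e hw ∣ a := by
  classical
  let g : MvPowerSeries ι k := fun m => MvPowerSeries.coeff (w + m) (e a).1
  have hg (m) : MvPowerSeries.coeff m g = MvPowerSeries.coeff (w + m) (e a).1 := rfl
  have hgmem : g ∈ supportedSeries k (latticeMonoid Λ) := by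
    intro m hm
    rw [hg]
    refine (e a).2 _ fun h => hm ?_
    rw [mem_latticeMonoid, map_add] at h
    exact (Λ.add_mem_cancel_left hw).1 h
  refine ⟨e.symm ⟨g, hgmem⟩, e.injective (Subtype.ext ?_)⟩
  rw [map_mul, e.apply_symm_apply]
  change _ = (e (latticeMonomial e hw)).1 * g
  rw [equiv_latticeMonomial]
  ext m
  rw [MvPowerSeries.coeff_monomial_mul]
  split_ifs with hm
  · rw [one_mul, hg, add_tsub_cancel_of_le hm]
  · by_contra h0
    exact hm (h m h0)

variable [Finite ι]

/-- Adding a large multiple of `q` makes the other coordinates of `x` nonnegative without changing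
the `i`-th. -/
theorem exists_mem_latticeMonoid_apply_eq_one (hq : ∀ i, ∃ q ∈ Λ, q i = 0 ∧ ∀ j ≠ i, 0 < q j)
    {i : ι} (hi : ∃ x ∈ Λ, x i = 1) : ∃ w ∈ latticeMonoid Λ, w i = 1 := by
  have := Fintype.ofFinite ι
  obtain ⟨x, hx, hx1⟩ := hi
  obtain ⟨q, hqΛ, hq0, hqpos⟩ := hq i
  set N : ℕ := ∑ j, (x j).natAbs
  obtain ⟨w, hw⟩ := exists_expHom_eq (v := x + N • q) (by
    intro j
    by_cases hj : j = i
    · subst hj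
      simp [hx1, hq0]
    · have h1 : (x j).natAbs ≤ N := Finset.single_le_sum (f := fun j => (x j).natAbs)
        (fun _ _ => Nat.zero_le _) (Finset.mem_univ j)
      have h2 : (N : ℤ) ≤ N * q j := le_mul_of_one_le_right (by positivity) (hqpos j hj)
      rw [Pi.add_apply, Pi.smul_apply, nsmul_eq_mul]
      omega)
  refine ⟨w, ?_, ?_⟩
  · rw [mem_latticeMonoid, hw]
    exact Λ.add_mem hx (Λ.nsmul_mem hqΛ N)
  · have := congrFun hw i
    simp only [expHom_apply, Pi.add_apply, hx1, Pi.smul_apply, hq0, smul_zero, add_zero] at this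
    exact_mod_cast this

variable [IsDomain R] [IsNoetherianRing R]

/-- The ideal is minimal over a monomial of exponent `w` with `w i = 1`: any `a` in it becomes
divisible by that monomial after multiplication by a high power of the monomial of `q'`, which lies
outside the ideal. Krull's principal ideal theorem applies. -/
theorem height_coordIdeal (hq : ∀ i, ∃ q ∈ Λ, q i = 0 ∧ ∀ j ≠ i, 0 < q j)
    {i : ι} (hi : ∃ x ∈ Λ, x i = 1) : (coordIdeal e i).height = 1 := by
  have := Fintype.ofFinite ι
  obtain ⟨w, hw, hw1⟩ := exists_mem_latticeMonoid_apply_eq_one hq hi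
  obtain ⟨q, hqΛ, hq0, hqpos⟩ := hq i
  obtain ⟨q', hq'⟩ := exists_expHom_eq (v := q) fun j => by
    by_cases hj : j = i
    · rw [hj, hq0]
    · exact (hqpos j hj).le
  have hq'Λ : q' ∈ latticeMonoid Λ := by rwa [mem_latticeMonoid, hq']
  have hq'0 : q' i = 0 := by
    have := congrFun hq' i
    rw [hq0, expHom_apply] at this
    exact_mod_cast this
  have hq'pos (j) (hj : j ≠ i) : 1 ≤ q' j := by
    have := hqpos j hj
    rw [← hq', expHom_apply] at this
    exact_mod_cast this
  have hwmem : latticeMonomial e hw ∈ coordIdeal e i :=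
    (latticeMonomial_mem_coordIdeal e hw).2 (by simp [hw1])
  refine le_antisymm ?_ ?_
  · refine Ideal.height_le_one_of_isPrincipal_of_mem_minimalPrimes
      (Ideal.span {latticeMonomial e hw}) _ ⟨⟨inferInstance,
        (Ideal.span_singleton_le_iff_mem _).2 hwmem⟩, ?_⟩
    rintro Q ⟨hQ, hwQ⟩ hQP a ha
    rw [Ideal.span_singleton_le_iff_mem] at hwQ
    set N : ℕ := ∑ j, w j
    have hN : N • q' ∈ latticeMonoid Λ := (latticeMonoid Λ).nsmul_mem hq'Λ N
    have hdvd : latticeMonomial e hw ∣ latticeMonomial e hN * a := by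
      refine latticeMonomial_dvd_of_forall e hw fun m hm => ?_
      have hmul : (e (latticeMonomial e hN * a)).1 =
          MvPowerSeries.monomial (N • q') 1 * (e a).1 := by
        rw [map_mul, ← equiv_latticeMonomial e hN]
        rfl
      classical
      rw [hmul, MvPowerSeries.coeff_monomial_mul] at hm
      split_ifs at hm with hle
      · intro j
        by_cases hj : j = i
        · subst hj
          rw [hw1, Nat.one_le_iff_ne_zero]
          intro hm0
          rw [one_mul] at hm
          exact hm (MvPowerSeries.X_dvd_iff.1 ((mem_coordIdeal e).1 ha) _ (by simp [hm0]))
        · have h1 : w j ≤ N := Finset.single_le_sum (f := w) (fun _ _ => Nat.zero_le _)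
            (Finset.mem_univ j)
          have h2 := hle j
          rw [Finsupp.smul_apply, smul_eq_mul] at h2
          have h3 := Nat.le_mul_of_pos_right N (hq'pos j hj)
          omega
      · exact absurd rfl hm
    refine (hQ.mem_or_mem (Q.mem_of_dvd hdvd hwQ)).resolve_left fun h => ?_
    exact (latticeMonomial_mem_coordIdeal e hN).1 (hQP h) (by simp [hq'0])
  · rw [Order.one_le_iff_ne_zero, Ne, Ideal.height_eq_zero_iff_eq_bot]
    intro h
    rw [h, Ideal.mem_bot] at hwmem
    exact latticeMonomial_ne_zero e hw hwmem

/-- If the ring of series with exponents in the lattice is `ℚ`-factorial, then the lattice contains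
a multiple of each unit vector. -/
theorem exists_single_mem_of_isQFactorial [IsIntegrallyClosed R] [IsLocalRing R] [DecidableEq ι]
    (e : R ≃+* supportedSeries k (latticeMonoid Λ)) (hR : IsQFactorial R) (hq : ∀ i, ∃ q ∈ Λ, q i = 0 ∧ ∀ j ≠ i, 0 < q j)
    {i : ι} (hi : ∃ x ∈ Λ, x i = 1) : ∃ N : ℕ, 0 < N ∧ Pi.single i (N : ℤ) ∈ Λ := by
  have : DecidableEq (PrimeDivisor R) := Classical.decEq _
  let P : PrimeDivisor R := ⟨⟨coordIdeal e i, inferInstance⟩, height_coordIdeal e hq hi⟩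
  obtain ⟨m, hm, hcart⟩ := hR (Finsupp.single P 1)
  -- A neighbourhood of the closed point is all of `Spec R`, so the divisor `m P` is principal, the
  -- divisor of `a / b`. It is effective, so `a / b` is a ring element `c`.
  obtain ⟨g, hg, a, b, ha, hb, hab⟩ := hcart (IsLocalRing.closedPoint R)
  have hgu : IsUnit g := by
    by_contra h
    exact hg h
  have hord (Q : PrimeDivisor R) :
      ordAlong Q a - ordAlong Q b = if Q = P then (m : ℤ) else 0 := by
    rw [← hab Q fun h => Q.1.2.ne_top (Ideal.eq_top_of_isUnit_mem _ h hgu)]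
    simp [Finsupp.single_apply, eq_comm]
  obtain ⟨c, rfl⟩ := dvd_of_ordAlong_le ha hb fun Q => by
    have := hord Q
    split_ifs at this <;> omega
  have hc : c ≠ 0 := right_ne_zero_of_mul ha
  have hordc (Q : PrimeDivisor R) : ordAlong Q c = if Q = P then (m : ℤ) else 0 := by
    rw [← hord Q, ordAlong_mul Q hb hc]
    ring
  have hcP : c ∈ coordIdeal e i := mem_of_ordAlong_pos P (by rw [hordc, if_pos rfl]; omega)
  -- The divisor of such a monomial contains `P`, so that of its `m`-th power dominates `m P`.
  -- Dividing a monomial, `c` is a unit times a monomial of some exponent `t`.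
  have hdvd {w : ι →₀ ℕ} (hw : w ∈ latticeMonoid Λ) (hwi : w i ≠ 0) :
      c ∣ latticeMonomial e hw ^ m := by
    have hw0 := latticeMonomial_ne_zero e hw
    refine dvd_of_ordAlong_le (pow_ne_zero m hw0) hc fun Q => ?_
    rw [hordc, ordAlong_pow Q hw0]
    split_ifs with hQ
    · subst hQ
      have := ordAlong_pos P hw0 ((latticeMonomial_mem_coordIdeal e hw).2 hwi)
      exact le_mul_of_one_le_right (by positivity) this
    · exact mul_nonneg (by positivity) (ordAlong_nonneg _ _)
  have hdvd' {w : ι →₀ ℕ} (hw : w ∈ latticeMonoid Λ) (hwi : w i ≠ 0) :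
      (e c).1 ∣ MvPowerSeries.monomial (m • w) 1 := by
    have := equiv_val_dvd e (hdvd hw hwi)
    rw [map_pow] at this
    change _ ∣ (e (latticeMonomial e hw)).1 ^ m at this
    rwa [equiv_latticeMonomial, MvPowerSeries.monomial_pow, one_pow] at this
  obtain ⟨w, hw, hw1⟩ := exists_mem_latticeMonoid_apply_eq_one hq hi
  obtain ⟨u, t, hu, ht⟩ := exists_isUnit_mul_monomial (hdvd' hw (by simp [hw1]))
  have htΛ : t ∈ latticeMonoid Λ := by
    by_contra h
    have h1 := (e c).2 t h
    rw [ht, MvPowerSeries.coeff_mul_monomial, if_pos le_rfl, tsub_self, mul_one] at h1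
    have h2 := hu.map (MvPowerSeries.constantCoeff (σ := ι) (R := k))
    rw [← MvPowerSeries.coeff_zero_eq_constantCoeff_apply, h1] at h2
    exact not_isUnit_zero h2
  have hti : t i ≠ 0 := by
    have h1 := (mem_coordIdeal e).1 hcP
    rw [ht] at h1
    rcases (prime_X i).dvd_or_dvd h1 with h2 | h2
    · exact absurd (isUnit_of_dvd_unit h2 hu) (prime_X i).not_isUnit
    · intro h0
      have := MvPowerSeries.X_dvd_iff.1 h2 t h0
      rw [MvPowerSeries.coeff_monomial_same] at this
      exact one_ne_zero this
  -- The monomial of an element that vanishes at `j` but is positive at `i` has an `m`-th power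
  -- divisible by `c`, which bounds `t j` by zero.
  have htj (j) (hj : j ≠ i) : t j = 0 := by
    obtain ⟨q, hqΛ, hq0, hqpos⟩ := hq j
    obtain ⟨q', rfl⟩ := exists_expHom_eq (v := q) fun l => by
      by_cases hl : l = j
      · rw [hl, hq0]
      · exact (hqpos l hl).le
    have hqi : q' i ≠ 0 := by
      have := hqpos i hj.symm
      rw [expHom_apply] at this
      omega
    have h1 := hdvd' (w := q') hqΛ hqi
    rw [ht] at h1
    have h2 := le_of_mul_monomial_dvd_monomial h1 j
    rw [expHom_apply] at hq0
    have h3 : q' j = 0 := by exact_mod_cast hq0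
    simpa [h3] using h2
  refine ⟨t i, Nat.pos_of_ne_zero hti, ?_⟩
  have : expHom ι t = Pi.single i (t i : ℤ) := by
    ext j
    by_cases hj : j = i
    · subst hj
      simp
    · simp [htj j hj, hj]
  rw [← this]
  exact htΛ

end divisor

/-! ### Dimension -/

section dimension

/-- `Λ` contains the product of the `N i ℤ`, so coordinatewise residues represent all classes. -/
theorem finiteIndex_of_forall_single_mem {ι : Type} [Finite ι] [DecidableEq ι]
    {Λ : AddSubgroup (ι → ℤ)} (h : ∀ i, ∃ N : ℕ, 0 < N ∧ Pi.single i (N : ℤ) ∈ Λ) :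
    Λ.FiniteIndex := by
  have := Fintype.ofFinite ι
  choose N hN hmem using h
  have hΛ (x : ι → ℤ) : (fun i => N i * x i) ∈ Λ := by
    have : (fun i => N i * x i) = ∑ i, x i • Pi.single i (N i : ℤ) := by
      ext i
      simp [Finset.sum_apply, Pi.single_apply, mul_comm]
    rw [this]
    exact Λ.sum_mem fun i _ => Λ.zsmul_mem (hmem i) _
  have : Finite ((ι → ℤ) ⧸ Λ) := by
    refine Finite.of_surjective (α := ∀ i, Fin (N i))
      (fun a => QuotientAddGroup.mk (fun i => ((a i : ℕ) : ℤ))) fun q => ?_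
    induction q using QuotientAddGroup.induction_on with
    | H x =>
      have hpos (i) : (0 : ℤ) < N i := by exact_mod_cast hN i
      have hlt (i) : (x i % N i).toNat < N i := by
        have h1 := Int.emod_nonneg (x i) (hpos i).ne'
        have h2 := Int.emod_lt_of_pos (x i) (hpos i)
        omega
      refine ⟨fun i => ⟨(x i % N i).toNat, hlt i⟩, ?_⟩
      rw [QuotientAddGroup.eq]
      convert hΛ fun i => x i / N i using 1
      ext i
      have h1 := Int.emod_nonneg (x i) (hpos i).ne'
      have h2 := Int.emod_add_mul_ediv (x i) (N i)
      simp only [Pi.add_apply, Pi.neg_apply]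
      omega
  exact AddSubgroup.finiteIndex_of_finite_quotient

variable {k : Type u} [Field k]

theorem card_le_ringKrullDim_mvPowerSeries (n : ℕ) :
    (n : WithBot ℕ∞) ≤ ringKrullDim (MvPowerSeries (Fin n) k) := by
  induction n with
  | zero =>
    rw [ringKrullDim_eq_of_ringEquiv (MvPowerSeries.isEmptyEquiv (σ := Fin 0) (R := k)).toRingEquiv,
      ringKrullDim_eq_zero_of_field]
    rfl
  | succ n ih =>
    rw [ringKrullDim_eq_of_ringEquiv (MvPowerSeries.finSuccEquiv (R := k) (n := n)).toRingEquiv]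
    refine le_trans ?_ ringKrullDim_succ_le_ringKrullDim_powerseries
    push_cast
    gcongr

theorem natCard_le_ringKrullDim_mvPowerSeries (ι : Type) [Finite ι] :
    (Nat.card ι : WithBot ℕ∞) ≤ ringKrullDim (MvPowerSeries ι k) := by
  rw [ringKrullDim_eq_of_ringEquiv
    (MvPowerSeries.renameEquiv k (Finite.equivFin ι)).toRingEquiv]
  exact card_le_ringKrullDim_mvPowerSeries _

/-- Incomparability: contraction along an integral map is strictly increasing on chains of primes.
-/
theorem ringKrullDim_le_of_finite {A B : Type*} [CommRing A] [CommRing B] (φ : A →+* B)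
    (hφ : φ.Finite) : ringKrullDim B ≤ ringKrullDim A := by
  let := φ.toAlgebra
  have : Module.Finite A B := hφ
  exact Order.krullDim_le_of_strictMono (PrimeSpectrum.comap (algebraMap A B)) fun _ _ h =>
    Ideal.IsIntegral.comap_lt_comap h

theorem mem_span_range_X {ι : Type} [Finite ι] {f : MvPowerSeries ι k}
    (hf : MvPowerSeries.constantCoeff f = 0) :
    f ∈ Ideal.span (Set.range (MvPowerSeries.X : ι → MvPowerSeries ι k)) := by
  classical
  have := Fintype.ofFinite ι
  by_cases hι : Nonempty ι
  swap
  · have := not_nonempty_iff.1 hι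
    have : f = 0 := by
      ext m
      rw [Subsingleton.elim m 0, MvPowerSeries.coeff_zero_eq_constantCoeff_apply, hf, map_zero]
    rw [this]
    exact zero_mem _
  have hex (m : ι →₀ ℕ) (hm : m ≠ 0) : ∃ i, m i ≠ 0 := by
    by_contra! h
    exact hm (Finsupp.ext h)
  choose! c hc using hex
  let g : ι → MvPowerSeries ι k := fun i m => if m ≠ 0 ∧ c m = i then MvPowerSeries.coeff m f else 0
  have hg (i m) : MvPowerSeries.coeff m (g i) =
    if m ≠ 0 ∧ c m = i then MvPowerSeries.coeff m f else 0 := rfl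
  have hfg : f = ∑ i, g i := by
    ext m
    rw [map_sum]
    simp_rw [hg]
    by_cases hm : m = 0
    · subst hm
      simpa using hf
    · simp [hm]
  rw [hfg]
  refine Ideal.sum_mem _ fun i _ => Ideal.mem_of_dvd _ (MvPowerSeries.X_dvd_iff.2 fun m hm => ?_)
    (Ideal.subset_span ⟨i, rfl⟩)
  rw [hg, if_neg]
  rintro ⟨h0, rfl⟩
  exact hc m h0 hm

theorem isMaximal_of_forall_X_mem {ι : Type} [Finite ι] {Q : Ideal (MvPowerSeries ι k)}
    [Q.IsPrime] (h : ∀ i, MvPowerSeries.X i ∈ Q) : Q.IsMaximal := by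
  have hmax : (RingHom.ker (MvPowerSeries.constantCoeff (σ := ι) (R := k))).IsMaximal :=
    RingHom.ker_isMaximal_of_surjective _ fun c => ⟨MvPowerSeries.C c, by simp⟩
  have hle : RingHom.ker (MvPowerSeries.constantCoeff (σ := ι) (R := k)) ≤ Q := fun f hf =>
    (Ideal.span_le.2 (by rintro _ ⟨i, rfl⟩; exact h i)) (mem_span_range_X hf)
  rwa [← hmax.eq_of_le (Ideal.IsPrime.ne_top inferInstance) hle]

/-- A prime of `R` containing `s` lies under a prime of `S` containing its image. That prime is
maximal, hence so is its contraction, and `R` modulo `s` has dimension zero. -/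
theorem ringKrullDim_le_card_of_finite {R S : Type*} [CommRing R] [IsNoetherianRing R]
    [IsLocalRing R] [CommRing S] (φ : R →+* S) (hφ : Function.Injective φ) (hfin : φ.Finite)
    (s : Finset R) (hs : ∀ a ∈ s, ¬ IsUnit a)
    (h : ∀ Q : Ideal S, Q.IsPrime → (∀ a ∈ s, φ a ∈ Q) → Q.IsMaximal) :
    ringKrullDim R ≤ s.card := by
  let := φ.toAlgebra
  have : FaithfulSMul R S := (faithfulSMul_iff_algebraMap_injective _ _).2 hφ
  have : Module.Finite R S := hfin
  refine (ringKrullDim_le_ringKrullDim_quotient_add_card s fun a ha => ?_).trans ?_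
  · rw [IsLocalRing.ringJacobson_eq_maximalIdeal]
    exact hs a ha
  · have h0 : Ring.KrullDimLE 0 (R ⧸ Ideal.span (s : Set R)) := by
      refine Ring.krullDimLE_zero_iff.2 fun P hP => ?_
      have hsurj := Ideal.Quotient.mk_surjective (I := Ideal.span (s : Set R))
      set P' := P.comap (Ideal.Quotient.mk (Ideal.span (s : Set R))) with hP'
      obtain ⟨Q, -, hQ, hQP⟩ := Ideal.exists_ideal_over_prime_of_isIntegral (S := S) P' ⊥ (by
        rw [← RingHom.ker_eq_comap_bot,
          (RingHom.injective_iff_ker_eq_bot _).1 (FaithfulSMul.algebraMap_injective R S)]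
        exact bot_le)
      have hQmax : Q.IsMaximal := h Q hQ fun a ha => by
        have : a ∈ P' := by
          rw [Ideal.mem_comap, Ideal.Quotient.eq_zero_iff_mem.2 (Ideal.subset_span ha)]
          exact P.zero_mem
        rw [← hQP] at this
        exact this
      have hmax : P'.IsMaximal := by
        rw [← hQP]
        exact Ideal.isMaximal_comap_of_isIntegral_of_isMaximal Q
      have hmap := Ideal.map_comap_of_surjective _ hsurj P
      rw [← hP'] at hmap
      have := Ideal.map_eq_top_or_isMaximal_of_surjective _ hsurj hmax
      rw [hmap] at this
      exact this.resolve_left hP.ne_top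
    have h1 := Ring.krullDimLE_iff.1 h0
    calc _ ≤ ((0 : ℕ) : WithBot ℕ∞) + s.card := by gcongr
      _ = _ := by simp

/-- The upper bound comes from the parameters `x i ^ N` with `N` the index of `Λ`, the lower one
from the finite extension by the full power series ring. -/
theorem ringKrullDim_of_equiv_supportedSeries {ι : Type} [Finite ι] {Λ : AddSubgroup (ι → ℤ)}
    [Λ.FiniteIndex] {R : Type v} [CommRing R] [IsNoetherianRing R] [IsLocalRing R]
    (e : R ≃+* supportedSeries k (latticeMonoid Λ)) : ringKrullDim R = Nat.card ι := by
  classical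
  have := Fintype.ofFinite ι
  let φ : R →+* MvPowerSeries ι k :=
    (algebraMap (supportedSeries k (latticeMonoid Λ)) (MvPowerSeries ι k)).comp e.toRingHom
  have hfin : φ.Finite :=
    (RingHom.finite_algebraMap.2 (module_finite_supportedSeries (k := k) Λ)).comp
      (RingHom.Finite.of_surjective _ e.surjective)
  have hφ : Function.Injective φ := Subtype.val_injective.comp e.injective
  have hφm {m : ι →₀ ℕ} (hm : m ∈ latticeMonoid Λ) :
      φ (latticeMonomial e hm) = MvPowerSeries.monomial m 1 := equiv_latticeMonomial e hm
  clear_value φ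
  refine le_antisymm ?_ ((natCard_le_ringKrullDim_mvPowerSeries (k := k) ι).trans
    (ringKrullDim_le_of_finite φ hfin))
  have hmem (i : ι) : Λ.index • Finsupp.single i 1 ∈ latticeMonoid Λ := nsmul_mem_latticeMonoid _
  have hX (i : ι) : φ (latticeMonomial e (hmem i)) = MvPowerSeries.X i ^ Λ.index := by
    rw [hφm, MvPowerSeries.X_pow_eq]
    simp
  have hN : Λ.index ≠ 0 := AddSubgroup.FiniteIndex.index_ne_zero
  refine (ringKrullDim_le_card_of_finite φ hφ hfin
    (Finset.univ.image fun i => latticeMonomial e (hmem i)) ?_ ?_).trans ?_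
  · intro a ha hu
    obtain ⟨i, -, rfl⟩ := Finset.mem_image.1 ha
    have := hu.map φ
    rw [hX, isUnit_pow_iff hN] at this
    exact (prime_X i).not_isUnit this
  · intro Q hQ h
    refine isMaximal_of_forall_X_mem fun i => hQ.mem_of_pow_mem Λ.index ?_
    rw [← hX]
    exact h _ (Finset.mem_image_of_mem _ (Finset.mem_univ i))
  · rw [Nat.card_eq_fintype_card]
    exact_mod_cast Finset.card_image_le

end dimension

/-! ### The canonical map of a diagonalizable group action away from coordinate hyperplanes -/

namespace FiniteTorusSubgroup

variable {k : Type u} [Field k] {n : ℕ} (G : FiniteTorusSubgroup k n)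

/-- The characters of `G`. -/
abbrev CharGroup : Type := (Fin n → ℤ) ⧸ G.lattice

section basis

variable {G} {e : G.CharGroup → Fin n →₀ ℕ}
  (he : ∀ χ, (QuotientAddGroup.mk (expHom _ (e χ)) : G.CharGroup) = χ)

theorem character_eq_of_mk_eq {a b : Fin n → ℤ}
    (h : (QuotientAddGroup.mk a : G.CharGroup) = QuotientAddGroup.mk b) :
    G.character (.ofAdd a) = G.character (.ofAdd b) := by
  rw [character_eq_iff, ← neg_mem_iff]
  convert QuotientAddGroup.eq.1 h using 1
  abel

include he in
theorem linearIndependent_character :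
    LinearIndependent k fun χ => G.character (.ofAdd (expHom _ (e χ))) := by
  have h1 : LinearIndepOn k id {a : G.CoordRing | IsGroupLikeElem k a} :=
    linearIndepOn_isGroupLikeElem
  refine h1.linearIndependent.comp
    (fun χ => (⟨_, G.isGroupLikeElem_character _⟩ : {a : G.CoordRing | IsGroupLikeElem k a}))
    fun χ χ' h => ?_
  rw [← he χ, ← he χ', QuotientAddGroup.eq, ← neg_mem_iff]
  convert G.character_eq_iff.1 (congrArg Subtype.val h) using 1
  abel

include he in
theorem span_character : ⊤ ≤
    Submodule.span k (Set.range fun χ => G.character (.ofAdd (expHom _ (e χ)))) := by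
  rintro b -
  obtain ⟨a, rfl⟩ := Ideal.Quotient.mk_surjective b
  induction a using AddMonoidAlgebra.induction_linear with
  | zero => rw [map_zero]; exact zero_mem _
  | add a b ha hb => rw [map_add]; exact add_mem ha hb
  | single m c =>
    have h1 : Ideal.Quotient.mk G.ideal (AddMonoidAlgebra.single m c) =
        c • G.character (.ofAdd m) := by
      rw [character_apply, ← Ideal.Quotient.mkₐ_eq_mk k, ← map_smul, AddMonoidAlgebra.smul_single,
        smul_eq_mul, mul_one]
    rw [h1]
    refine Submodule.smul_mem _ _ (Submodule.subset_span ⟨QuotientAddGroup.mk m, ?_⟩)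
    exact character_eq_of_mk_eq (he _)

theorem coeff_proj_mul_C (f : PowerSeriesRing k n) (t : G.CoordRing) (m : Fin n →₀ ℕ) :
    MvPowerSeries.coeff m (G.proj f * MvPowerSeries.C t) = MvPowerSeries.coeff m f • t := by
  rw [MvPowerSeries.coeff_mul_C, coeff_proj]
  exact (Algebra.smul_def _ _).symm

theorem coaction_monomial (m : Fin n →₀ ℕ) :
    G.coaction (MvPowerSeries.monomial m 1) =
      G.proj (MvPowerSeries.monomial m 1) *
        MvPowerSeries.C (G.character (.ofAdd (expHom _ m))) := by
  classical
  ext e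
  rw [coeff_coaction, coeff_proj_mul_C, MvPowerSeries.coeff_monomial]
  split_ifs with h
  · rw [h, map_one, mul_one, one_smul]
  · rw [map_zero, mul_zero, zero_smul]

variable [Fintype G.CharGroup]

include he in
/-- The functions on `G × Spec S` are the combinations of the characters of `G` with coefficients
in `S`. -/
theorem exists_eq_sum_proj_mul_C (b : G.ProductRing) : ∃ c : G.CharGroup → PowerSeriesRing k n,
    b = ∑ χ, G.proj (c χ) * MvPowerSeries.C (G.character (.ofAdd (expHom _ (e χ)))) := by
  let B := Module.Basis.mk (linearIndependent_character he) (span_character he)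
  let c : G.CharGroup → PowerSeriesRing k n := fun χ m => B.repr (MvPowerSeries.coeff m b) χ
  have hc (χ m) : MvPowerSeries.coeff m (c χ) = B.repr (MvPowerSeries.coeff m b) χ := rfl
  refine ⟨c, ?_⟩
  ext m
  rw [map_sum]
  simp_rw [coeff_proj_mul_C, hc]
  conv_lhs => rw [← B.sum_repr (MvPowerSeries.coeff m b)]
  refine Finset.sum_congr rfl fun χ _ => ?_
  rw [Module.Basis.mk_apply]

include he in
theorem eq_zero_of_sum_proj_mul_C_eq_zero {c : G.CharGroup → PowerSeriesRing k n}
    (h : ∑ χ, G.proj (c χ) * MvPowerSeries.C (G.character (.ofAdd (expHom _ (e χ)))) = 0)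
    (χ : G.CharGroup) : c χ = 0 := by
  ext m
  have h1 := congrArg (MvPowerSeries.coeff m) h
  rw [map_sum, map_zero] at h1
  simp_rw [coeff_proj_mul_C] at h1
  exact Fintype.linearIndependent_iff.1 (linearIndependent_character he) _ h1 χ

end basis

theorem canonicalMap_tmul (a b : PowerSeriesRing k n) :
    G.canonicalMap (a ⊗ₜ b) = G.proj a * G.coaction b :=
  Algebra.TensorProduct.productMap_apply_tmul _ _ _ _

/-! ### The canonical map after inverting an invariant monomial -/

section localization

variable {G} {e e' : G.CharGroup → Fin n →₀ ℕ} {w : Fin n →₀ ℕ}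
  (he : ∀ χ, (QuotientAddGroup.mk (expHom _ (e χ)) : G.CharGroup) = χ)
  (hw : w ∈ latticeMonoid G.lattice) (hee' : ∀ χ, e χ + e' χ = w)

theorem monomial_mem_invariants (hw : w ∈ latticeMonoid G.lattice) :
    (MvPowerSeries.monomial w 1 : PowerSeriesRing k n) ∈ G.invariants := by
  rw [invariants_eq]
  exact monomial_mem_supportedSeries hw 1

variable [Fintype G.CharGroup]

-- The function `χ` on `G` is the quotient of the coaction by the projection of the monomial of
-- exponent `e χ`. Multiplying by the monomial of exponent `w` clears this denominator, with
-- cofactor the monomial of exponent `e' χ`.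
include he hee' in
theorem exists_canonicalMap_eq (b : G.ProductRing) : ∃ a,
    G.canonicalMap a = G.canonicalMap (MvPowerSeries.monomial w 1 ⊗ₜ 1) * b := by
  obtain ⟨c, rfl⟩ := exists_eq_sum_proj_mul_C he b
  refine ⟨∑ χ, (MvPowerSeries.monomial (e' χ) 1 * c χ) ⊗ₜ MvPowerSeries.monomial (e χ) 1, ?_⟩
  rw [map_sum, Finset.mul_sum]
  refine Finset.sum_congr rfl fun χ _ => ?_
  have h1 : (MvPowerSeries.monomial w 1 : PowerSeriesRing k n) =
      MvPowerSeries.monomial (e χ) 1 * MvPowerSeries.monomial (e' χ) 1 := by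
    rw [MvPowerSeries.monomial_mul_monomial, hee', one_mul]
  rw [canonicalMap_tmul, canonicalMap_tmul, coaction_monomial, h1, map_mul, map_mul, map_one G.coaction]
  ring

/-- The part of a power series on which `G` acts through the given character. -/
def isotypicPart (χ : G.CharGroup) (f : PowerSeriesRing k n) : PowerSeriesRing k n :=
  open Classical in fun m =>
    if (QuotientAddGroup.mk (expHom _ m) : G.CharGroup) = χ then MvPowerSeries.coeff m f else 0

open Classical in
omit [Fintype G.CharGroup] in
theorem coeff_isotypicPart (χ : G.CharGroup) (f : PowerSeriesRing k n) (m : Fin n →₀ ℕ) :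
    MvPowerSeries.coeff m (isotypicPart χ f) =
      if (QuotientAddGroup.mk (expHom _ m) : G.CharGroup) = χ then MvPowerSeries.coeff m f
      else 0 := rfl

theorem sum_isotypicPart (f : PowerSeriesRing k n) :
    ∑ χ : G.CharGroup, isotypicPart χ f = f := by
  classical
  ext m
  rw [map_sum]
  simp_rw [coeff_isotypicPart]
  simp

include he hw hee' in
omit [Fintype G.CharGroup] in
theorem monomial_mul_isotypicPart_mem (χ : G.CharGroup) (f : PowerSeriesRing k n) :
    MvPowerSeries.monomial (e' χ) 1 * isotypicPart χ f ∈ G.invariants := by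
  classical
  rw [invariants_eq]
  intro m hm
  rw [MvPowerSeries.coeff_monomial_mul]
  split_ifs with hle
  · rw [one_mul, coeff_isotypicPart, if_neg]
    intro h
    apply hm
    obtain ⟨d, rfl⟩ := exists_add_of_le hle
    rw [add_tsub_cancel_left, ← he χ, QuotientAddGroup.eq] at h
    rw [mem_latticeMonoid, ← hee' χ, map_add] at hw
    rw [mem_latticeMonoid, map_add]
    have := G.lattice.sub_mem hw h
    convert this using 1
    abel
  · rfl

-- Decompose the right factor into isotypic parts. The monomial of exponent `e' χ` times the
-- `χ`-part is invariant, so it can be moved to the left factor, leaving only the monomial of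
-- exponent `e χ` on the right.
include he hw hee' in
theorem exists_monomial_tmul_one_mul_eq
    (a : PowerSeriesRing k n ⊗[G.invariants] PowerSeriesRing k n) :
    ∃ c : G.CharGroup → PowerSeriesRing k n,
      MvPowerSeries.monomial w 1 ⊗ₜ 1 * a = ∑ χ, c χ ⊗ₜ MvPowerSeries.monomial (e χ) 1 := by
  induction a using TensorProduct.induction_on with
  | zero => exact ⟨0, by simp⟩
  | add a b ha hb =>
    obtain ⟨c, hc⟩ := ha
    obtain ⟨d, hd⟩ := hb
    refine ⟨c + d, ?_⟩
    rw [mul_add, hc, hd, ← Finset.sum_add_distrib]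
    exact Finset.sum_congr rfl fun χ _ => (TensorProduct.add_tmul _ _ _).symm
  | tmul s t =>
    refine ⟨fun χ => MvPowerSeries.monomial (e' χ) 1 * isotypicPart χ t * s, ?_⟩
    let wi : G.invariants := ⟨MvPowerSeries.monomial w 1, monomial_mem_invariants hw⟩
    let r : G.CharGroup → G.invariants := fun χ =>
      ⟨_, monomial_mul_isotypicPart_mem he hw hee' χ t⟩
    have h1 : MvPowerSeries.monomial w 1 ⊗ₜ[G.invariants] 1 * (s ⊗ₜ t) = s ⊗ₜ[G.invariants] (wi • t) := by
      rw [Algebra.TensorProduct.tmul_mul_tmul, one_mul, TensorProduct.tmul_smul,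
        TensorProduct.smul_tmul']
      rfl
    have h2 : wi • t = ∑ χ, r χ • (MvPowerSeries.monomial (e χ) 1 : PowerSeriesRing k n) := by
      conv_lhs => rw [← sum_isotypicPart (G := G) t, Finset.smul_sum]
      refine Finset.sum_congr rfl fun χ _ => ?_
      change MvPowerSeries.monomial w 1 * isotypicPart χ t =
        MvPowerSeries.monomial (e' χ) 1 * isotypicPart χ t * MvPowerSeries.monomial (e χ) 1
      rw [← hee' χ, ← one_mul (1 : k), ← MvPowerSeries.monomial_mul_monomial, one_mul]
      ring
    rw [h1, h2, TensorProduct.tmul_sum]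
    refine Finset.sum_congr rfl fun χ _ => ?_
    rw [TensorProduct.tmul_smul, TensorProduct.smul_tmul']
    rfl

-- In the normal form the canonical map reads off the left coefficients, up to monomials, as
-- coordinates along the linearly independent characters; so all of them vanish.
include he hw hee' in
theorem monomial_tmul_one_mul_eq_zero
    {a : PowerSeriesRing k n ⊗[G.invariants] PowerSeriesRing k n} (ha : G.canonicalMap a = 0) :
    MvPowerSeries.monomial w 1 ⊗ₜ 1 * a = 0 := by
  obtain ⟨c, hc⟩ := exists_monomial_tmul_one_mul_eq he hw hee' a
  have h1 := congrArg G.canonicalMap hc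
  rw [map_mul, ha, mul_zero, map_sum] at h1
  simp_rw [canonicalMap_tmul, coaction_monomial, ← mul_assoc, ← map_mul] at h1
  have h2 := eq_zero_of_sum_proj_mul_C_eq_zero he h1.symm
  rw [hc]
  refine Finset.sum_eq_zero fun χ _ => ?_
  have h3 : c χ = 0 := by
    refine (mul_eq_zero.1 (h2 χ)).resolve_right fun h => ?_
    have := congrArg (MvPowerSeries.coeff (e χ)) h
    classical
    rw [MvPowerSeries.coeff_monomial_same] at this
    exact one_ne_zero this
  rw [h3, TensorProduct.zero_tmul]

end localization

end FiniteTorusSubgroup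

/-! ### Isomorphisms over unions of basic open sets -/

section restrict

/-- `φ` is bijective up to powers of `z`, and these become invertible in `L` and `L'`. -/
theorem bijective_of_isLocalization_away {T B L L' : Type*} [CommRing T] [CommRing B] [CommRing L]
    [CommRing L'] [Algebra T L] [Algebra B L'] (φ : T →+* B) (z : T) [IsLocalization.Away z L]
    [IsLocalization.Away (φ z) L'] (ψ : L →+* L')
    (hψ : ∀ t, ψ (algebraMap T L t) = algebraMap B L' (φ t))
    (hinj : ∀ a, φ a = 0 → ∃ M, z ^ M * a = 0)
    (hsurj : ∀ b, ∃ M a, φ a = φ z ^ M * b) : Function.Bijective ψ := by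
  have hu : IsUnit (algebraMap T L z) := IsLocalization.Away.algebraMap_isUnit z
  have hu' : IsUnit (algebraMap B L' (φ z)) := IsLocalization.Away.algebraMap_isUnit (φ z)
  constructor
  · rw [injective_iff_map_eq_zero]
    intro x hx
    obtain ⟨⟨a, _, N, rfl⟩, ha⟩ := IsLocalization.surj (Submonoid.powers z) x
    have h1 : algebraMap B L' (φ a) = 0 := by
      rw [← hψ, ← ha, map_mul, hx, zero_mul]
    obtain ⟨⟨_, N', rfl⟩, h2⟩ :=
      (IsLocalization.map_eq_zero_iff (Submonoid.powers (φ z)) L' _).1 h1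
    obtain ⟨M, hM⟩ := hinj (z ^ N' * a) (by rw [map_mul, map_pow]; exact h2)
    have h3 : algebraMap T L a = 0 := by
      have := congrArg (algebraMap T L) hM
      rw [map_mul, map_mul, map_pow, map_pow, map_zero] at this
      exact (hu.pow N').mul_right_eq_zero.1 ((hu.pow M).mul_right_eq_zero.1 this)
    rw [h3] at ha
    exact (IsUnit.mul_left_eq_zero (by simpa using hu.pow N)).1 ha
  · intro x
    obtain ⟨⟨b, _, N, rfl⟩, hb⟩ := IsLocalization.surj (Submonoid.powers (φ z)) x
    obtain ⟨M, a, ha⟩ := hsurj b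
    obtain ⟨v, hv⟩ := (hu.pow (M + N)).exists_left_inv
    refine ⟨algebraMap T L a * v, ?_⟩
    have h1 : ψ v * algebraMap B L' (φ z) ^ (M + N) = 1 := by
      rw [← hψ, ← map_pow, ← map_mul, hv, map_one]
    refine (hu'.pow (M + N)).mul_left_injective ?_
    change _ * _ = _ * _
    have hb' : x * algebraMap B L' (φ z) ^ N = algebraMap B L' b := by
      rw [← map_pow]
      exact hb
    rw [map_mul, mul_assoc, h1, mul_one, hψ, ha, map_mul, map_pow, pow_add, ← hb']
    ring

theorem isIso_morphismRestrict_basicOpen {T B : CommRingCat.{u}} (φ : T ⟶ B) (z : T)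
    (hinj : ∀ a, φ.hom a = 0 → ∃ M, z ^ M * a = 0)
    (hsurj : ∀ b, ∃ M a, φ.hom a = φ.hom z ^ M * b) :
    IsIso (Spec.map φ ∣_ PrimeSpectrum.basicOpen z) := by
  have hU : IsAffineOpen (X := Spec T) (PrimeSpectrum.basicOpen z) := IsAffineOpen.Spec_basicOpen z
  rw [isIso_morphismRestrict_iff_isIso_app _ hU, ConcreteCategory.isIso_iff_bijective]
  have h1 (A : CommRingCat.{u}) (x : A) (U : (Spec A).Opens)
      (hU : U = PrimeSpectrum.basicOpen x) : IsLocalization.Away x Γ(Spec A, U) := by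
    subst hU
    infer_instance
  let D : (Spec T).Opens := PrimeSpectrum.basicOpen z
  have h2 : IsLocalization.Away z Γ(Spec T, D) := h1 T z D rfl
  have h3 := h1 B (φ.hom z) (Spec.map φ ⁻¹ᵁ D) rfl
  refine bijective_of_isLocalization_away φ.hom z
    ((Spec.map φ).app D).hom (fun t => ?_) hinj hsurj
  have key : ((Scheme.ΓSpecIso T).inv ≫ (Spec T).presheaf.map
        (homOfLE (le_top : D ≤ ⊤)).op) ≫
        (Spec.map φ).app D =
      φ ≫ (Scheme.ΓSpecIso B).inv ≫ (Spec B).presheaf.map (homOfLE le_top).op := by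
    rw [← Category.assoc φ, Scheme.ΓSpecIso_inv_naturality, Category.assoc, Category.assoc,
      Scheme.Hom.naturality]
    rfl
  exact congrArg (fun g => g.hom t) key

theorem isIso_morphismRestrict_iSup {X Y : Scheme.{u}} (f : X ⟶ Y) {κ : Type*}
    (U : κ → Y.Opens) (h : ∀ i, IsIso (f ∣_ U i)) : IsIso (f ∣_ ⨆ i, U i) := by
  have hle (i : κ) : U i ≤ ⨆ i, U i := le_iSup U i
  refine IsZariskiLocalAtTarget.of_iSup_eq_top (P := MorphismProperty.isomorphisms Scheme.{u})
    (fun i => (⨆ i, U i).ι ⁻¹ᵁ U i) ?_ fun i => ?_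
  · rw [← Scheme.Hom.preimage_iSup]
    exact Scheme.Opens.ι_preimage_self _
  · refine (MorphismProperty.arrow_mk_iso_iff _
      (morphismRestrictRestrict f (⨆ i, U i) ((⨆ i, U i).ι ⁻¹ᵁ U i))).2 ?_
    have : (⨆ i, U i).ι ''ᵁ ((⨆ i, U i).ι ⁻¹ᵁ U i) = U i := by
      rw [Scheme.Hom.image_preimage_eq_opensRange_inf, Scheme.Opens.opensRange_ι]
      exact inf_eq_right.2 (hle i)
    rw [this]
    exact h i

end restrict

/-! ### Freeness in codimension one -/

namespace FiniteTorusSubgroup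

variable {k : Type u} [Field k] {n : ℕ} (G : FiniteTorusSubgroup k n)

/-- The exponent vector of the product of the coordinates in `J`. -/
def prodExponent (J : Finset (Fin n)) : Fin n →₀ ℕ := ∑ i ∈ J, Finsupp.single i 1

theorem prodExponent_apply (J : Finset (Fin n)) (i : Fin n) :
    prodExponent J i = if i ∈ J then 1 else 0 := by
  simp [prodExponent, Finsupp.finsetSum_apply, Finsupp.single_apply]

/-- Every character of `G` is the restriction of a character in the coordinates in `J`. -/
def Generates (J : Finset (Fin n)) : Prop :=
  ∀ m : Fin n → ℤ, ∃ x ∈ G.lattice, ∀ i ∉ J, x i = m i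

variable {G}

theorem Generates.exists_exponent {J : Finset (Fin n)} (hJ : G.Generates J) (χ : G.CharGroup) :
    ∃ e : Fin n →₀ ℕ, (QuotientAddGroup.mk (expHom _ e) : G.CharGroup) = χ ∧
      ∀ i ∉ J, e i = 0 := by
  obtain ⟨m, rfl⟩ := QuotientAddGroup.mk_surjective χ
  obtain ⟨x, hx, hxJ⟩ := hJ m
  have hN : 0 < G.lattice.index := Nat.pos_of_ne_zero AddSubgroup.FiniteIndex.index_ne_zero
  set N := G.lattice.index
  set K : ℕ := ∑ i, (m i - x i).natAbs
  -- `m - x` has the same class as `m` and is supported on `J`. Adding `N * K` at each coordinate in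
  -- `J` makes it nonnegative, and stays in the class since `N` is the index.
  obtain ⟨e, he⟩ := exists_expHom_eq (v := m - x + N • (K • expHom _ (prodExponent J))) (by
    intro i
    have h1 : (m i - x i).natAbs ≤ K := Finset.single_le_sum
      (f := fun i => (m i - x i).natAbs) (fun _ _ => Nat.zero_le _) (Finset.mem_univ i)
    rw [Pi.add_apply, Pi.sub_apply, Pi.smul_apply, Pi.smul_apply, expHom_apply,
      prodExponent_apply, nsmul_eq_mul, nsmul_eq_mul]
    by_cases hi : i ∈ J
    · have h2 : (K : ℤ) ≤ N * K := le_mul_of_one_le_left (by positivity) (by exact_mod_cast hN)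
      rw [if_pos hi]
      push_cast
      rw [mul_one]
      omega
    · rw [if_neg hi, hxJ i hi]
      simp)
  refine ⟨e, ?_, fun i hi => ?_⟩
  · rw [he, QuotientAddGroup.eq]
    have h1 := G.lattice.sub_mem hx (G.lattice.nsmul_index_mem (K • expHom _ (prodExponent J)))
    convert h1 using 1
    abel
  · have h1 := congrFun he i
    rw [Pi.add_apply, Pi.sub_apply, Pi.smul_apply, Pi.smul_apply, expHom_apply, expHom_apply,
      prodExponent_apply, if_neg hi, hxJ i hi] at h1
    simpa using h1

/-- Provides one invariant monomial in the coordinates of `J` divisible by a chosen monomial of each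
weight: the multiple is divisible by the index and exceeds all degrees involved. -/
theorem Generates.exists_exponents {J : Finset (Fin n)} (hJ : G.Generates J) :
    ∃ N, 0 < N ∧ N • prodExponent J ∈ latticeMonoid G.lattice ∧
      ∃ e e' : G.CharGroup → Fin n →₀ ℕ,
        (∀ χ, (QuotientAddGroup.mk (expHom _ (e χ)) : G.CharGroup) = χ) ∧
        ∀ χ, e χ + e' χ = N • prodExponent J := by
  have := Fintype.ofFinite G.CharGroup
  choose e he heJ using hJ.exists_exponent
  have hN : 0 < G.lattice.index := Nat.pos_of_ne_zero AddSubgroup.FiniteIndex.index_ne_zero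
  refine ⟨G.lattice.index * (1 + ∑ χ, (e χ).degree), by positivity, ?_, e,
    fun χ => (G.lattice.index * (1 + ∑ χ, (e χ).degree)) • prodExponent J - e χ, he,
    fun χ => add_tsub_cancel_of_le fun i => ?_⟩
  · rw [mul_smul]
    exact nsmul_mem_latticeMonoid _
  · by_cases hi : i ∈ J
    · have h1 : (e χ).degree ≤ ∑ χ, (e χ).degree := Finset.single_le_sum
        (f := fun χ => (e χ).degree) (fun _ _ => Nat.zero_le _) (Finset.mem_univ χ)
      have h2 := Finsupp.le_degree i (e χ)
      have h3 := Nat.le_mul_of_pos_left (1 + ∑ χ, (e χ).degree) hN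
      rw [Finsupp.smul_apply, prodExponent_apply, if_pos hi, smul_eq_mul, mul_one]
      omega
    · rw [heJ χ i hi]
      exact Nat.zero_le _

variable (G) in
/-- The locus where the product of the coordinates in some generating set is invertible. -/
def freeLocus : (Spec (CommRingCat.of (PowerSeriesRing k n))).Opens :=
  ⨆ J : {J : Finset (Fin n) // G.Generates J},
    PrimeSpectrum.basicOpen (MvPowerSeries.monomial (prodExponent J.1) 1 : PowerSeriesRing k n)

theorem mem_freeLocus {P : PrimeSpectrum (PowerSeriesRing k n)} : P ∈ G.freeLocus ↔
    ∃ J, G.Generates J ∧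
      (MvPowerSeries.monomial (prodExponent J) 1 : PowerSeriesRing k n) ∉ P.asIdeal := by
  rw [freeLocus]
  erw [TopologicalSpace.Opens.mem_iSup]
  exact ⟨fun ⟨J, hJ⟩ => ⟨J.1, J.2, hJ⟩, fun ⟨J, hJ, h⟩ => ⟨⟨J, hJ⟩, h⟩⟩

theorem monomial_prodExponent (J : Finset (Fin n)) :
    (MvPowerSeries.monomial (prodExponent J) 1 : PowerSeriesRing k n) =
      ∏ i ∈ J, MvPowerSeries.X i := by
  classical
  induction J using Finset.induction_on with
  | empty => simp [prodExponent]
  | insert i J hi ih =>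
    rw [Finset.prod_insert hi, ← ih, prodExponent, Finset.sum_insert hi]
    exact monomial_eq_prod_X _ _

/-- This is where primitivity of the coordinates enters the proof of freeness: a suitable multiple
of `x` adjusts the `i`-th coordinate at will. -/
theorem generates_compl_singleton {i : Fin n} (h : ∃ x ∈ G.lattice, x i = 1) :
    G.Generates {i}ᶜ := by
  obtain ⟨x, hx, hx1⟩ := h
  intro m
  refine ⟨m i • x, G.lattice.zsmul_mem hx _, fun j hj => ?_⟩
  have : j = i := by simpa using hj
  subst this
  simp [hx1]

theorem two_le_height_of_X_mem {P : Ideal (PowerSeriesRing k n)} [P.IsPrime] {i j : Fin n}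
    (hij : i ≠ j) (hi : MvPowerSeries.X i ∈ P) (hj : MvPowerSeries.X j ∈ P) : 2 ≤ P.height := by
  classical
  have h1 : (Ideal.span {(MvPowerSeries.X i : PowerSeriesRing k n)}).IsPrime :=
    (Ideal.span_singleton_prime (prime_X i).ne_zero).2 (prime_X i)
  have h2 : (⊥ : Ideal (PowerSeriesRing k n)) < Ideal.span {MvPowerSeries.X i} := by
    rw [bot_lt_iff_ne_bot, Ne, Ideal.span_singleton_eq_bot]
    exact (prime_X i).ne_zero
  have h3 : Ideal.span {(MvPowerSeries.X i : PowerSeriesRing k n)} < P := by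
    refine lt_of_le_of_ne ((Ideal.span_singleton_le_iff_mem _).2 hi) ?_
    rintro rfl
    rw [Ideal.mem_span_singleton, MvPowerSeries.X_dvd_iff] at hj
    have := hj (Finsupp.single j 1) (by simp [hij.symm])
    simp [MvPowerSeries.coeff_X] at this
  have h4 := Ideal.height_add_one_le_of_lt_of_isPrime h2
  have h5 := Ideal.height_add_one_le_of_lt_of_isPrime h3
  calc (2 : ℕ∞) = 0 + 1 + 1 := by norm_num
    _ ≤ (⊥ : Ideal (PowerSeriesRing k n)).height + 1 + 1 := by gcongr; exact zero_le
    _ ≤ _ := (add_le_add_left h4 1).trans h5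

/-- The set of all coordinates generates, so `P` contains some `X i`. The complement of `i`
generates too, so `P` contains a second coordinate. -/
theorem two_le_height_of_notMem_freeLocus (h : ∀ i, ∃ x ∈ G.lattice, x i = 1)
    (P : PrimeSpectrum (PowerSeriesRing k n)) (hP : P ∉ G.freeLocus) : 2 ≤ P.asIdeal.height := by
  classical
  simp only [mem_freeLocus, not_exists, not_and, not_not] at hP
  have key (J : Finset (Fin n)) (hJ : G.Generates J) : ∃ i ∈ J, MvPowerSeries.X i ∈ P.asIdeal := by
    have := hP J hJ
    rwa [monomial_prodExponent, P.2.prod_mem_iff] at this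
  obtain ⟨i, -, hi⟩ := key Finset.univ fun m => ⟨0, zero_mem _, fun i hi => by simp at hi⟩
  obtain ⟨j, hj, hjP⟩ := key _ (generates_compl_singleton (h i))
  exact two_le_height_of_X_mem (by simpa [eq_comm] using hj) hi hjP

theorem preimage_freeLocus :
    Spec.map (CommRingCat.ofHom G.coaction.toRingHom) ⁻¹ᵁ G.freeLocus =
      Spec.map (CommRingCat.ofHom G.proj.toRingHom) ⁻¹ᵁ G.freeLocus := by
  ext Q
  change PrimeSpectrum.comap G.coaction.toRingHom Q ∈ G.freeLocus ↔
    PrimeSpectrum.comap G.proj.toRingHom Q ∈ G.freeLocus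
  rw [mem_freeLocus, mem_freeLocus]
  refine exists_congr fun J => and_congr_right fun _ => not_congr ?_
  change G.coaction _ ∈ PrimeSpectrum.asIdeal Q ↔ G.proj _ ∈ PrimeSpectrum.asIdeal Q
  rw [coaction_monomial]
  refine Ideal.mul_unit_mem_iff_mem _ ?_
  exact ((Group.isUnit _).map G.character).map MvPowerSeries.C

theorem monomial_smul_eq_pow (N : ℕ) (w : Fin n →₀ ℕ) :
    (MvPowerSeries.monomial (N • w) 1 : PowerSeriesRing k n) = MvPowerSeries.monomial w 1 ^ N := by
  rw [MvPowerSeries.monomial_pow, one_pow]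

theorem monomial_tmul_one_eq {w : Fin n →₀ ℕ} (hw : w ∈ latticeMonoid G.lattice) :
    (MvPowerSeries.monomial w 1 ⊗ₜ[G.invariants] 1 :
      PowerSeriesRing k n ⊗[G.invariants] PowerSeriesRing k n) =
      1 ⊗ₜ MvPowerSeries.monomial w 1 := by
  let wi : G.invariants := ⟨MvPowerSeries.monomial w 1, monomial_mem_invariants hw⟩
  have h1 : (MvPowerSeries.monomial w 1 : PowerSeriesRing k n) = wi • 1 := (mul_one _).symm
  rw [h1, TensorProduct.smul_tmul]

theorem monomial_nsmul_tmul_one (N : ℕ) (w : Fin n →₀ ℕ) :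
    (MvPowerSeries.monomial (N • w) 1 ⊗ₜ[G.invariants] 1 :
      PowerSeriesRing k n ⊗[G.invariants] PowerSeriesRing k n) =
      (MvPowerSeries.monomial w 1 ⊗ₜ 1) ^ N := by
  rw [Algebra.TensorProduct.tmul_pow, one_pow, monomial_smul_eq_pow]

theorem one_tmul_monomial_nsmul (N : ℕ) (w : Fin n →₀ ℕ) :
    (1 ⊗ₜ[G.invariants] MvPowerSeries.monomial (N • w) 1 :
      PowerSeriesRing k n ⊗[G.invariants] PowerSeriesRing k n) =
      (1 ⊗ₜ MvPowerSeries.monomial w 1) ^ N := by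
  rw [Algebra.TensorProduct.tmul_pow, one_pow, monomial_smul_eq_pow]

theorem isFreeInCodimOne_of_forall (h : ∀ i, ∃ x ∈ G.lattice, x i = 1) : G.IsFreeInCodimOne := by
  refine ⟨G.freeLocus, two_le_height_of_notMem_freeLocus h, preimage_freeLocus, ?_⟩
  have := Fintype.ofFinite G.CharGroup
  choose N hN hmem e e' he hee' using
    fun J : {J : Finset (Fin n) // G.Generates J} => J.2.exists_exponents
  let U : {J : Finset (Fin n) // G.Generates J} → G.fibreSquare.Opens := fun J =>
    PrimeSpectrum.basicOpen (MvPowerSeries.monomial (N J • prodExponent J.1) 1 ⊗ₜ[G.invariants] 1)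
  -- Suitable powers of the monomials are invariant, so they may be moved across the tensor product,
  -- and the conditions on the left and right factors coincide.
  have hU : G.openSquare G.freeLocus = ⨆ J, U J := by
    ext Q
    have h1 : Q ∈ G.openSquare G.freeLocus ↔
      PrimeSpectrum.comap (Algebra.TensorProduct.includeLeft : PowerSeriesRing k n →ₐ[G.invariants]
        PowerSeriesRing k n ⊗[G.invariants] PowerSeriesRing k n).toRingHom Q ∈ G.freeLocus ∧
      PrimeSpectrum.comap (Algebra.TensorProduct.includeRight : PowerSeriesRing k n →ₐ[G.invariants]
        PowerSeriesRing k n ⊗[G.invariants] PowerSeriesRing k n).toRingHom Q ∈ G.freeLocus := Iff.rfl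
    have h2 : Q ∈ ⨆ J, U J ↔ ∃ J : {J : Finset (Fin n) // G.Generates J},
        (MvPowerSeries.monomial (N J • prodExponent J.1) 1 ⊗ₜ[G.invariants] 1) ∉
          PrimeSpectrum.asIdeal Q := TopologicalSpace.Opens.mem_iSup
    have hQ : (PrimeSpectrum.asIdeal Q).IsPrime := PrimeSpectrum.isPrime Q
    have h3 (J : {J : Finset (Fin n) // G.Generates J}) :
        (MvPowerSeries.monomial (prodExponent J.1) 1 ⊗ₜ[G.invariants] 1) ∉
          PrimeSpectrum.asIdeal Q ↔
        (MvPowerSeries.monomial (N J • prodExponent J.1) 1 ⊗ₜ[G.invariants] 1) ∉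
          PrimeSpectrum.asIdeal Q := by
      rw [monomial_nsmul_tmul_one, hQ.pow_mem_iff_mem _ (hN J)]
    have h4 (J : {J : Finset (Fin n) // G.Generates J}) :
        (1 ⊗ₜ[G.invariants] MvPowerSeries.monomial (prodExponent J.1) 1) ∉
          PrimeSpectrum.asIdeal Q ↔
        (MvPowerSeries.monomial (N J • prodExponent J.1) 1 ⊗ₜ[G.invariants] 1) ∉
          PrimeSpectrum.asIdeal Q := by
      rw [monomial_tmul_one_eq (hmem J), one_tmul_monomial_nsmul, hQ.pow_mem_iff_mem _ (hN J)]
    refine (h1.trans ?_).trans h2.symm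
    rw [mem_freeLocus, mem_freeLocus]
    constructor
    · rintro ⟨⟨J, hJ, h⟩, -⟩
      exact ⟨⟨J, hJ⟩, (h3 ⟨J, hJ⟩).1 h⟩
    · rintro ⟨J, hJ⟩
      exact ⟨⟨J.1, J.2, (h3 J).2 hJ⟩, ⟨J.1, J.2, (h4 J).2 hJ⟩⟩
  rw [hU]
  refine isIso_morphismRestrict_iSup _ _ fun J => isIso_morphismRestrict_basicOpen _ _ ?_ ?_
  · intro a ha
    refine ⟨1, ?_⟩
    rw [pow_one]
    exact monomial_tmul_one_mul_eq_zero (he J) (hmem J) (hee' J) ha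
  · intro b
    obtain ⟨a, ha⟩ := exists_canonicalMap_eq (he J) (hee' J) b
    exact ⟨1, a, by rw [pow_one]; exact ha⟩

end FiniteTorusSubgroup

/-! ### Irredundant presentations of rational cones -/

section presentation

variable {r : ℕ}

theorem exists_facets (s : Finset (Fin r → ℤ)) :
    ∃ (M : AddSubgroup (Fin r → ℤ)) (I : Finset (Fin r → ℤ)),
      (∀ m, (∀ v ∈ s, 0 ≤ m ⬝ᵥ v) ↔ m ∈ M ∧ ∀ v ∈ I, 0 ≤ m ⬝ᵥ v) ∧
      (∃ p ∈ M, ∀ v ∈ I, 0 < p ⬝ᵥ v) ∧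
      ∀ v ∈ I, ∃ q ∈ M, q ⬝ᵥ v = 0 ∧ ∀ w ∈ I, w ≠ v → 0 < q ⬝ᵥ w := by
  classical
  let S : Set (Fin r → ℤ) := {m | ∀ v ∈ s, 0 ≤ m ⬝ᵥ v}
  -- Forms that vanish on all of `S` become the linear equations of `M`; only the others can define
  -- facets.
  let s₁ := s.filter fun v => ∃ m ∈ S, 0 < m ⬝ᵥ v
  let M : AddSubgroup (Fin r → ℤ) :=
    { carrier := {m | ∀ v ∈ s, v ∉ s₁ → m ⬝ᵥ v = 0}
      zero_mem' := by simp
      add_mem' := fun {a b} ha hb v hv hv' => by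
        rw [add_dotProduct, ha v hv hv', hb v hv hv', add_zero]
      neg_mem' := fun {a} ha v hv hv' => by rw [neg_dotProduct, ha v hv hv', neg_zero] }
  have hM (m) : m ∈ M ↔ ∀ v ∈ s, v ∉ s₁ → m ⬝ᵥ v = 0 := Iff.rfl
  have hSM {m} (hm : m ∈ S) : m ∈ M := fun v hv hv' => by
    by_contra h
    exact hv' (Finset.mem_filter.2 ⟨hv, m, hm, lt_of_le_of_ne (hm v hv) (Ne.symm h)⟩)
  obtain ⟨p, hpS, hp⟩ : ∃ p ∈ S, ∀ v ∈ s₁, 0 < p ⬝ᵥ v := by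
    have h1 (v : s₁) : ∃ m ∈ S, 0 < m ⬝ᵥ v.1 := (Finset.mem_filter.1 v.2).2
    choose m hm hmv using h1
    refine ⟨∑ v, m v, fun v hv => ?_, fun v hv => ?_⟩
    · rw [sum_dotProduct]
      exact Finset.sum_nonneg fun w _ => hm w v hv
    · rw [sum_dotProduct]
      exact Finset.sum_pos' (fun w _ => hm w v (Finset.mem_filter.1 hv).1)
        ⟨⟨v, hv⟩, Finset.mem_univ _, hmv ⟨v, hv⟩⟩
  let good : Finset (Fin r → ℤ) → Prop := fun I =>
    I ⊆ s₁ ∧ ∀ m ∈ M, (∀ v ∈ I, 0 ≤ m ⬝ᵥ v) → m ∈ S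
  have hgood : good s₁ := ⟨subset_rfl, fun m hm h v hv => by
    by_cases hv' : v ∈ s₁
    · exact h v hv'
    · exact (hm v hv hv').ge⟩
  obtain ⟨I, ⟨hI, hmin⟩⟩ : ∃ I, Minimal good I := by
    have hfin : {I | good I}.Finite := s₁.powerset.finite_toSet.subset fun I hI => by
      simpa using hI.1
    exact hfin.exists_minimal ⟨s₁, hgood⟩
  refine ⟨M, I, fun m => ⟨fun hm => ⟨hSM hm, fun v hv =>
    hm v (Finset.mem_filter.1 (hI.1 hv)).1⟩, fun ⟨hm, h⟩ => hI.2 m hm h⟩,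
    ⟨p, hSM hpS, fun v hv => hp v (hI.1 hv)⟩, fun v hv => ?_⟩
  have hnot : ¬ good (I.erase v) := fun h =>
    Finset.notMem_erase v I (hmin h (Finset.erase_subset v I) hv)
  simp only [good, not_and, not_forall] at hnot
  obtain ⟨m, hmM, hm, hmS⟩ := hnot ((Finset.erase_subset v I).trans hI.1)
  have hmv : m ⬝ᵥ v < 0 := by
    by_contra h
    refine hmS (hI.2 m hmM fun w hw => ?_)
    by_cases hwv : w = v
    · rw [hwv]
      exact not_lt.1 h
    · exact hm w (Finset.mem_erase.2 ⟨hwv, hw⟩)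
  have hpv := hp v (hI.1 hv)
  -- By minimality of `I`, some `m` in `M` violates only the inequality of `v`. This is a positive
  -- combination of `m` with the interior point `p`, chosen to vanish on `v`.
  refine ⟨(p ⬝ᵥ v) • m - (m ⬝ᵥ v) • p,
    M.sub_mem (M.zsmul_mem hmM _) (M.zsmul_mem (hSM hpS) _), ?_, fun w hw hwv => ?_⟩
  · rw [sub_dotProduct, smul_dotProduct, smul_dotProduct, smul_eq_mul, smul_eq_mul]
    ring
  · rw [sub_dotProduct, smul_dotProduct, smul_dotProduct, smul_eq_mul, smul_eq_mul]
    have h1 := mul_nonneg hpv.le (hm w (Finset.mem_erase.2 ⟨hwv, hw⟩))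
    have h2 := mul_neg_of_neg_of_pos hmv (hp w (hI.1 hw))
    linarith

/-- Makes a facet equation primitive by dividing out the generator of its image. -/
theorem exists_surjective_of_ne_zero {M : Type*} [AddCommGroup M] (f : M →+ ℤ) {p : M}
    (hp : f p ≠ 0) : ∃ g : M →+ ℤ, Function.Surjective g ∧ ∃ d : ℤ, 0 < d ∧ ∀ m, f m = d * g m := by
  obtain ⟨d, hd⟩ := Int.subgroup_cyclic f.range
  rw [← AddSubgroup.zmultiples_eq_closure] at hd
  wlog hd0 : 0 ≤ d generalizing d
  · exact this (-d) (by rw [hd, AddSubgroup.zmultiples_neg]) (by omega)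
  have hd' : d ≠ 0 := by
    rintro rfl
    have : f p ∈ f.range := ⟨p, rfl⟩
    rw [hd] at this
    simp at this
    exact hp this
  have hdvd (m) : d ∣ f m := by
    have : f m ∈ f.range := ⟨m, rfl⟩
    rw [hd] at this
    exact Int.mem_zmultiples_iff.1 this
  have hmul (m) : f m = d * (f m / d) := (Int.mul_ediv_cancel' (hdvd m)).symm
  refine ⟨{ toFun := fun m => f m / d
            map_zero' := by simp
            map_add' := fun a b => by rw [map_add, Int.add_ediv_of_dvd_left (hdvd a)] },
    fun z => ?_, d, lt_of_le_of_ne hd0 (Ne.symm hd'), hmul⟩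
  have : d * z ∈ f.range := by
    rw [hd]
    exact Int.mem_zmultiples_iff.2 (dvd_mul_right d z)
  obtain ⟨m, hm⟩ := this
  refine ⟨m, ?_⟩
  change f m / d = z
  rw [hm, Int.mul_ediv_cancel_left _ hd']

/-- The elements of a lattice in `ℤ^J × ℤ^I` whose coordinates in `I` are nonnegative. -/
def halfMonoid {J I : Type} (Λ : AddSubgroup (J ⊕ I → ℤ)) : AddSubmonoid (J ⊕ I → ℤ) where
  carrier := {x | x ∈ Λ ∧ ∀ i, 0 ≤ x (.inr i)}
  zero_mem' := ⟨zero_mem _, fun _ => le_rfl⟩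
  add_mem' ha hb := ⟨add_mem ha.1 hb.1, fun i => add_nonneg (ha.2 i) (hb.2 i)⟩

/-- The properties of a lattice in `ℤ^J × ℤ^I` that defines a presentation of a rational cone:
the coordinates in `J` are free and the coordinates in `I` are the primitive equations of the
facets. -/
structure IsFacetLattice {J I : Type} (Λ : AddSubgroup (J ⊕ I → ℤ)) : Prop where
  mem_of_forall : ∀ x : J ⊕ I → ℤ, (∀ i, x (.inr i) = 0) → x ∈ Λ
  exists_eq_one : ∀ i, ∃ x ∈ Λ, x i = 1
  exists_pos : ∀ i, ∃ x ∈ Λ, x i = 0 ∧ ∀ j ≠ i, 0 < x j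

/-- The joint map to `ℤ^I` has free image, so `M` splits as its kernel plus a complement. A basis of
the kernel supplies the free coordinates `J`. -/
theorem exists_isFacetLattice {M : Type*} [AddCommGroup M] [Module.Free ℤ M] [Module.Finite ℤ M]
    {I : Type} [Finite I] (g : I → M →+ ℤ) (hg : ∀ i, Function.Surjective (g i))
    (hp : ∃ p, ∀ i, 0 < g i p) (hq : ∀ i, ∃ q, g i q = 0 ∧ ∀ j ≠ i, 0 < g j q) :
    ∃ (J : Type) (_ : Finite J) (Λ : AddSubgroup (J ⊕ I → ℤ)) (φ : M ≃+ Λ),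
      IsFacetLattice Λ ∧ ∀ m i, (φ m).1 (.inr i) = g i m := by
  classical
  have := Fintype.ofFinite I
  let G : M →ₗ[ℤ] (I → ℤ) := (AddMonoidHom.pi g : M →+ (I → ℤ)).toIntLinearMap
  have hG (m i) : G m i = g i m := rfl
  obtain ⟨σ, hσ⟩ := Module.projective_lifting_property G.rangeRestrict LinearMap.id
    G.surjective_rangeRestrict
  have hσ' (y : LinearMap.range G) : G (σ y) = y.1 := congrArg Subtype.val (LinearMap.congr_fun hσ y)
  let U := LinearMap.ker G
  let ρ : M →ₗ[ℤ] U := LinearMap.codRestrict U (LinearMap.id - σ ∘ₗ G.rangeRestrict) fun m => by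
    rw [LinearMap.mem_ker, LinearMap.sub_apply, map_sub, LinearMap.comp_apply, hσ', sub_eq_zero]
    rfl
  have hρ (m) : (ρ m : M) = m - σ (G.rangeRestrict m) := rfl
  let J := Fin (Module.finrank ℤ U)
  let b : Module.Basis J ℤ U := Module.finBasis ℤ U
  let Φ : M →+ (J ⊕ I → ℤ) :=
    { toFun := fun m => Sum.elim (b.equivFun (ρ m)) (fun i => g i m)
      map_zero' := by
        ext i
        cases i <;> simp
      map_add' := fun x y => by
        ext i
        cases i <;> simp }
  have hΦl (m j) : Φ m (.inl j) = b.equivFun (ρ m) j := rfl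
  have hΦr (m i) : Φ m (.inr i) = g i m := rfl
  have hΦinj : Function.Injective Φ := by
    rw [injective_iff_map_eq_zero]
    intro m hm
    have h1 : G m = 0 := by
      ext i
      rw [hG, ← hΦr, hm]
      rfl
    have h2 : ρ m = 0 := by
      apply b.equivFun.injective
      ext j
      rw [← hΦl, hm]
      simp
    have h3 := hρ m
    have h4 : G.rangeRestrict m = 0 := Subtype.ext h1
    rw [h2, h4, map_zero, sub_zero] at h3
    exact h3.symm
  have hmem (x : J ⊕ I → ℤ) (hx : ∀ i, x (.inr i) = 0) : x ∈ Φ.range := by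
    let u : U := b.equivFun.symm fun j => x (.inl j)
    have hu : G u.1 = 0 := LinearMap.mem_ker.1 u.2
    refine ⟨u.1, ?_⟩
    have h1 : ρ u.1 = u := by
      ext1
      have : G.rangeRestrict u.1 = 0 := Subtype.ext hu
      rw [hρ, this, map_zero, sub_zero]
    ext i
    cases i with
    | inl j => rw [hΦl, h1]; exact congrFun (b.equivFun.apply_symm_apply _) j
    | inr i => rw [hΦr, hx, ← hG, hu]; rfl
  -- The coordinates in `J` can be changed arbitrarily within the lattice, so the positivity
  -- conditions only concern `I`.
  have hadj (m : M) (f : J → ℤ) : Sum.elim f (fun i => g i m) ∈ Φ.range := by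
    have h1 := hmem (Sum.elim f (fun i => g i m) - Φ m) fun i => by simp [hΦr]
    have h2 := Φ.range.add_mem h1 ⟨m, rfl⟩
    rwa [sub_add_cancel] at h2
  refine ⟨J, inferInstance, Φ.range, AddMonoidHom.ofInjective hΦinj, ⟨hmem, ?_, ?_⟩, fun m i => rfl⟩
  · rintro (j | i)
    · exact ⟨Pi.single (.inl j) 1, hmem _ fun i => by simp, by simp⟩
    · obtain ⟨m, hm⟩ := hg i 1
      exact ⟨Φ m, ⟨m, rfl⟩, hm⟩
  · rintro (j | i)
    · obtain ⟨p, hp⟩ := hp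
      refine ⟨_, hadj p fun j' => if j' = j then 0 else 1, by simp, ?_⟩
      rintro (j' | i) h
      · have : j' ≠ j := fun h' => h (by rw [h'])
        simp [this]
      · exact hp i
    · obtain ⟨q, hq0, hq⟩ := hq i
      refine ⟨_, hadj q fun _ => 1, hq0, ?_⟩
      rintro (j' | i') h
      · exact one_pos
      · exact hq i' fun h' => h (by rw [h'])

theorem exists_equiv_halfMonoid (s : Finset (Fin r → ℤ)) (S : AddSubmonoid (Fin r → ℤ))
    (hS : ∀ m, m ∈ S ↔ ∀ v ∈ s, 0 ≤ m ⬝ᵥ v) :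
    ∃ (J I : Type) (_ : Finite J) (_ : Finite I) (Λ : AddSubgroup (J ⊕ I → ℤ)),
      IsFacetLattice Λ ∧ Nonempty (S ≃+ halfMonoid Λ) := by
  obtain ⟨M, I, hSM, ⟨p, hpM, hp⟩, hq⟩ := exists_facets s
  let f : I → M →+ ℤ := fun v =>
    { toFun := fun m => m.1 ⬝ᵥ v.1
      map_zero' := by simp
      map_add' := fun a b => add_dotProduct _ _ _ }
  have hf (v : I) : ∃ g : M →+ ℤ, Function.Surjective g ∧ ∃ d : ℤ, 0 < d ∧ ∀ m, f v m = d * g m :=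
    exists_surjective_of_ne_zero (f v) (p := ⟨p, hpM⟩) (hp v.1 v.2).ne'
  choose g hg d hd hfg using hf
  have hpos (v : I) (m : M) : 0 < g v m ↔ 0 < m.1 ⬝ᵥ v.1 := by
    change _ ↔ 0 < f v m
    rw [hfg, mul_pos_iff_of_pos_left (hd v)]
  have hnonneg (v : I) (m : M) : 0 ≤ g v m ↔ 0 ≤ m.1 ⬝ᵥ v.1 := by
    change _ ↔ 0 ≤ f v m
    rw [hfg, mul_nonneg_iff_of_pos_left (hd v)]
  have hzero (v : I) (m : M) : g v m = 0 ↔ m.1 ⬝ᵥ v.1 = 0 := by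
    change _ ↔ f v m = 0
    rw [hfg, mul_eq_zero, or_iff_right (hd v).ne']
  have : Module.Free ℤ M := inferInstanceAs (Module.Free ℤ (AddSubgroup.toIntSubmodule M))
  have : Module.Finite ℤ M := inferInstanceAs (Module.Finite ℤ (AddSubgroup.toIntSubmodule M))
  obtain ⟨J, hJ, Λ, φ, hΛ, hφ⟩ := exists_isFacetLattice g hg
    ⟨⟨p, hpM⟩, fun v => (hpos v _).2 (hp v.1 v.2)⟩ fun v => by
      obtain ⟨q, hqM, hq0, hqpos⟩ := hq v.1 v.2
      exact ⟨⟨q, hqM⟩, (hzero v _).2 hq0, fun w hw =>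
        (hpos w _).2 (hqpos w.1 w.2 fun h => hw (Subtype.ext h))⟩
  have hSM' (m : S) : m.1 ∈ M ∧ ∀ v ∈ I, 0 ≤ m.1 ⬝ᵥ v := (hSM m.1).1 ((hS _).1 m.2)
  let θ : S →+ halfMonoid Λ :=
    { toFun := fun m => ⟨(φ ⟨m.1, (hSM' m).1⟩).1, (φ _).2, fun v => by
        rw [hφ, hnonneg]
        exact (hSM' m).2 v.1 v.2⟩
      map_zero' := by
        have h := congrArg Subtype.val (map_zero φ)
        exact Subtype.ext h
      map_add' := fun a b => by
        have h := congrArg Subtype.val (map_add φ ⟨a.1, (hSM' a).1⟩ ⟨b.1, (hSM' b).1⟩)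
        exact Subtype.ext h }
  refine ⟨J, I, hJ, inferInstance, Λ, hΛ, ⟨AddEquiv.ofBijective θ ⟨?_, ?_⟩⟩⟩
  · intro a b hab
    have h1 := congrArg Subtype.val hab
    have h2 := φ.injective (Subtype.ext h1)
    have h3 := congrArg Subtype.val h2
    exact Subtype.ext h3
  · rintro ⟨x, hx, hx0⟩
    obtain ⟨m, hm⟩ := φ.surjective ⟨x, hx⟩
    have hmS : m.1 ∈ S := by
      rw [hS, hSM]
      refine ⟨m.2, fun v hv => (hnonneg ⟨v, hv⟩ m).1 ?_⟩
      rw [← hφ, hm]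
      exact hx0 _
    refine ⟨⟨m.1, hmS⟩, Subtype.ext ?_⟩
    have h := congrArg Subtype.val hm
    exact h

end presentation

/-! ### Closed points of toric varieties -/

section closedPoint

/-- Take a minimal cone whose chart contains the point. If the monomial of `m` is nonzero there, the
point lies in the chart of the face `σ ∩ m^⊥`; by minimality this face is `σ`, so `-m` is
nonnegative on `σ` too. -/
theorem ToricVariety.exists_minimal_chart {k : Type u} [Field k] {r : ℕ} {Δ : Fan r}
    {X : Scheme.{u}} {p : X ⟶ Spec (CommRingCat.of k)} (V : ToricVariety Δ X p) {x : X}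
    (hx : IsClosed ({x} : Set X)) :
    ∃ (σ : PointedCone ℝ (Fin r → ℝ)) (hσ : σ ∈ Δ.cones) (y : PrimeSpectrum (ChartRing k σ)),
      V.ι σ hσ y = x ∧ y.asIdeal.IsMaximal ∧
      ∀ m : dualMonoid σ, AddMonoidAlgebra.single m 1 ∉ y.asIdeal → -m.1 ∈ dualMonoid σ := by
  obtain ⟨σ, hmin⟩ : ∃ σ, Minimal (fun σ => ∃ hσ : σ ∈ Δ.cones, x ∈ Set.range (V.ι σ hσ)) σ := by
    have hfin : {σ | ∃ hσ : σ ∈ Δ.cones, x ∈ Set.range (V.ι σ hσ)}.Finite :=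
      Δ.finite.subset fun σ h => h.1
    obtain ⟨σ, hσ, h⟩ := V.covers x
    exact hfin.exists_minimal ⟨σ, hσ, h⟩
  obtain ⟨⟨hσ, y, hy⟩, hmin⟩ := hmin
  have := V.isOpenImmersion σ hσ
  have hinj : Function.Injective (V.ι σ hσ) := (V.ι σ hσ).isOpenEmbedding.injective
  refine ⟨σ, hσ, y, hy, ?_, fun m hm => ?_⟩
  · refine (PrimeSpectrum.isClosed_singleton_iff_isMaximal y).1 ?_
    have h1 := hx.preimage (V.ι σ hσ).continuous
    have h2 : (V.ι σ hσ) ⁻¹' {x} = {y} := by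
      ext z
      exact ⟨fun h => hinj (h.trans hy.symm), fun h => (congrArg _ h).trans hy⟩
    rw [h2] at h1
    exact h1
  · let τ : PointedCone ℝ (Fin r → ℝ) := σ ⊓
      ((LinearMap.ker (pairing m.1)).restrictScalars _ : PointedCone ℝ (Fin r → ℝ))
    have hτ (v) : v ∈ τ ↔ v ∈ σ ∧ pairing m.1 v = 0 := Iff.rfl
    have hface := isFaceOf_of_forall_mem_iff m.2 hτ
    have hτΔ := Δ.face_mem σ hσ τ hface
    have hyτ : y ∈ Set.range (chartMap k hface.le) := by
      obtain ⟨s, hs⟩ := Δ.rational σ hσ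
      change σ = PointedCone.hull ℝ (realVec '' (s : Set (Fin r → ℤ))) at hs
      clear_value τ
      subst hs
      exact (range_chartMap k s.finite_toSet hface.le m hτ y).2 hm
    obtain ⟨z, hz⟩ := hyτ
    have hxτ : x ∈ Set.range (V.ι τ hτΔ) := ⟨z, by
      rw [← V.chartMap_comp τ hτΔ σ hσ hface.le, ← hy, ← hz]
      rfl⟩
    have hle : σ ≤ τ := hmin ⟨hτΔ, hxτ⟩ hface.le
    rw [mem_dualMonoid]
    intro v hv
    rw [pairing_neg, ((hτ v).1 (hle hv)).2, neg_zero]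

/-- Writing each free coordinate as a difference of two natural numbers presents the monoid as the
image of a subtractive submonoid of some `ℕ^r`. -/
theorem halfMonoid_fg {J I : Type} [Finite J] [Finite I] (Λ : AddSubgroup (J ⊕ I → ℤ)) :
    (halfMonoid Λ).FG := by
  let φ : ((J ⊕ J) ⊕ I →₀ ℕ) →+ (J ⊕ I → ℤ) :=
    { toFun := fun f => Sum.elim (fun j => (f (.inl (.inl j)) : ℤ) - f (.inl (.inr j)))
        (fun i => f (.inr i))
      map_zero' := by
        ext i
        cases i <;> simp
      map_add' := fun a b => by
        ext i
        cases i
        · simp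
          ring
        · simp }
  have hφl (f j) : φ f (.inl j) = (f (.inl (.inl j)) : ℤ) - f (.inl (.inr j)) := rfl
  have hφr (f i) : φ f (.inr i) = f (.inr i) := rfl
  have hfg : (Λ.toAddSubmonoid.comap φ).FG := AddSubmonoid.fg_of_subtractive fun x hx y hxy => by
    have h1 : φ x ∈ Λ := hx
    have h2 : φ (x + y) ∈ Λ := hxy
    rw [map_add] at h2
    exact (Λ.add_mem_cancel_left h1).1 h2
  have hmap : (Λ.toAddSubmonoid.comap φ).map φ = halfMonoid Λ := by
    ext v
    constructor
    · rintro ⟨f, hf, rfl⟩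
      exact ⟨hf, fun i => by rw [hφr]; positivity⟩
    · rintro ⟨hv, hv0⟩
      let f : (J ⊕ J) ⊕ I →₀ ℕ := Finsupp.equivFunOnFinite.symm (Sum.elim
        (Sum.elim (fun j => (v (.inl j)).toNat) (fun j => (-v (.inl j)).toNat))
        (fun i => (v (.inr i)).toNat))
      have hf : φ f = v := by
        ext i
        cases i with
        | inl j => simp [hφl, f]
        | inr i => simp [hφr, f, hv0 i]
      exact ⟨f, by change φ f ∈ Λ; rwa [hf], hf⟩
  rw [← hmap]
  exact hfg.map φ

theorem exists_algHom_of_isMaximal {k : Type u} [Field k] [IsAlgClosed k] {A : Type*} [CommRing A]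
    [Algebra k A] [Algebra.FiniteType k A] (P : Ideal A) (hP : P.IsMaximal) :
    ∃ x : A →ₐ[k] k, ∀ a, a ∈ P ↔ x a = 0 := by
  let := Ideal.Quotient.field P
  have : Module.Finite k (A ⧸ P) := finite_of_finite_type_of_isJacobsonRing k (A ⧸ P)
  have hbij := IsAlgClosed.algebraMap_bijective_of_isIntegral (k := k) (K := A ⧸ P)
  let E : k ≃ₐ[k] A ⧸ P := AlgEquiv.ofBijective (Algebra.ofId k (A ⧸ P)) hbij
  refine ⟨E.symm.toAlgHom.comp (Ideal.Quotient.mkₐ k P), fun a => ?_⟩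
  rw [← Ideal.Quotient.eq_zero_iff_mem]
  exact (map_eq_zero_iff E.symm E.symm.injective).symm

end closedPoint

/-! ### Local rings of affine toric varieties at closed points of the closed orbit -/

section translation

/-- A map `β` that need not be an isomorphism may still be one on local rings. The universal
properties extend `α` and `g ∘ β` to maps between `T` and `C`, and the hypotheses make these inverse
to each other. -/
theorem isLocalization_atPrime_of_comp_eq {A B C T : Type*} [CommRing A] [CommRing B] [CommRing C]
    [CommRing T] {P : Ideal A} [P.IsPrime] {Q : Ideal B} [Q.IsPrime]
    [Algebra B C] [IsLocalization.AtPrime C Q]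
    (g : A →+* T) (hg : @IsLocalization.AtPrime A _ T _ g.toAlgebra P _)
    (α : A →+* C) (β : B →+* A) (hα : ∀ a ∉ P, IsUnit (α a)) (hβ : ∀ b ∉ Q, β b ∉ P)
    (hαβ : α.comp β = algebraMap B C)
    (hβα : ∀ β' : C →+* T, β'.comp (algebraMap B C) = g.comp β → β'.comp α = g) :
    @IsLocalization.AtPrime B _ T _ (g.comp β).toAlgebra Q _ := by
  let iA : Algebra A T := g.toAlgebra
  have hgT : algebraMap A T = g := rfl
  let β' : C →+* T := IsLocalization.lift (M := Q.primeCompl) (g := g.comp β) fun b =>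
    IsLocalization.map_units (M := P.primeCompl) T ⟨β b, hβ b b.2⟩
  have hβ' : β'.comp (algebraMap B C) = g.comp β := IsLocalization.lift_comp _
  let α' : T →+* C := IsLocalization.lift (M := P.primeCompl) (g := α) fun a => hα a a.2
  have hα' : α'.comp g = α := IsLocalization.lift_comp (M := P.primeCompl) _
  have h1 : α'.comp β' = RingHom.id C := by
    refine IsLocalization.ringHom_ext Q.primeCompl ?_
    rw [RingHom.comp_assoc, hβ', ← RingHom.comp_assoc, hα', hαβ, RingHom.id_comp]
  have h2 : β'.comp α' = RingHom.id T := by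
    refine IsLocalization.ringHom_ext P.primeCompl ?_
    rw [hgT, RingHom.comp_assoc, hα', hβα β' hβ', RingHom.id_comp]
  let iB : Algebra B T := (g.comp β).toAlgebra
  let E : C ≃ₐ[B] T := AlgEquiv.ofRingEquiv (f := RingEquiv.ofRingHom β' α' h2 h1) fun b =>
    RingHom.congr_fun hβ' b
  exact IsLocalization.isLocalization_of_algEquiv Q.primeCompl E

variable {k : Type u} [Field k] {J I : Type} {Λ : AddSubgroup (J ⊕ I → ℤ)}

/-- The vector with vanishing coordinates in `J`. -/
def projRight (J I : Type) : (J ⊕ I → ℤ) →+ (J ⊕ I → ℤ) where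
  toFun x := Sum.elim 0 fun i => x (.inr i)
  map_zero' := by ext i; cases i <;> rfl
  map_add' a b := by ext i; cases i <;> simp

@[simp] theorem projRight_inl (x : J ⊕ I → ℤ) (j : J) : projRight J I x (.inl j) = 0 := rfl

@[simp] theorem projRight_inr (x : J ⊕ I → ℤ) (i : I) : projRight J I x (.inr i) = x (.inr i) := rfl

theorem IsFacetLattice.projRight_mem (h : IsFacetLattice Λ) {x : J ⊕ I → ℤ} (hx : x ∈ Λ) :
    projRight J I x ∈ Λ := by
  have := Λ.add_mem (h.mem_of_forall (projRight J I x - x) fun i => by simp) hx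
  rwa [sub_add_cancel] at this

/-- The projection of the monoid `halfMonoid Λ` to its coordinates in `I`. -/
def IsFacetLattice.toLattice [Finite J] [Finite I] (h : IsFacetLattice Λ) :
    halfMonoid Λ →+ latticeMonoid Λ where
  toFun x := ⟨Finsupp.equivFunOnFinite.symm fun i => (projRight J I x.1 i).toNat, by
    have : expHom _ (Finsupp.equivFunOnFinite.symm fun i => (projRight J I x.1 i).toNat) =
        projRight J I x.1 := by
      ext i
      cases i with
      | inl j => simp
      | inr i => simpa using x.2.2 i
    rw [mem_latticeMonoid, this]
    exact h.projRight_mem x.2.1⟩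
  map_zero' := by
    ext i
    simp
  map_add' a b := by
    ext i
    cases i with
    | inl j => simp
    | inr i =>
      have h1 := a.2.2 i
      have h2 := b.2.2 i
      simp [Int.toNat_add h1 h2]

theorem IsFacetLattice.expHom_toLattice [Finite J] [Finite I] (h : IsFacetLattice Λ)
    (x : halfMonoid Λ) : expHom _ (h.toLattice x).1 = projRight J I x.1 := by
  ext i
  cases i with
  | inl j => simp [toLattice]
  | inr i => simpa [toLattice] using x.2.2 i

/-- The projection of the monoid `latticeMonoid Λ` to its coordinates in `I`. -/
def IsFacetLattice.ofLattice (h : IsFacetLattice Λ) : latticeMonoid Λ →+ halfMonoid Λ where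
  toFun p := ⟨projRight J I (expHom _ p.1), h.projRight_mem p.2, fun i => by simp⟩
  map_zero' := Subtype.ext (by simp)
  map_add' a b := Subtype.ext (by simp)

/-- The inclusion of the lattice `ℤ^J` of units. -/
def IsFacetLattice.ofUnits (h : IsFacetLattice Λ) : (J → ℤ) →+ halfMonoid Λ where
  toFun y := ⟨Sum.elim y 0, h.mem_of_forall _ fun i => by simp, fun i => by simp⟩
  map_zero' := Subtype.ext (by ext i; cases i <;> simp)
  map_add' a b := Subtype.ext (by ext i; cases i <;> simp)

/-- The `j`-th coordinate function, which is a unit of the monoid algebra of `halfMonoid Λ`. -/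
def IsFacetLattice.unitCoord (k : Type u) [Field k] [DecidableEq J] (h : IsFacetLattice Λ) (j : J) :
    (AddMonoidAlgebra k (halfMonoid Λ))ˣ where
  val := AddMonoidAlgebra.single (h.ofUnits (Pi.single j 1)) 1
  inv := AddMonoidAlgebra.single (h.ofUnits (-Pi.single j 1)) 1
  val_inv := by
    rw [AddMonoidAlgebra.single_mul_single, ← map_add, add_neg_cancel, map_zero, one_mul]; rfl
  inv_val := by
    rw [AddMonoidAlgebra.single_mul_single, ← map_add, neg_add_cancel, map_zero, one_mul]; rfl

theorem IsFacetLattice.prod_unitCoord [Fintype J] [DecidableEq J] (h : IsFacetLattice Λ)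
    (y : J → ℤ) : ((∏ j, h.unitCoord k j ^ y j : (AddMonoidAlgebra k (halfMonoid Λ))ˣ) :
      AddMonoidAlgebra k (halfMonoid Λ)) = AddMonoidAlgebra.single (h.ofUnits y) 1 := by
  let φ : Multiplicative (J → ℤ) →* (AddMonoidAlgebra k (halfMonoid Λ))ˣ :=
    MonoidHom.toHomUnits ((AddMonoidAlgebra.of k (halfMonoid Λ)).comp
      (AddMonoidHom.toMultiplicative h.ofUnits))
  have hφ (y : J → ℤ) : (φ (.ofAdd y)).1 = AddMonoidAlgebra.single (h.ofUnits y) 1 := rfl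
  have h1 (j) : h.unitCoord k j = φ (.ofAdd (Pi.single j 1)) := Units.ext rfl
  rw [← hφ]
  congr 1
  have h2 : Multiplicative.ofAdd y = ∏ j, Multiplicative.ofAdd (Pi.single j (1 : ℤ)) ^ y j := by
    apply Multiplicative.toAdd.injective
    rw [toAdd_prod]
    ext i
    simp [Finset.sum_apply, Pi.single_apply]
  rw [h2, map_prod]
  exact Finset.prod_congr rfl fun j _ => by rw [h1, map_zpow]

theorem IsFacetLattice.single_mem (h : IsFacetLattice Λ) (j : J) :
    Finsupp.single (.inl j) 1 ∈ latticeMonoid Λ :=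
  h.mem_of_forall _ fun i => by simp

theorem IsFacetLattice.prod_single [Fintype J] [Finite I] (h : IsFacetLattice Λ)
    (p : latticeMonoid Λ) :
    (∏ j, (AddMonoidAlgebra.single ⟨_, h.single_mem j⟩ 1 :
      AddMonoidAlgebra k (latticeMonoid Λ)) ^ p.1 (.inl j)) *
        AddMonoidAlgebra.single (h.toLattice (h.ofLattice p)) 1 = AddMonoidAlgebra.single p 1 := by
  classical
  have h1 : ∏ j, (AddMonoidAlgebra.single ⟨_, h.single_mem j⟩ 1 :
      AddMonoidAlgebra k (latticeMonoid Λ)) ^ p.1 (.inl j) =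
      AddMonoidAlgebra.single (∑ j, p.1 (.inl j) • ⟨_, h.single_mem j⟩) 1 := by
    have := map_prod (AddMonoidAlgebra.of k (latticeMonoid Λ))
      (fun j => .ofAdd (p.1 (.inl j) • (⟨_, h.single_mem j⟩ : latticeMonoid Λ))) Finset.univ
    rw [← ofAdd_sum] at this
    refine Eq.trans (Finset.prod_congr rfl fun j _ => ?_) this.symm
    rw [AddMonoidAlgebra.single_pow, one_pow]
    rfl
  rw [h1, AddMonoidAlgebra.single_mul_single, one_mul]
  congr 1
  apply Subtype.ext
  apply expHom_injective
  have h2 := h.expHom_toLattice (h.ofLattice p)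
  have h3 : (h.ofLattice p).1 = projRight J I (expHom _ p.1) := rfl
  rw [AddSubmonoid.coe_add, map_add, h2, h3, AddSubmonoid.coe_finsetSum, map_sum]
  ext i
  cases i with
  | inl j => simp [Finsupp.single_apply]
  | inr i => simp

theorem IsFacetLattice.prod_unitCoord_mul [Fintype J] [Finite I] [DecidableEq J]
    (h : IsFacetLattice Λ) (m : halfMonoid Λ) :
    ((∏ j, h.unitCoord k j ^ m.1 (.inl j) : (AddMonoidAlgebra k (halfMonoid Λ))ˣ) :
      AddMonoidAlgebra k (halfMonoid Λ)) *
        AddMonoidAlgebra.single (h.ofLattice (h.toLattice m)) 1 = AddMonoidAlgebra.single m 1 := by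
  rw [h.prod_unitCoord fun j => m.1 (.inl j), AddMonoidAlgebra.single_mul_single, one_mul]
  congr 1
  apply Subtype.ext
  have h3 : (h.ofLattice (h.toLattice m)).1 = projRight J I (expHom _ (h.toLattice m).1) := rfl
  have h4 : (h.ofUnits fun j => m.1 (.inl j)).1 = Sum.elim (fun j => m.1 (.inl j)) 0 := rfl
  rw [AddSubmonoid.coe_add, h3, h4, h.expHom_toLattice]
  ext i
  cases i <;> simp

/-- The algebra is generated by the unit coordinates, their inverses and the monomials in the
coordinates of `I`; values on inverses are forced. -/
theorem IsFacetLattice.ringHom_ext [Fintype J] [Finite I] [DecidableEq J] (h : IsFacetLattice Λ)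
    {D : Type*} [CommRing D]
    (β : AddMonoidAlgebra k (latticeMonoid Λ) →ₐ[k] AddMonoidAlgebra k (halfMonoid Λ))
    (hβt : ∀ j, ∃ b, β b = h.unitCoord k j)
    (hβ : ∀ m, ∃ b, β b = AddMonoidAlgebra.single (h.ofLattice (h.toLattice m)) 1)
    {φ ψ : AddMonoidAlgebra k (halfMonoid Λ) →+* D} (hφψ : ∀ b, φ (β b) = ψ (β b)) : φ = ψ := by
  refine AddMonoidAlgebra.ringHom_ext (fun c => ?_) fun m => ?_
  · have := hφψ (algebraMap k _ c)
    rw [β.commutes] at this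
    exact this
  · have h1 (j) : Units.map φ.toMonoidHom (h.unitCoord k j) =
        Units.map ψ.toMonoidHom (h.unitCoord k j) := by
      obtain ⟨b, hb⟩ := hβt j
      ext1
      change φ (h.unitCoord k j) = ψ (h.unitCoord k j)
      rw [← hb, hφψ]
    have h2 : φ (∏ j, h.unitCoord k j ^ m.1 (.inl j) : (AddMonoidAlgebra k (halfMonoid Λ))ˣ) =
        ψ (∏ j, h.unitCoord k j ^ m.1 (.inl j) : (AddMonoidAlgebra k (halfMonoid Λ))ˣ) := by
      have : Units.map φ.toMonoidHom (∏ j, h.unitCoord k j ^ m.1 (.inl j)) =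
          Units.map ψ.toMonoidHom (∏ j, h.unitCoord k j ^ m.1 (.inl j)) := by
        rw [map_prod, map_prod]
        exact Finset.prod_congr rfl fun j _ => by rw [map_zpow, map_zpow, h1]
      exact congrArg Units.val this
    obtain ⟨b, hb⟩ := hβ m
    rw [← h.prod_unitCoord_mul, map_mul, map_mul, h2, ← hb, hφψ]

/-- The point `x` is a point of the torus `𝔾_m^J` at which the nonunit monomials vanish. Translating
its unit coordinates to the origin identifies its local ring with that of the origin of the monoid
algebra with exponents in `ℕ^J × ℕ^I`. -/
theorem IsFacetLattice.isLocalization_atPrime [Finite J] [Finite I] (h : IsFacetLattice Λ)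
    (x : AddMonoidAlgebra k (halfMonoid Λ) →ₐ[k] k) {P : Ideal (AddMonoidAlgebra k (halfMonoid Λ))}
    [P.IsPrime] (hP : ∀ a, a ∈ P ↔ x a = 0)
    (hx : ∀ m : halfMonoid Λ, x (AddMonoidAlgebra.single m 1) ≠ 0 → ∀ i, m.1 (.inr i) = 0)
    {T : Type*} [CommRing T] (g : AddMonoidAlgebra k (halfMonoid Λ) →+* T)
    (hg : @IsLocalization.AtPrime _ _ T _ g.toAlgebra P _) :
    ∃ β : AddMonoidAlgebra k (latticeMonoid Λ) →ₐ[k] AddMonoidAlgebra k (halfMonoid Λ),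
      @IsLocalization.AtPrime _ _ T _ (g.comp β.toRingHom).toAlgebra
        (polyOriginIdeal k (latticeMonoid Λ)) _ := by
  classical
  have := Fintype.ofFinite J
  let A := AddMonoidAlgebra k (halfMonoid Λ)
  let B := AddMonoidAlgebra k (latticeMonoid Λ)
  let t (j : J) : Aˣ := h.unitCoord k j
  have htx (j) : x (t j) ≠ 0 := ((t j).isUnit.map x).ne_zero
  -- The variable indexed by `j` goes to `t j / x (t j) - 1`, which vanishes at `x`. The inverse `α`
  -- below sends `t j` to `x (t j) * (1 + X j)`, a unit only after localizing.
  let β : B →ₐ[k] A := AddMonoidAlgebra.lift k A (latticeMonoid Λ)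
    { toFun := fun p => (∏ j, (algebraMap k A (x (t j))⁻¹ * t j - 1) ^ p.toAdd.1 (.inl j)) *
        AddMonoidAlgebra.single (h.ofLattice p.toAdd) 1
      map_one' := by
        rw [toAdd_one, map_zero, ← AddMonoidAlgebra.one_def]
        simp
      map_mul' := fun p q => by
        have h1 : AddMonoidAlgebra.single (h.ofLattice (p.toAdd + q.toAdd)) (1 : k) =
            AddMonoidAlgebra.single (h.ofLattice p.toAdd) 1 *
              AddMonoidAlgebra.single (h.ofLattice q.toAdd) 1 := by
          rw [AddMonoidAlgebra.single_mul_single, one_mul, map_add]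
        rw [toAdd_mul, h1, mul_mul_mul_comm, ← Finset.prod_mul_distrib]
        congr 1
        exact Finset.prod_congr rfl fun j _ => pow_add _ _ _ }
  have hβ (p : latticeMonoid Λ) : β (AddMonoidAlgebra.single p 1) =
      (∏ j, (algebraMap k A (x (t j))⁻¹ * t j - 1) ^ p.1 (.inl j)) *
        AddMonoidAlgebra.single (h.ofLattice p) 1 := by
    rw [AddMonoidAlgebra.lift_single, one_smul]
    rfl
  have hxβ (b : B) : x (β b) = b.coeff 0 := by
    have h1 (p : latticeMonoid Λ) : x (β (AddMonoidAlgebra.single p 1)) =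
        if p = 0 then 1 else 0 := by
      have h2 (j) : x (algebraMap k A (x (t j))⁻¹ * t j - 1) = 0 := by
        rw [map_sub, map_mul, map_one, x.commutes, Algebra.algebraMap_self_apply,
          inv_mul_cancel₀ (htx j), sub_self]
      rw [hβ, map_mul, map_prod]
      split_ifs with hp
      · subst hp
        rw [map_zero, ← AddMonoidAlgebra.one_def, map_one]
        simp
      · by_contra h0
        apply hp
        apply Subtype.ext
        ext i
        cases i with
        | inl j =>
          have h3 := Finset.prod_ne_zero_iff.1 (left_ne_zero_of_mul h0) j (Finset.mem_univ j)
          rw [map_pow, h2] at h3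
          by_contra h4
          exact h3 (zero_pow h4)
        | inr i =>
          have h3 := hx _ (right_ne_zero_of_mul h0) i
          have h4 : ((p.1 (.inr i) : ℕ) : ℤ) = 0 := h3
          exact_mod_cast h4
    induction b using AddMonoidAlgebra.induction_linear with
    | zero => simp
    | add a b ha hb => rw [map_add, map_add, ha, hb]; rfl
    | single p c =>
      have h2 : (AddMonoidAlgebra.single p c : B) = c • AddMonoidAlgebra.single p 1 := by
        rw [AddMonoidAlgebra.smul_single, smul_eq_mul, mul_one]
      rw [h2, map_smul, map_smul, h1, ← h2, AddMonoidAlgebra.coeff_single, Finsupp.single_apply]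
      simp
  let C := Localization.AtPrime (polyOriginIdeal k (latticeMonoid Λ))
  let X (j : J) : B := AddMonoidAlgebra.single ⟨_, h.single_mem j⟩ 1
  have hβX (j) : β (X j) = algebraMap k A (x (t j))⁻¹ * t j - 1 := by
    have h1 : h.ofLattice ⟨_, h.single_mem j⟩ = 0 := by
      apply Subtype.ext
      ext i
      cases i <;> simp [IsFacetLattice.ofLattice]
    rw [hβ, h1, ← AddMonoidAlgebra.one_def, mul_one, Finset.prod_eq_single j]
    · simp
    · intro j' _ hj'
      simp [hj'.symm]
    · simp
  let s (j : J) : B := algebraMap k B (x (t j)) * (1 + X j)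
  have hβs (j) : β (s j) = t j := by
    rw [map_mul, β.commutes, map_add, map_one, hβX, add_sub_cancel, ← mul_assoc, ← map_mul,
      mul_inv_cancel₀ (htx j), map_one, one_mul]
  have hs (j) : s j ∈ (polyOriginIdeal k (latticeMonoid Λ)).primeCompl := by
    change s j ∉ polyOriginIdeal k (latticeMonoid Λ)
    rw [mem_polyOriginIdeal, ← hxβ, hβs]
    exact htx j
  let w (j : J) : Cˣ := (IsLocalization.map_units C ⟨s j, hs j⟩).unit
  have hw (j) : (w j : C) = algebraMap B C (s j) := rfl
  let α : A →ₐ[k] C := AddMonoidAlgebra.lift k C (halfMonoid Λ)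
    { toFun := fun m => ((∏ j, w j ^ m.toAdd.1 (.inl j) : Cˣ) : C) *
        algebraMap B C (AddMonoidAlgebra.single (h.toLattice m.toAdd) 1)
      map_one' := by
        rw [toAdd_one, map_zero, ← AddMonoidAlgebra.one_def, map_one]
        simp
      map_mul' := fun p q => by
        have h1 : (AddMonoidAlgebra.single (h.toLattice (p.toAdd + q.toAdd)) 1 : B) =
            AddMonoidAlgebra.single (h.toLattice p.toAdd) 1 *
              AddMonoidAlgebra.single (h.toLattice q.toAdd) 1 := by
          rw [AddMonoidAlgebra.single_mul_single, one_mul, map_add]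
        rw [toAdd_mul, h1, map_mul, mul_mul_mul_comm, ← Units.val_mul, ← Finset.prod_mul_distrib]
        congr 2
        exact Finset.prod_congr rfl fun j _ => zpow_add _ _ _ }
  have hα (m : halfMonoid Λ) : α (AddMonoidAlgebra.single m 1) =
      ((∏ j, w j ^ m.1 (.inl j) : Cˣ) : C) *
        algebraMap B C (AddMonoidAlgebra.single (h.toLattice m) 1) := by
    rw [AddMonoidAlgebra.lift_single, one_smul]
    rfl
  have hαt (j) : α (t j) = algebraMap B C (s j) := by
    have h1 : h.toLattice (h.ofUnits (Pi.single j 1)) = 0 := by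
      apply Subtype.ext
      apply expHom_injective
      rw [h.expHom_toLattice]
      ext i
      cases i <;> simp [IsFacetLattice.ofUnits]
    have h2 : (t j : A) = AddMonoidAlgebra.single (h.ofUnits (Pi.single j 1)) 1 := rfl
    rw [h2, hα, h1, ← AddMonoidAlgebra.one_def, map_one, mul_one, Finset.prod_eq_single j]
    · simp [IsFacetLattice.ofUnits, hw]
    · intro j' _ hj'
      simp [IsFacetLattice.ofUnits, hj']
    · simp
  have hβt (m) : β (AddMonoidAlgebra.single (h.toLattice m) 1) =
      AddMonoidAlgebra.single (h.ofLattice (h.toLattice m)) 1 := by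
    rw [hβ, Finset.prod_eq_one, one_mul]
    intro j _
    have : (h.toLattice m).1 (.inl j) = 0 := by simp [IsFacetLattice.toLattice]
    rw [this, pow_zero]
  have hαβ (b : B) : α (β b) = algebraMap B C b := by
    have : α.comp β = Algebra.algHom k B C := by
      refine AddMonoidAlgebra.algHom_ext (fun p => ?_) (AlgHom.ext fun c => by
        exact (AlgHom.commutes _ c).trans (AlgHom.commutes _ c).symm)
      change α (β _) = algebraMap B C _
      have h1 (j) : α (algebraMap k A (x (t j))⁻¹ * t j - 1) = algebraMap B C (X j) := by
        rw [map_sub, map_mul, map_one, α.commutes, hαt, IsScalarTower.algebraMap_apply k B C,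
          ← map_mul, ← mul_assoc, ← map_mul, inv_mul_cancel₀ (htx j), map_one, one_mul, map_add,
          map_one, add_sub_cancel_left]
      have h2 : α (AddMonoidAlgebra.single (h.ofLattice p) 1) =
          algebraMap B C (AddMonoidAlgebra.single (h.toLattice (h.ofLattice p)) 1) := by
        rw [hα, Finset.prod_eq_one, Units.val_one, one_mul]
        intro j _
        simp [IsFacetLattice.ofLattice]
      rw [hβ, map_mul, map_prod, h2, ← h.prod_single p, map_mul, map_prod]
      congr 1
      exact Finset.prod_congr rfl fun j _ => by rw [map_pow, h1, map_pow]
    exact AlgHom.congr_fun this b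
  refine ⟨β, isLocalization_atPrime_of_comp_eq (C := C) g hg α.toRingHom β.toRingHom ?_ ?_ ?_ ?_⟩
  -- Evaluation at the origin, which pulls back to `x` along `α`. So `α a` has nonzero value
  -- whenever `a` does at `x`, and is then a unit.
  · let ρ : C →+* k := IsLocalization.lift (M := (polyOriginIdeal k (latticeMonoid Λ)).primeCompl)
      (g := x.toRingHom.comp β.toRingHom) fun b => by
        have h1 : b.1 ∉ polyOriginIdeal k (latticeMonoid Λ) := b.2
        rw [mem_polyOriginIdeal, ← hxβ] at h1
        exact isUnit_iff_ne_zero.2 h1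
    have hρ (b : B) : ρ (algebraMap B C b) = x (β b) := IsLocalization.lift_eq _ b
    have hρα : ρ.comp α.toRingHom = x.toRingHom :=
      h.ringHom_ext β (fun j => ⟨_, hβs j⟩) (fun m => ⟨_, hβt m⟩) fun b =>
        (congrArg ρ (hαβ b)).trans (hρ b)
    intro a ha
    obtain ⟨⟨b, c⟩, hbc⟩ := IsLocalization.surj (polyOriginIdeal k (latticeMonoid Λ)).primeCompl
      (α a)
    have h1 : x (β b) ≠ 0 := by
      have h2 : ρ (α a) = x a := RingHom.congr_fun hρα a
      rw [← hρ, ← hbc, map_mul, hρ, h2]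
      have h3 : c.1 ∉ polyOriginIdeal k (latticeMonoid Λ) := c.2
      rw [mem_polyOriginIdeal, ← hxβ] at h3
      exact mul_ne_zero (fun h => ha ((hP a).2 h)) h3
    refine isUnit_of_mul_isUnit_left (y := algebraMap B C c) ?_
    change IsUnit (α a * algebraMap B C c)
    rw [hbc]
    exact IsLocalization.map_units C
      (⟨b, fun h => h1 (by rw [hxβ]; exact mem_polyOriginIdeal.1 h)⟩ :
        (polyOriginIdeal k (latticeMonoid Λ)).primeCompl)
  · intro b hb
    rw [hP]
    change x (β b) ≠ 0
    rw [hxβ]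
    exact fun h => hb (mem_polyOriginIdeal.2 h)
  · exact RingHom.ext hαβ
  · intro β' hβ'
    refine h.ringHom_ext β (fun j => ⟨_, hβs j⟩) (fun m => ⟨_, hβt m⟩) fun b => ?_
    exact (congrArg β' (hαβ b)).trans (RingHom.congr_fun hβ' b)

end translation

/-! ### Toric singularities as rings of series with exponents in a lattice -/

section presentation

variable {k : Type u} [Field k]

theorem IsToric.exists_equiv_supportedSeries [IsAlgClosed k] {R : Type v} [CommRing R] [Algebra k R]
    (hR : IsToric k R) : ∃ (ι : Type) (_ : Finite ι) (Λ : AddSubgroup (ι → ℤ)),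
      (∀ i, ∃ x ∈ Λ, x i = 1) ∧ (∀ i, ∃ x ∈ Λ, x i = 0 ∧ ∀ j ≠ i, 0 < x j) ∧
      Nonempty (R ≃ₐ[k] supportedSeries k (latticeMonoid Λ)) := by
  obtain ⟨r, Δ, X, p, V, x, hx, e, he⟩ := hR
  obtain ⟨σ, hσ, y, rfl, hymax, hy⟩ := V.exists_minimal_chart hx
  obtain ⟨s, hs⟩ := Δ.rational σ hσ
  have hmem (m) : m ∈ dualMonoid σ ↔ ∀ v ∈ s, 0 ≤ m ⬝ᵥ v := by
    rw [hs]
    exact mem_dualMonoid_hull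
  obtain ⟨J, I, hJ, hI, Λ, hΛ, ⟨φ⟩⟩ := exists_equiv_halfMonoid s _ hmem
  refine ⟨J ⊕ I, inferInstance, Λ, hΛ.exists_eq_one, hΛ.exists_pos, ?_⟩
  let E : AddMonoidAlgebra k (halfMonoid Λ) ≃ₐ[k] ChartRing k σ :=
    AddMonoidAlgebra.domCongr k k φ.symm
  have hE (m) : E (AddMonoidAlgebra.single m 1) = AddMonoidAlgebra.single (φ.symm m) 1 :=
    AddMonoidAlgebra.mapDomain_single
  let P : Ideal (AddMonoidAlgebra k (halfMonoid Λ)) := y.asIdeal.comap E.toRingEquiv.toRingHom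
  have hP (a) : a ∈ P ↔ E a ∈ y.asIdeal := Iff.rfl
  have hPmax : P.IsMaximal := Ideal.comap_isMaximal_of_surjective _ E.surjective
  have : AddMonoid.FG (halfMonoid Λ) :=
    (AddMonoid.fg_iff_addSubmonoid_fg _).2 (halfMonoid_fg Λ)
  obtain ⟨x, hxP⟩ := exists_algHom_of_isMaximal (k := k) P hPmax
  -- By minimality of the chart such an `m` is invertible in the monoid. The `I`-coordinates of `m`
  -- and its inverse are nonnegative with sum zero.
  have hx (m : halfMonoid Λ) (hm : x (AddMonoidAlgebra.single m 1) ≠ 0) (i : I) :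
      m.1 (.inr i) = 0 := by
    have h1 : AddMonoidAlgebra.single (φ.symm m) 1 ∉ y.asIdeal := by
      rw [← hE, ← hP, hxP]
      exact hm
    have h2 := hy _ h1
    have h3 : φ.symm m + ⟨_, h2⟩ = 0 := Subtype.ext (add_neg_cancel _)
    have h4 := congrArg φ h3
    rw [map_add, φ.apply_symm_apply, map_zero] at h4
    have h5 := congrFun (congrArg Subtype.val h4) (.inr i)
    have h6 : m.1 (.inr i) + (φ ⟨_, h2⟩).1 (.inr i) = 0 := h5
    have h7 := m.2.2 i
    have h8 := (φ ⟨_, h2⟩).2.2 i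
    omega
  have := V.isOpenImmersion σ hσ
  obtain ⟨g, hg, hgk⟩ := exists_isLocalization_stalk p (V.ι σ hσ) (V.ι_comp σ hσ) y
  have hg' := isLocalization_atPrime_comp_equiv E.toRingEquiv g y.asIdeal P hP hg
  obtain ⟨β, hβ⟩ := hΛ.isLocalization_atPrime x hxP hx _ hg'
  obtain ⟨e', he'⟩ := exists_equiv_completedStalk (latticeMonoid_fg Λ) p _ _ hβ fun c => by
    rw [← hgk]
    exact congrArg g ((congrArg E (β.commutes c)).trans (E.commutes c))
  refine ⟨AlgEquiv.ofRingEquiv (f := e.trans e'.symm) fun c => ?_⟩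
  rw [RingEquiv.trans_apply, he, ← he', e'.symm_apply_apply]

theorem coeff_renameEquiv {ι ι' : Type} (f : ι ≃ ι') (p : MvPowerSeries ι k) (m : ι →₀ ℕ) :
    MvPowerSeries.coeff (m.mapDomain f) (MvPowerSeries.renameEquiv k f p) =
      MvPowerSeries.coeff m p := by
  have h1 : (MvPowerSeries.renameEquiv k f) p = MvPowerSeries.rename f p := rfl
  have h2 := MvPowerSeries.coeff_embDomain_rename f.toEmbedding p m
  rw [Finsupp.embDomain_eq_mapDomain] at h2
  rw [h1]
  exact h2

theorem nonempty_equiv_supportedSeries_of_equiv {ι ι' : Type} (f : ι ≃ ι')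
    {P : AddSubmonoid (ι →₀ ℕ)} {P' : AddSubmonoid (ι' →₀ ℕ)}
    (hP : ∀ m, m ∈ P ↔ m.mapDomain f ∈ P') :
    Nonempty (supportedSeries k P ≃ₐ[k] supportedSeries k P') := by
  have h : (supportedSeries k P).map (MvPowerSeries.renameEquiv k f).toAlgHom =
      supportedSeries k P' := by
    have hmap (p : MvPowerSeries ι k) : MvPowerSeries.renameEquiv k f p ∈ supportedSeries k P' ↔
        p ∈ supportedSeries k P := by
      rw [mem_supportedSeries, mem_supportedSeries]
      have hsurj : Function.Surjective (Finsupp.mapDomain f : (ι →₀ ℕ) → ι' →₀ ℕ) :=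
        Finsupp.mapDomain_surjective f.surjective
      refine hsurj.forall.trans (forall_congr' fun m => ?_)
      rw [coeff_renameEquiv, hP]
    ext q
    constructor
    · rintro ⟨p, hp, rfl⟩
      exact (hmap p).2 hp
    · intro hq
      obtain ⟨p, rfl⟩ := (MvPowerSeries.renameEquiv k f).surjective q
      exact ⟨p, (hmap p).1 hq, rfl⟩
  exact ⟨((MvPowerSeries.renameEquiv k f).subalgebraMap _).trans (Subalgebra.equivOfEq _ _ h)⟩

theorem FiniteTorusSubgroup.exists_isFreeInCodimOne {n : ℕ} {ι : Type} (f : ι ≃ Fin n)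
    (Λ : AddSubgroup (ι → ℤ)) [Λ.FiniteIndex] (hΛ : ∀ i, ∃ x ∈ Λ, x i = 1) :
    ∃ G : FiniteTorusSubgroup k n, G.IsFreeInCodimOne ∧
      Nonempty (supportedSeries k (latticeMonoid Λ) ≃ₐ[k] G.invariants) := by
  let φ : (Fin n → ℤ) ≃+ (ι → ℤ) := (LinearEquiv.funCongrLeft ℤ ℤ f).toAddEquiv
  have hφ (x i) : φ x i = x (f i) := rfl
  let Λ' : AddSubgroup (Fin n → ℤ) := Λ.comap φ.toAddMonoidHom
  have hΛ' : Λ'.FiniteIndex := ⟨by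
    rw [AddSubgroup.index_comap_of_surjective (f := φ.toAddMonoidHom) Λ φ.surjective]
    exact AddSubgroup.FiniteIndex.index_ne_zero⟩
  refine ⟨.ofLattice k Λ', isFreeInCodimOne_of_forall fun i => ?_, ?_⟩
  · obtain ⟨x, hx, hx1⟩ := hΛ (f.symm i)
    rw [lattice_ofLattice]
    refine ⟨φ.symm x, ?_, ?_⟩
    · change φ (φ.symm x) ∈ Λ
      rwa [φ.apply_symm_apply]
    · rw [← hx1, ← φ.apply_symm_apply x, hφ, f.apply_symm_apply, φ.apply_symm_apply]
  · rw [invariants_eq, lattice_ofLattice]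
    refine nonempty_equiv_supportedSeries_of_equiv f fun m => ?_
    rw [mem_latticeMonoid, mem_latticeMonoid]
    have : φ (expHom _ (m.mapDomain f)) = expHom _ m := by
      ext i
      rw [hφ, expHom_apply, expHom_apply, Finsupp.mapDomain_apply f.injective]
    rw [← this]
    rfl

theorem exists_isFreeInCodimOne_of_isToric [IsAlgClosed k] {n : ℕ} {R : Type v} [CommRing R]
    [IsDomain R] [IsIntegrallyClosed R] [IsNoetherianRing R] [IsLocalRing R] [Algebra k R]
    (hdim : ringKrullDim R = n) (hR : IsToric k R) (hQ : IsQFactorial R) :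
    ∃ G : FiniteTorusSubgroup k n, G.IsFreeInCodimOne ∧ Nonempty (R ≃ₐ[k] G.invariants) := by
  classical
  obtain ⟨ι, hι, Λ, h1, hq, ⟨e⟩⟩ := hR.exists_equiv_supportedSeries
  have hfin : Λ.FiniteIndex := finiteIndex_of_forall_single_mem fun i =>
    exists_single_mem_of_isQFactorial e.toRingEquiv hQ hq (h1 i)
  have hcard := ringKrullDim_of_equiv_supportedSeries e.toRingEquiv
  rw [hdim] at hcard
  have hcard' : Nat.card ι = n := by exact_mod_cast hcard.symm
  obtain ⟨G, hG, ⟨e'⟩⟩ :=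
    FiniteTorusSubgroup.exists_isFreeInCodimOne (k := k) (Finite.equivFinOfCardEq hcard') Λ h1
  exact ⟨G, hG, ⟨e.trans e'⟩⟩

end presentation

end ToricSing

end

theorem proposition5p1 {k : Type u} [Field k] [IsAlgClosed k] (n : ℕ)
    (R : Type v) [CommRing R] [IsDomain R] [IsIntegrallyClosed R] [IsNoetherianRing R]
    [IsLocalRing R] [Algebra k R] [IsAdicComplete (IsLocalRing.maximalIdeal R) R]
    (hdim : ringKrullDim R = n) :
    (ToricSing.IsToric k R ∧ ToricSing.IsQFactorial R) ↔
      ∃ G : ToricSing.FiniteTorusSubgroup k n,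
        G.IsFreeInCodimOne ∧ Nonempty (R ≃ₐ[k] G.invariants) := by
  refine ⟨fun h => ToricSing.exists_isFreeInCodimOne_of_isToric hdim h.1 h.2, ?_⟩
  rintro ⟨G, -, ⟨e⟩⟩
  -- Needed for the generic shear behind unique factorization in `k[[x₁, …, xₙ]]`.
  have : Infinite k := IsAlgClosed.instInfinite
  rw [G.invariants_eq] at e
  exact ⟨ToricSing.isToric_of_equiv_supportedSeries R G.lattice e,
    ToricSing.isQFactorial_of_equiv_supportedSeries R G.lattice e⟩
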